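/- **Setting.** Let $\Sigma$ be a finite alphabet. A DBA $\mathcal B=(Q,q_0,\delta,F)$ accepts an infinite word iff its run visits $F$ infinitely often; it is *weak* (a wDBA) iff every strongly connected set of states is contained in $F$ or disjoint from $F$. Let $L\subseteq\Sigma^\omega$ be recognised by a wDBA, let $n$ be the least number of states of a wDBA recognising $L$, and for $u_1,u_2\in\Sigma^*$ let $u_1\backsim_L u_2$ iff for all $x\in\Sigma^*$, $y\in\Sigma^+$: $u_1xy^\omega\in L\Leftrightarrow u_2xy^\omega\in L$. A teacher for $L$ answers membership queries $\mathsf{MQ}(x,y)$ ("is $xy^\omega\in L$?", $x\in\Sigma^*,y\in\Sigma^+$) and equivalence queries ("does the wDBA $\mathcal B$ recognise $L$?"). A negative answer to the latter comes with an arbitrary counterexample, i.e. a pair $(x,y)$ with $xy^\omega$ in the symmetric difference of $L$ and the language of $\mathcal B$; its length is $|x|+|y|$. **The learning algorithm.** It maintains a finite set $S\subseteq\Sigma^*$ of representatives (initially $\{\varepsilon\}$), a finite set $E\subseteq\Sigma^*\times\Sigma^+$ of experiments (initially empty), the table $f(w,(x,y))=\mathsf{MQ}(wx,y)$ for $w\in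 S\cup S\Sigma$, $(x,y)\in E$, and a global counter $k$, initially $1$. It repeats the following round. 1. *Closing.* While some $w\in S\Sigma$ satisfies $f(w,\cdot)\ne f(s,\cdot)$ for all $s\in S$, add such a $w$ to $S$. Let $\mathcal T$ be the transition system with states $S$ and initial state $\varepsilon$, in which the $a$-successor of $s$ is the $s'\in S$ with $f(s',\cdot)=f(sa,\cdot)$. Write $\mathcal T(u)$ for the state reached on $u$. 2. *Acceptance marking.* For each state $u$ find by breadth-first search a loop word $g(u)=v\in\Sigma^+$ with $\mathcal T(uv)=u$; mark $u$ accepting iff $\mathsf{MQ}(u,v)=\top$. States without a loop word are rejecting. 3. *Conflicts.* If two states $u_1,u_2$ of one strongly connected component are marked accepting and rejecting by loop words $x$ and $y$, respectively, let $(u,v)=\mathsf{resolveConflictState}(u_1,u_2,x,y)$ and go to step 5. 4. *Conjecture.* Otherwise ask an equivalence query for $\mathcal T$ with the marked states accepting. If the answer is "yes", output this wDBA and stop. Otherwise write the counterexample as $xy^\omega$ with $\mathcal T(x)=\mathcal T(xy)=:p$. If $p$ is accepting: if $\mathsf{MQ}(p,y)=\top$ let $(u,v)=(x,y)$, else $(u,v)=\mathsf{resolveConflict}(p,g(p),y)$.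 If $p$ is rejecting: if $\mathsf{MQ}(p,y)=\bot$ let $(u,v)=(x,y)$, else $(u,v)=\mathsf{resolveConflict}(p,y,g(p))$. 5. *Refinement.* By binary search with membership queries, find $i<|u|$ for which $\mathsf{MQ}(x_i\,u[i\ldots],v)\neq\mathsf{MQ}(x_{i+1}\,u[i+1\ldots],v)$, where $x_j$ is the state of $\mathcal T$ reached on the first $j$ letters of $u$ and $u[j\ldots]$ is the rest of $u$ after these $j$ letters. Add $x_i\,u[i]$ to $S$ and $(u[i+1\ldots],v)$ to $E$. $\mathsf{resolveConflict}(u,x,y)$: for $h=1,\dots,k$, with $z=y^kx^k$, return $(uz^{h-1}y^k,x)$ if $\mathsf{MQ}(uz^{h-1}y^k,x)=\bot$, and return $(uz^h,y)$ if $\mathsf{MQ}(uz^h,y)=\top$. If nothing was returned, increase the global $k$ by one and repeat. $\mathsf{resolveConflictState}(u_1,u_2,x,y)$: find by breadth-first search $z,w\in\Sigma^+$ leading in $\mathcal T$ from $u_1$ to $u_2$ and from $u_2$ to $u_1$. If $\mathsf{MQ}(u_1,zw)=\bot$ return $\mathsf{resolveConflict}(u_1,x,zw)$; else if $\mathsf{MQ}(u_2,wz)=\top$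 return $\mathsf{resolveConflict}(u_2,wz,y)$; else return $(u_1z,wz)$. **Theorem.** There are absolute constants $C,d\in\mathbb N$ such that for all $\Sigma$, $L$ and every teacher for $L$ as above, the learning algorithm terminates, and, with $\ell$ the length of the longest counterexample returned in the run ($\ell=0$ and $\log 0:=0$ if there is none): * (correctness) its output is a wDBA that recognises $L$ and has exactly $n$ states; all of its states are reachable, and two finite words lead to the same state iff they are $\backsim_L$-equivalent (so its transition system is the canonical one); * it asks at most $n$ equivalence queries; * it asks at most $C\cdot\max\{n^2\cdot|\Sigma|,\;n\cdot\log\ell\}$ membership queries; * it runs in polynomial time: it makes at most $C\,(n+|\Sigma|+\ell)^d$ elementary steps, where asking a query costs its length and that of its answer, and list operations cost the lengths of the lists. -/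

import Mathlib

/-! ## Infinite words and weak deterministic Büchi automata -/

/-- The ultimately periodic word `x · y^ω`, as a map from positions to letters. -/
def upWord {A : Type} (x y : List A) (hy : y ≠ []) (i : ℕ) : A :=
  if h : i < x.length then x[i]
  else y[(i - x.length) % y.length]'(Nat.mod_lt _ (List.length_pos_of_ne_nil hy))

/-- A deterministic Büchi automaton: the same tuple as a DFA (complete deterministic transition
function, start state, accepting states), read on infinite words. -/
abbrev DBA (A : Type) (Q : Type) := DFA A Q

namespace DBA

variable {A Q : Type}

/-- The run on an infinite word. -/
def omegaRun (M : DBA A Q) (w : ℕ → A) : ℕ → Q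
  | 0 => M.start
  | i + 1 => M.step (M.omegaRun w i) (w i)

/-- The states that occur infinitely often in the run on `w`. -/
def infStates (M : DBA A Q) (w : ℕ → A) : Set Q :=
  {q | ∃ᶠ i in Filter.atTop, M.omegaRun w i = q}

/-- The `ω`-language recognised by the automaton (Büchi acceptance). -/
def language (M : DBA A Q) : Set (ℕ → A) :=
  {w | (M.infStates w ∩ M.accept).Nonempty}

/-- Any two different states of `C` are reachable from each other. -/
def IsSCC (M : DBA A Q) (C : Set Q) : Prop :=
  ∀ p ∈ C, ∀ q ∈ C, p ≠ q →
    ∃ u v : List A, u ≠ [] ∧ v ≠ [] ∧ M.evalFrom p u = q ∧ M.evalFrom q v = p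

/-- Weakness: each strongly connected set of states is accepting or rejecting as a whole. -/
def IsWeak (M : DBA A Q) : Prop :=
  ∀ C : Set Q, M.IsSCC C → C ⊆ M.accept ∨ Disjoint C M.accept

/-- A weak DBA with the least number of states among all weak DBAs for its language. -/
def IsMinimalWeak {n : ℕ} (D : DBA A (Fin n)) : Prop :=
  D.IsWeak ∧ ∀ (m : ℕ) (D' : DBA A (Fin m)), D'.IsWeak → D'.language = D.language → n ≤ m

end DBA

/-- The right congruence of an `ω`-language, through ultimately periodic words. -/
def RightCongr {A : Type} (L : Set (ℕ → A)) (u₁ u₂ : List A) : Prop :=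
  ∀ (x y : List A) (hy : y ≠ []), upWord (u₁ ++ x) y hy ∈ L ↔ upWord (u₂ ++ x) y hy ∈ L

/-! ## Conjectures

A transition system is stored as an association list that gives, for each state, the list of its
outgoing transitions.  States are named by words; the initial state is the empty word. -/

abbrev TransList (A : Type) := List (List A × List (A × List A))

/-- A conjecture: a transition list with the list of accepting states. -/
structure Conjecture (A : Type) where
  delta : TransList A
  acc : List (List A)

namespace Conjecture

variable {A : Type}

/-- The states of a conjecture: the words listed in the transition list (and the initial state,
which the transition lists of the learner always contain). -/
def State (B : Conjecture A) : Type := {w : List A // w = [] ∨ w ∈ B.delta.map Prod.fst}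

/-- The automaton that a conjecture describes.  (Missing transitions, which do not occur in the
conjectures of the learner, lead to the initial state.) -/
def toDBA [DecidableEq A] (B : Conjecture A) : DBA A B.State where
  step q a :=
    let r := ((B.delta.lookup q.1).bind fun l => l.lookup a).getD []
    if h : r = [] ∨ r ∈ B.delta.map Prod.fst then ⟨r, h⟩ else ⟨[], Or.inl rfl⟩
  start := ⟨[], Or.inl rfl⟩
  accept := {q | q.1 ∈ B.acc}

/-- The length of the description of a conjecture. -/
def size (B : Conjecture A) : ℕ :=
  (B.delta.map fun p => p.1.length + 1 + (p.2.map fun t => t.2.length + 2).sum).sum +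
    (B.acc.map fun w => w.length + 1).sum

end Conjecture

/-! ## Teachers -/

/-- A teacher answers membership queries `x · y^ω ∈ L?` and equivalence queries.  The answer to an
equivalence query may also depend on the number of equivalence queries asked before; it is `none`
for "yes" and a pair `(x, y)`, read as `x · y^ω`, for a counterexample. -/
structure Teacher (A : Type) where
  mq : List A → List A → Bool
  eq : ℕ → Conjecture A → Option (List A × List A)

/-- The teacher answers all membership queries, and all equivalence queries on weak DBAs, truthfully
with respect to `L`.  Nothing is assumed about its answers to other queries. -/
structure Teacher.Truthful {A : Type} [DecidableEq A] (T : Teacher A) (L : Set (ℕ → A)) :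
    Prop where
  mq_iff : ∀ (x y : List A) (hy : y ≠ []), T.mq x y = true ↔ upWord x y hy ∈ L
  eq_none : ∀ (i : ℕ) (B : Conjecture A), B.toDBA.IsWeak → T.eq i B = none → B.toDBA.language = L
  eq_some : ∀ (i : ℕ) (B : Conjecture A) (x y : List A), B.toDBA.IsWeak → T.eq i B = some (x, y) →
    ∃ hy : y ≠ [], ¬ (upWord x y hy ∈ B.toDBA.language ↔ upWord x y hy ∈ L)

/-! ## Programs with queries and a step count -/

/-- What is recorded during the run of a learner. -/
structure RunState where
  /-- the global program variable of `resolveConflict` -/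
  k : ℕ
  /-- the number of elementary steps so far -/
  time : ℕ
  /-- the number of membership queries so far -/
  mqs : ℕ
  /-- the number of equivalence queries so far -/
  eqs : ℕ
  /-- the length `|x| + |y|` of the longest counterexample `(x, y)` received so far -/
  maxCex : ℕ

/-- The start of a run: the global variable is `1`, everything else is `0`. -/
def RunState.initial : RunState := ⟨1, 0, 0, 0, 0⟩

/-- Programs that talk to a teacher; `none` stands for non-termination. -/
abbrev Learn (A : Type) := ReaderT (Teacher A) (StateT RunState Option)

/-! The cost model: the teacher is accessed only by `askMQ` and `askEQ`, which are charged for the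
length of the query and of the answer; concatenating and comparing lists is charged for their
length; each call of one of the recursive procedures below is charged at least one step, and apart
from the calls it makes it does a bounded number of elementary operations (comparison of two
letters, arithmetic on counters, construction and inspection of a pair or of a list cell), unless
it charges itself for more.  Lists are shared, not copied. -/

namespace Learner

variable {A : Type}

/-- Charge `c` steps. -/
def tick (c : ℕ) : Learn A Unit := fun _ s => some ((), { s with time := s.time + c })

/-- The membership query for `x · y^ω`. -/
def askMQ (x y : List A) : Learn A Bool := fun T s =>
  some (T.mq x y, { s with time := s.time + (x.length + y.length + 1), mqs := s.mqs + 1 })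

/-- The length of an answer to an equivalence query. -/
def answerLength : Option (List A × List A) → ℕ
  | none => 0
  | some (x, y) => x.length + y.length

/-- The equivalence query for `B`. -/
def askEQ (B : Conjecture A) : Learn A (Option (List A × List A)) := fun T s =>
  some (T.eq s.eqs B,
    { s with
      time := s.time + (B.size + answerLength (T.eq s.eqs B) + 1)
      eqs := s.eqs + 1
      maxCex := max s.maxCex (answerLength (T.eq s.eqs B)) })

/-- Read the global variable `k`. -/
def getK : Learn A ℕ := fun _ s => some (s.k, { s with time := s.time + 1 })

/-- Write the global variable `k`. -/
def setK (k : ℕ) : Learn A Unit := fun _ s => some ((), { s with k := k, time := s.time + 1 })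

/-- At most `n` iterations of a loop with the given body, which yields either a new value of the loop
variable or the result; `none` if there is no result by then. -/
def iterate {σ α : Type} (body : σ → Learn A (σ ⊕ α)) : ℕ → σ → Learn A α
  | 0, _ => fun _ _ => none
  | n + 1, x => do
    match ← body x with
    | Sum.inl x' => iterate body n x'
    | Sum.inr a => return a

open Classical in
/-- The unbounded loop with the given body: its outcome is that of sufficiently many iterations, and
it is `none` if the loop does not terminate. -/
noncomputable def loop {σ α : Type} (body : σ → Learn A (σ ⊕ α)) (x : σ) : Learn A α := fun T s =>
  if h : ∃ n, (iterate body n x T s).isSome then iterate body (Nat.find h) x T s else none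

/-- Concatenation of words. -/
def cat (u v : List A) : Learn A (List A) := do
  tick (u.length + 1)
  return u ++ v

/-- The power `y^k`. -/
def power (y : List A) : ℕ → Learn A (List A)
  | 0 => do
    tick 1
    return []
  | k + 1 => do
    let w ← power y k
    cat y w

/-- Comparison of two lists (of letters or of truth values). -/
def same {β : Type} [DecidableEq β] (u v : List β) : Learn A Bool := do
  tick (u.length + v.length + 1)
  return decide (u = v)

/-! ### The TS learner

The function `f : (S ∪ S·Σ) × E → {⊤, ⊥}` is stored as a table. -/

/-- The part of `f` that belongs to one representative `word ∈ S`: its own values on `E`, and those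
of `word · a` for each letter `a`.  The values are listed in the order of `E`. -/
structure Row (A : Type) where
  word : List A
  vals : List Bool
  ext : List (A × List Bool)

/-- The representatives `S` (with the values of `f`) and the experiments `E`. -/
structure Table (A : Type) where
  rows : List (Row A)
  exps : List (List A × List A)

/-- The values of `f` at `w` on a list of experiments. -/
def queryVals (w : List A) : List (List A × List A) → Learn A (List Bool)
  | [] => do
    tick 1
    return []
  | (x, y) :: es => do
    let wx ← cat w x
    let b ← askMQ wx y
    let bs ← queryVals w es
    return b :: bs

/-- The values of `f` at the words `w · a`, for the letters `a` of a list. -/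
def queryExt (w : List A) (es : List (List A × List A)) :
    List A → Learn A (List (A × List Bool))
  | [] => do
    tick 1
    return []
  | a :: as => do
    let wa ← cat w [a]
    let bs ← queryVals wa es
    let l ← queryExt w es as
    return (a, bs) :: l

/-- Add the representative `w` to `S`, and query the new values of `f`. -/
def addState (sig : List A) (t : Table A) (w : List A) : Learn A (Table A) := do
  let vals ← queryVals w t.exps
  let ext ← queryExt w t.exps sig
  return { rows := { word := w, vals := vals, ext := ext } :: t.rows, exps := t.exps }

/-- Extend the values of the words `w · a` by those on the new experiment `e`. -/
def addExpExt (e : List A × List A) (w : List A) :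
    List (A × List Bool) → Learn A (List (A × List Bool))
  | [] => do
    tick 1
    return []
  | (a, bs) :: l => do
    let wa ← cat w [a]
    let wax ← cat wa e.1
    let b ← askMQ wax e.2
    let l' ← addExpExt e w l
    return (a, b :: bs) :: l'

/-- Extend all rows by the values on the new experiment `e`. -/
def addExpRows (e : List A × List A) : List (Row A) → Learn A (List (Row A))
  | [] => do
    tick 1
    return []
  | r :: rs => do
    let wx ← cat r.word e.1
    let b ← askMQ wx e.2
    let ext ← addExpExt e r.word r.ext
    let rs' ← addExpRows e rs
    return { word := r.word, vals := b :: r.vals, ext := ext } :: rs'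

/-- Add the experiment `e` to `E`, and query the new values of `f`. -/
def addExp (t : Table A) (e : List A × List A) : Learn A (Table A) := do
  let rows ← addExpRows e t.rows
  return { rows := rows, exps := e :: t.exps }

/-- The representative in `S` whose values on `E` are `bs`, if there is one. -/
def findRow : List (Row A) → List Bool → Learn A (Option (List A))
  | [], _ => do
    tick 1
    return none
  | r :: rs, bs => do
    if ← same r.vals bs then
      return some r.word
    else
      findRow rs bs

/-- A word `w · a` that has the same values on `E` as no word in `S`, if there is one. -/
def findOpenExt (rows : List (Row A)) (w : List A) :
    List (A × List Bool) → Learn A (Option (List A))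
  | [] => do
    tick 1
    return none
  | (a, bs) :: l => do
    match ← findRow rows bs with
    | some _ => findOpenExt rows w l
    | none =>
      let wa ← cat w [a]
      return some wa

/-- A word in `S·Σ` that has the same values on `E` as no word in `S`, if there is one. -/
def findOpen (rows : List (Row A)) : List (Row A) → Learn A (Option (List A))
  | [] => do
    tick 1
    return none
  | r :: rs => do
    match ← findOpenExt rows r.word r.ext with
    | some w => return some w
    | none => findOpen rows rs

/-- One round of `close`. -/
def closeBody (sig : List A) (t : Table A) : Learn A (Table A ⊕ Table A) := do
  match ← findOpen t.rows t.rows with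
  | none => return Sum.inr t
  | some w =>
    let t' ← addState sig t w
    return Sum.inl t'

/-- Add representatives until each word in `S·Σ` has the same values on `E` as a word in `S`. -/
noncomputable def close (sig : List A) (t : Table A) : Learn A (Table A) :=
  loop (closeBody sig) t

/-- The outgoing transitions of one state. -/
def buildExt (rows : List (Row A)) : List (A × List Bool) → Learn A (List (A × List A))
  | [] => do
    tick 1
    return []
  | (a, bs) :: l => do
    let o ← findRow rows bs
    let l' ← buildExt rows l
    match o with
    | none => return l'
    | some w => return (a, w) :: l'

/-- The transition system of a closed table: the `a`-successor of `s ∈ S` is the word in `S` that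
has the same values on `E` as `s · a`. -/
def buildTS (rows : List (Row A)) : List (Row A) → Learn A (TransList A)
  | [] => do
    tick 1
    return []
  | r :: rs => do
    let l ← buildExt rows r.ext
    let δ ← buildTS rows rs
    return (r.word, l) :: δ

/-! ### Conflict resolution -/

/-- The inner loop of `resolveConflict`.  Here `yk = y^k`, `xk = x^k`, `p = u · z^(h-1)` with
`z = y^k · x^k`, and the number counts the remaining rounds. -/
def resolveInner (x y yk xk : List A) : ℕ → List A → Learn A (Option (List A × List A))
  | 0, _ => do
    tick 1
    return none
  | r + 1, p => do
    let p₁ ← cat p yk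
    let b₁ ← askMQ p₁ x
    if b₁ = false then
      return some (p₁, x)
    else
      let p₂ ← cat p₁ xk
      let b₂ ← askMQ p₂ y
      if b₂ = true then
        return some (p₂, y)
      else
        resolveInner x y yk xk r p₂

/-- One round of the outer loop of `resolveConflict`. -/
def resolveBody (u x y : List A) : Learn A (Unit ⊕ (List A × List A)) := do
  let k ← getK
  let yk ← power y k
  let xk ← power x k
  match ← resolveInner x y yk xk k u with
  | some c => return Sum.inr c
  | none =>
    setK (k + 1)
    return Sum.inl ()

/-- `resolveConflict(u, x, y)`: a valid counterexample from two loop words `x`, `y` of the state `u`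
with `u · x^ω ∈ L` and `u · y^ω ∉ L`. -/
noncomputable def resolveConflict (u x y : List A) : Learn A (List A × List A) :=
  loop (fun _ : Unit => resolveBody u x y) ()

variable [DecidableEq A]

/-- Search an association list for a word. -/
def lookupWord {β : Type} : List (List A × β) → List A → Learn A (Option β)
  | [], _ => do
    tick 1
    return none
  | (w, b) :: l, u => do
    if ← same w u then
      return some b
    else
      lookupWord l u

/-- Search an association list for a letter. -/
def lookupLetter {β : Type} : List (A × β) → A → Learn A (Option β)
  | [], _ => do
    tick 1
    return none
  | (c, b) :: l, a => do
    tick 1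
    if c = a then
      return some b
    else
      lookupLetter l a

/-! ### Working in a transition system -/

/-- One transition. -/
def step (δ : TransList A) (q : List A) (a : A) : Learn A (List A) := do
  match ← lookupWord δ q with
  | none => return []
  | some l =>
    match ← lookupLetter l a with
    | none => return []
    | some r => return r

/-- The state reached from `q` on a finite word. -/
def run (δ : TransList A) : List A → List A → Learn A (List A)
  | q, [] => do
    tick 1
    return q
  | q, a :: u => do
    let r ← step δ q a
    run δ r u

/-- Add to `seen` the successors of the state `r`, itself reached by the word `w`, that are new. -/
def extend (δ : TransList A) (r w : List A) :
    List A → List (List A × List A) → Learn A (List (List A × List A))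
  | [], seen => do
    tick 1
    return seen
  | a :: as, seen => do
    let r' ← step δ r a
    match ← lookupWord seen r' with
    | some _ => extend δ r w as seen
    | none =>
      let w' ← cat w [a]
      extend δ r w as ((r', w') :: seen)

/-- Add to `seen` the new successors of all states of a list. -/
def extendAll (δ : TransList A) (sig : List A) :
    List (List A × List A) → List (List A × List A) → Learn A (List (List A × List A))
  | [], seen => do
    tick 1
    return seen
  | (r, w) :: ps, seen => do
    let seen' ← extend δ r w sig seen
    extendAll δ sig ps seen'

/-- Breadth-first search for a given number of rounds. -/
def rounds (δ : TransList A) (sig : List A) :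
    ℕ → List (List A × List A) → Learn A (List (List A × List A))
  | 0, seen => do
    tick 1
    return seen
  | m + 1, seen => do
    let seen' ← extendAll δ sig seen seen
    rounds δ sig m seen'

/-- A non-empty word that leads from state `p` to state `q`, if there is one. -/
def findPath (δ : TransList A) (sig p q : List A) : Learn A (Option (List A)) := do
  tick (δ.length + 1)
  let seen ← extend δ p [] sig []
  let seen' ← rounds δ sig δ.length seen
  lookupWord seen' q

/-- `resolveConflictState(u₁, u₂, x, y)`: a valid counterexample from loop words `x` of `u₁` and `y`
of `u₂` with `u₁ · x^ω ∈ L` and `u₂ · y^ω ∉ L`, for states `u₁`, `u₂` of the same component. -/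
noncomputable def resolveConflictState (δ : TransList A) (sig u₁ u₂ x y : List A) :
    Learn A (List A × List A) := do
  let z := (← findPath δ sig u₁ u₂).getD []
  let w := (← findPath δ sig u₂ u₁).getD []
  let zw ← cat z w
  let b₁ ← askMQ u₁ zw
  if b₁ = false then
    resolveConflict u₁ x zw
  else
    let wz ← cat w z
    let b₂ ← askMQ u₂ wz
    if b₂ = true then
      resolveConflict u₂ wz y
    else
      let u₁z ← cat u₁ z
      return (u₁z, wz)

/-! ### Acceptance marking -/

/-- The marking of the states: `(u, v, b)` records the loop word `v = g(u)` of the state `u` and the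
answer `b` to the membership query for `u · v^ω`.  Transient states are not listed. -/
abbrev Marks (A : Type) := List (List A × (List A × Bool))

/-- Find loop words and mark the given states. -/
def mark (δ : TransList A) (sig : List A) : TransList A → Learn A (Marks A)
  | [] => do
    tick 1
    return []
  | (u, _) :: l => do
    let o ← findPath δ sig u u
    let g ← mark δ sig l
    match o with
    | none => return g
    | some v =>
      let b ← askMQ u v
      return (u, (v, b)) :: g

/-- A rejecting state in the same component as `u₁`, with its loop word, if there is one. -/
def findRejecting (δ : TransList A) (sig u₁ : List A) : Marks A → Learn A (Option (List A × List A))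
  | [] => do
    tick 1
    return none
  | (u₂, (y, b)) :: g => do
    if b = true then
      tick 1
      findRejecting δ sig u₁ g
    else
      let z ← findPath δ sig u₁ u₂
      let w ← findPath δ sig u₂ u₁
      if z.isSome && w.isSome then
        return some (u₂, y)
      else
        findRejecting δ sig u₁ g

/-- A conflict `(u₁, u₂, x, y)`: an accepting state `u₁` and a rejecting state `u₂` of the same
component, with their loop words `x` and `y`. -/
def findConflict (δ : TransList A) (sig : List A) (g : Marks A) :
    Marks A → Learn A (Option (List A × List A × List A × List A))
  | [] => do
    tick 1
    return none
  | (u₁, (x, b)) :: l => do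
    if b = false then
      tick 1
      findConflict δ sig g l
    else
      match ← findRejecting δ sig u₁ g with
      | some (u₂, y) => return some (u₁, u₂, x, y)
      | none => findConflict δ sig g l

/-- The conjecture with the given transitions in which exactly the states marked `⊤` accept. -/
def conjecture (δ : TransList A) (g : Marks A) : Learn A (Conjecture A) := do
  tick (g.length + 1)
  return { delta := δ, acc := (g.filter fun p => p.2.2).map Prod.fst }

/-! ### Counterexample analysis -/

/-- Append `y` to `v`, following the run from `s`, until the run is in the state `u`; the number
bounds the number of rounds. -/
def findPeriod (δ : TransList A) (u y : List A) : ℕ → List A → List A → Learn A (List A)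
  | 0, _, v => do
    tick 1
    return v
  | r + 1, s, v => do
    let s' ← run δ s y
    let v' ← cat v y
    if ← same s' u then
      return v'
    else
      findPeriod δ u y r s' v'

/-- A valid counterexample from the counterexample `x' · y'^ω` to the current conjecture.  A
normalised decomposition `(x, y)` of the word is computed first; then `u` is the state reached on
`x`, `v = g(u)`, and `b` tells whether `u` is accepting. -/
noncomputable def analyse (δ : TransList A) (g : Marks A) (x' y' : List A) : Learn A (List A × List A) := do
  tick (δ.length + 1)
  let yy ← power y' δ.length
  let x ← cat x' yy
  let u ← run δ [] x
  let y ← findPeriod δ u y' δ.length u []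
  match ← lookupWord g u with
  | none => return (x, y)
  | some (v, b) =>
    let c ← askMQ u y
    if b = true then
      if c = true then
        return (x, y)
      else
        resolveConflict u v y
    else
      if c = true then
        resolveConflict u y v
      else
        return (x, y)

/-! ### Refinement -/

/-- Binary search for an index `i` with `lo ≤ i < hi` such that the membership queries for
`x_i · u[i…] · v^ω` and `x_{i+1} · u[i+1…] · v^ω` have different answers, where `x_i` is the state
reached on the first `i` letters of `u`; `b₀` is the answer at `lo`, and the answer at `hi` is
different. -/
def search (δ : TransList A) (u v : List A) (b₀ : Bool) (lo hi : ℕ) : Learn A ℕ := do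
  if h : hi ≤ lo + 1 then
    tick 1
    return lo
  else
    let mid := (lo + hi) / 2
    tick (mid + 1)
    let s ← run δ [] (u.take mid)
    let w ← cat s (u.drop mid)
    let b ← askMQ w v
    if b = b₀ then
      search δ u v b₀ mid hi
    else
      search δ u v b₀ lo mid
termination_by hi - lo
decreasing_by all_goals omega

/-- Refine the table by a valid counterexample `(u, v)`: add one representative and one
experiment. -/
def refine (sig : List A) (t : Table A) (δ : TransList A) (u v : List A) :
    Learn A (Table A) := do
  let b₀ ← askMQ u v
  tick (u.length + 1)
  let i ← search δ u v b₀ 0 u.length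
  tick (i + 1)
  let s ← run δ [] (u.take i)
  match u.drop i with
  | [] => return t
  | a :: u' =>
    let t' ← addExp t (u', v)
    let sa ← cat s [a]
    addState sig t' sa

/-! ### The learner -/

/-- One round of the main loop: build the transition system, mark its states, and refine by a
conflict, if there is one, or else by a counterexample to the conjecture, unless the teacher accepts
it. -/
noncomputable def mainBody (sig : List A) (t₀ : Table A) :
    Learn A (Table A ⊕ Conjecture A) := do
  let t ← close sig t₀
  let δ ← buildTS t.rows t.rows
  let g ← mark δ sig δ
  match ← findConflict δ sig g g with
  | some (u₁, u₂, x, y) =>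
    let (u, v) ← resolveConflictState δ sig u₁ u₂ x y
    let t' ← refine sig t δ u v
    return Sum.inl t'
  | none =>
    let B ← conjecture δ g
    match ← askEQ B with
    | none => return Sum.inr B
    | some (x, y) =>
      let (u, v) ← analyse δ g x y
      let t' ← refine sig t δ u v
      return Sum.inl t'

/-- The learning algorithm over the alphabet listed in `sig`; it starts with `S = {ε}` and without
experiments. -/
noncomputable def learn (sig : List A) : Learn A (Conjecture A) := do
  let t ← addState sig { rows := [], exps := [] } []
  loop (mainBody sig) t

end Learner

/-! Two words that lead a wDBA for `L` to the same state agree on every experiment, so at most `n`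
words have pairwise different rows (`distinguishesAtMost`). Every refinement adds one experiment and
one representative with a new row, so there are always fewer experiments than representatives. Hence
there are fewer than `n` refinements and at most `n` equivalence queries. A conjecture is weak
because it is free of conflicts (`ConflictFree.isWeak`). Once accepted, it has at most `n` states,
which the table separates, and by minimality at least `n`, so it is canonical (`isCanonical`).

A refinement needs a word `c.1 · c.2^ω` whose membership changes when `c.1` is replaced by the state
reached on it (`IsCex`). Replacing longer and longer prefixes, one finds a letter at which the
answer flips; there the suffix separates `s · a` from its representative (`Spec.refine`,
`TableInv.refine`). Conflicts and counterexamples either give such a word at once or give two loop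
words of one state with different answers. In the latter case `resolveConflict` alternates powers of
the two loops. If all its rounds for some `k` failed, the target automaton would alternate between
accepting and rejecting states, and weakness forces these to be new each time; so `k < n`
(`lt_of_unresolved`).

Queries: a failed attempt with value `k` costs `2 * k` queries, less than `(k + 1) ^ 2 - k ^ 2`. As
`k` is global and at most `n`, all failed attempts together cost at most `n ^ 2`; `Grow` performs
this amortisation. The table has at most `n * (1 + |Σ|) * n` entries. Each round asks `O(n)` further
queries and those of the binary search, which are logarithmic in a word length polynomial in `n` and
`ℓ`.

Time: each procedure is polynomial in a common bound `M` for all lengths, and `M` is itself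
polynomial in `n`, `|Σ|` and `ℓ`. Over the empty alphabet the query bound is zero, and the run is
computed explicitly (`WP.learn_nil`). -/

namespace Learner

variable {A : Type}

/-! ### A program logic with a query and time budget -/

/-- The program terminates from the run state `s`, with an outcome that satisfies `Q`. -/
def WP {α : Type} (T : Teacher A) (m : Learn A α) (s : RunState) (Q : α → RunState → Prop) : Prop :=
  ∃ a s', m T s = some (a, s') ∧ Q a s'

theorem WP.bind {α β : Type} {T : Teacher A} {m : Learn A α} {f : α → Learn A β} {s : RunState}
    {Q : β → RunState → Prop} (h : WP T m s fun a s' => WP T (f a) s' Q) :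
    WP T (m >>= f) s Q := by
  obtain ⟨a, s', h₁, b, s'', h₂, hQ⟩ := h
  refine ⟨b, s'', ?_, hQ⟩
  change (m T s).bind (fun p => f p.1 T p.2) = _
  rw [h₁]
  exact h₂

theorem WP.mono {α : Type} {T : Teacher A} {m : Learn A α} {s : RunState}
    {Q R : α → RunState → Prop} (h : WP T m s Q) (hQR : ∀ a s', Q a s' → R a s') : WP T m s R := by
  obtain ⟨a, s', h₁, h₂⟩ := h
  exact ⟨a, s', h₁, hQR _ _ h₂⟩

theorem WP.pure {α : Type} {T : Teacher A} {a : α} {s : RunState} {Q : α → RunState → Prop}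
    (h : Q a s) : WP T (pure a : Learn A α) s Q := ⟨a, s, rfl, h⟩

/-- `s'` is reached from `s` without equivalence queries, within `t` steps and with `q` membership
queries, apart from those that are paid for by an increase of `k ^ 2`; the global variable `k` stays
bounded by `K`. -/
structure Grow (K : ℕ) (s s' : RunState) (t q : ℕ) : Prop where
  eqs : s'.eqs = s.eqs
  maxCex : s'.maxCex = s.maxCex
  k_mono : s.k ≤ s'.k
  k_le : s'.k ≤ K
  mqs : s'.mqs + s.k ^ 2 ≤ s.mqs + s'.k ^ 2 + q
  time : s'.time ≤ s.time + t

theorem Grow.mono {K t q t' q' : ℕ} {s s' : RunState} (h : Grow K s s' t q) (ht : t ≤ t')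
    (hq : q ≤ q') : Grow K s s' t' q' :=
  ⟨h.eqs, h.maxCex, h.k_mono, h.k_le, h.mqs.trans (by omega), h.time.trans (by omega)⟩

theorem Grow.mono_bound {K K' t q : ℕ} {s s' : RunState} (h : Grow K s s' t q) (hK : K ≤ K') :
    Grow K' s s' t q :=
  ⟨h.eqs, h.maxCex, h.k_mono, h.k_le.trans hK, h.mqs, h.time⟩

theorem Grow.trans {K t₁ q₁ t₂ q₂ : ℕ} {s₀ s₁ s₂ : RunState} (h₁ : Grow K s₀ s₁ t₁ q₁)
    (h₂ : Grow K s₁ s₂ t₂ q₂) : Grow K s₀ s₂ (t₁ + t₂) (q₁ + q₂) :=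
  ⟨h₂.eqs.trans h₁.eqs, h₂.maxCex.trans h₁.maxCex, h₁.k_mono.trans h₂.k_mono, h₂.k_le,
    by have := h₁.mqs; have := h₂.mqs; omega, by have := h₁.time; have := h₂.time; omega⟩

/-- From each run state with `k ≤ K` the program yields a value that satisfies `P`, within the
given budget of steps and membership queries. -/
def Spec {α : Type} (K : ℕ) (T : Teacher A) (m : Learn A α) (t q : ℕ) (P : α → Prop) : Prop :=
  ∀ s : RunState, s.k ≤ K → WP T m s fun a s' => P a ∧ Grow K s s' t q

variable {K t q t₁ q₁ : ℕ} {T : Teacher A} {α β : Type}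

/-- Budgets are passed downwards: the continuation receives what the first program leaves. A proof
can thus follow the `do` block line by line, with only linear arithmetic as side goals. -/
theorem Spec.bind {m : Learn A α} {f : α → Learn A β} {P : α → Prop} {R : β → Prop}
    (h : Spec K T m t₁ q₁ P) (hf : ∀ a, P a → Spec K T (f a) (t - t₁) (q - q₁) R)
    (ht : t₁ ≤ t) (hq : q₁ ≤ q) : Spec K T (m >>= f) t q R := by
  intro s hs
  refine WP.bind ((h s hs).mono fun a s₁ h₁ => (hf a h₁.1 s₁ h₁.2.k_le).mono fun b s₂ h₂ => ?_)
  exact ⟨h₂.1, (h₁.2.trans h₂.2).mono (by omega) (by omega)⟩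

theorem Spec.mono {m : Learn A α} {P R : α → Prop} (h : Spec K T m t₁ q₁ P)
    (hPR : ∀ a, P a → R a) (ht : t₁ ≤ t) (hq : q₁ ≤ q) : Spec K T m t q R := fun s hs =>
  (h s hs).mono fun _ _ h' => ⟨hPR _ h'.1, h'.2.mono ht hq⟩

theorem Spec.pure {a : α} {P : α → Prop} (h : P a) : Spec K T (pure a : Learn A α) t q P :=
  fun s hs => WP.pure ⟨h, rfl, rfl, le_rfl, hs, by omega, by omega⟩

theorem Spec.tick {c : ℕ} : Spec K T (tick c) c 0 fun _ => True := fun _ hs =>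
  ⟨(), _, rfl, trivial, rfl, rfl, le_rfl, hs, le_rfl, le_rfl⟩

theorem Spec.askMQ {x y : List A} :
    Spec K T (askMQ x y) (x.length + y.length + 1) 1 (· = T.mq x y) := fun _ hs =>
  ⟨_, _, rfl, rfl, rfl, rfl, le_rfl, hs, by dsimp; omega, le_rfl⟩

/-- A tick that is followed by the end of the program. -/
theorem Spec.tick_pure {c : ℕ} {a : α} {P : α → Prop} (h : P a) (ht : c ≤ t) :
    Spec K T (do Learner.tick c; return a) t q P :=
  Spec.tick.bind (fun _ _ => Spec.pure h) ht (Nat.zero_le _)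

theorem Spec.cat {u v : List A} : Spec K T (cat u v) (u.length + 1) 0 (· = u ++ v) :=
  Spec.tick_pure rfl le_rfl

theorem Spec.same {β : Type} [DecidableEq β] {u v : List β} :
    Spec K T (same (A := A) u v) (u.length + v.length + 1) 0 (· = decide (u = v)) :=
  Spec.tick_pure rfl le_rfl

theorem Spec.power {y : List A} {k : ℕ} :
    Spec K T (power y k) (k * (y.length + 1) + 1) 0 (· = (List.replicate k y).flatten) := by
  induction k with
  | zero => exact Spec.tick_pure rfl (by omega)
  | succ k ih =>
    have : (k + 1) * (y.length + 1) = k * (y.length + 1) + (y.length + 1) := by ring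
    refine ih.bind (fun w hw => ?_) (by omega) le_rfl
    subst hw
    exact Spec.cat.mono (fun a ha => by simpa [List.replicate_succ] using ha) (by omega) le_rfl

/-! ### Loops -/

theorem iterate_succ {σ : Type} {body : σ → Learn A (σ ⊕ α)} {n : ℕ} {x : σ} {s : RunState} :
    iterate body (n + 1) x T s = (body x T s).bind fun p =>
      p.1.elim (fun x' => iterate body n x' T p.2) fun a => some (a, p.2) := by
  change (body x T s).bind _ = _
  congr 1
  funext p
  rcases p with ⟨_ | _, _⟩ <;> rfl

theorem iterate_succ_eq {σ : Type} {body : σ → Learn A (σ ⊕ α)} {n : ℕ} {x : σ} {s : RunState}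
    {r : α × RunState} (h : iterate body n x T s = some r) : iterate body (n + 1) x T s = some r := by
  induction n generalizing x s with
  | zero => simp [iterate] at h
  | succ n ih =>
    rw [iterate_succ] at h ⊢
    rcases hb : body x T s with _ | ⟨_ | a, s'⟩
    · rw [hb] at h
      exact h
    · rw [hb] at h
      exact ih h
    · rw [hb] at h
      exact h

theorem iterate_eq_of_le {σ : Type} {body : σ → Learn A (σ ⊕ α)} {m n : ℕ} {x : σ} {s : RunState}
    {r : α × RunState} (h : iterate body m x T s = some r) (hmn : m ≤ n) :
    iterate body n x T s = some r := by
  induction hmn with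
  | refl => exact h
  | step _ ih => exact iterate_succ_eq ih

/-- Additional iterations do not change an outcome, so the least sufficient number chosen by `loop`
gives the same one as `n`. -/
theorem loop_eq_of_iterate {σ : Type} {body : σ → Learn A (σ ⊕ α)} {n : ℕ} {x : σ} {s : RunState}
    {r : α × RunState} (h : iterate body n x T s = some r) : loop body x T s = some r := by
  classical
  have hex : ∃ n, (iterate body n x T s).isSome := ⟨n, by simp [h]⟩
  have h₁ : loop body x T s = iterate body (Nat.find hex) x T s := by
    simp only [loop]
    rw [dif_pos hex]
  obtain ⟨r', hr'⟩ := Option.isSome_iff_exists.mp (Nat.find_spec hex)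
  rw [h₁, hr', ← h]
  exact (iterate_eq_of_le hr' (Nat.find_min' hex (by simp [h]))).symm

/-- The rule for loops with an invariant and a variant. -/
theorem WP.loop {σ : Type} {body : σ → Learn A (σ ⊕ α)} {Q : α → RunState → Prop}
    (I : σ → RunState → Prop) (μ : σ → RunState → ℕ)
    (hbody : ∀ x s, I x s → WP T (body x) s fun r s' =>
      (∀ x', r = Sum.inl x' → I x' s' ∧ μ x' s' < μ x s) ∧ ∀ a, r = Sum.inr a → Q a s')
    {x : σ} {s : RunState} (hI : I x s) : WP T (loop body x) s Q := by
  -- Induction on a strict upper bound `m` of the variant.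
  suffices h : ∀ m x s, I x s → μ x s < m → ∃ n a s', iterate body n x T s = some (a, s') ∧ Q a s' by
    obtain ⟨n, a, s', h₁, h₂⟩ := h _ x s hI (Nat.lt_succ_self _)
    exact ⟨a, s', loop_eq_of_iterate h₁, h₂⟩
  intro m
  induction m with
  | zero => intro x s _ h; omega
  | succ m ih =>
    intro x s hI hm
    obtain ⟨r, s', h₁, h₂, h₃⟩ := hbody x s hI
    rcases r with x' | a
    · obtain ⟨hI', hμ⟩ := h₂ x' rfl
      obtain ⟨n, a, s'', h₄, h₅⟩ := ih x' s' hI' (by omega)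
      exact ⟨n + 1, a, s'', by rw [iterate_succ, h₁]; exact h₄, h₅⟩
    · exact ⟨1, a, s', by rw [iterate_succ, h₁]; rfl, h₃ a rfl⟩

end Learner

namespace Learner

variable {A : Type}

/-! ### The observation table -/

/-- The values of `f` at `w`. -/
def vals (T : Teacher A) (es : List (List A × List A)) (w : List A) : List Bool :=
  es.map fun e => T.mq (w ++ e.1) e.2

/-- The row of the representative `w`. -/
def rowOf (T : Teacher A) (sig : List A) (es : List (List A × List A)) (w : List A) : Row A where
  word := w
  vals := vals T es w
  ext := sig.map fun a => (a, vals T es (w ++ [a]))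

/-- The table with representatives `ws` and experiments `es`. -/
def tableOf (T : Teacher A) (sig : List A) (ws : List (List A)) (es : List (List A × List A)) :
    Table A where
  rows := ws.map (rowOf T sig es)
  exps := es

variable {K M : ℕ} {T : Teacher A} {sig as w : List A} {ws vs : List (List A)}
  {e : List A × List A} {es : List (List A × List A)}

@[simp] theorem vals_length : (vals T es w).length = es.length := by simp [vals]

theorem Spec.queryVals (hw : w.length ≤ M) (hes : ∀ e ∈ es, e.1.length + e.2.length ≤ M) :
    Spec K T (queryVals w es) (es.length * (3 * M + 2) + 1) es.length (· = vals T es w) := by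
  induction es with
  | nil => exact Spec.tick_pure rfl (by omega)
  | cons e es ih =>
    obtain ⟨x, y⟩ := e
    have hxy : x.length + y.length ≤ M := hes (x, y) (by simp)
    rw [List.length_cons, Nat.add_one_mul]
    refine Spec.cat.bind (fun _ h => ?_) (by omega) (by omega)
    subst h
    refine Spec.askMQ.bind (fun _ h => ?_) (by grind) (by omega)
    subst h
    refine (ih fun e he => hes e (by simp [he])).bind (fun _ h => ?_) (by grind) (by omega)
    subst h
    exact Spec.pure rfl

theorem Spec.queryExt (hw : w.length < M) (hes : ∀ e ∈ es, e.1.length + e.2.length ≤ M) :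
    Spec K T (queryExt w es as) (as.length * (es.length * (3 * M + 2) + M + 1) + 1)
      (as.length * es.length) (· = as.map fun a => (a, vals T es (w ++ [a]))) := by
  induction as with
  | nil => exact Spec.tick_pure rfl (by omega)
  | cons a as ih =>
    rw [List.length_cons, Nat.add_one_mul as.length, Nat.add_one_mul as.length]
    refine Spec.cat.bind (fun _ h => ?_) (by omega) (by omega)
    subst h
    refine (Spec.queryVals (M := M) (by simp; omega) hes).bind (fun _ h => ?_) (by omega) (by omega)
    subst h
    refine ih.bind (fun _ h => ?_) (by omega) (by omega)
    subst h
    exact Spec.pure rfl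

/-- The time to add a representative. -/
def tAddState (M : ℕ) : ℕ :=
  M * (3 * M + 2) + 1 + (M * (M * (3 * M + 2) + M + 1) + 1)

theorem Spec.addState (hw : w.length < M) (hes : ∀ e ∈ es, e.1.length + e.2.length ≤ M)
    (hl : es.length ≤ M) (hsig : sig.length ≤ M) :
    Spec K T (addState sig (tableOf T sig ws es) w) (tAddState M) ((1 + sig.length) * es.length)
      (· = tableOf T sig (w :: ws) es) := by
  have h₁ : es.length * (3 * M + 2) ≤ M * (3 * M + 2) := Nat.mul_le_mul_right _ hl
  have h₂ : sig.length * (es.length * (3 * M + 2) + M + 1) ≤ M * (M * (3 * M + 2) + M + 1) :=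
    Nat.mul_le_mul hsig (by omega)
  have h₃ : (1 + sig.length) * es.length = es.length + sig.length * es.length := by ring
  rw [h₃]
  unfold tAddState
  refine (Spec.queryVals hw.le hes).bind (fun _ h => ?_) ?_ (by simp)
  · subst h
    refine (Spec.queryExt hw hes).bind (fun _ h => ?_) ?_ (by simp)
    · subst h
      exact Spec.pure rfl
    · omega
  · omega

theorem Spec.addExpExt (hw : w.length < M) (he : e.1.length + e.2.length ≤ M) :
    Spec K T (addExpExt e w (as.map fun a => (a, vals T es (w ++ [a]))))
      (as.length * (4 * M + 3) + 1) as.length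
      (· = as.map fun a => (a, vals T (e :: es) (w ++ [a]))) := by
  induction as with
  | nil => exact Spec.tick_pure rfl (by omega)
  | cons a as ih =>
    rw [List.length_cons, Nat.add_one_mul]
    refine Spec.cat.bind (fun _ h => ?_) (by omega) (by omega)
    subst h
    refine Spec.cat.bind (fun _ h => ?_) (by grind) (by omega)
    subst h
    refine Spec.askMQ.bind (fun _ h => ?_) (by grind) (by omega)
    subst h
    refine ih.bind (fun _ h => ?_) (by grind) (by omega)
    subst h
    exact Spec.pure rfl

theorem Spec.addExpRows (hws : ∀ w ∈ ws, w.length < M) (he : e.1.length + e.2.length ≤ M) :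
    Spec K T (addExpRows e (ws.map (rowOf T sig es)))
      (ws.length * (sig.length * (4 * M + 3) + 3 * M + 3) + 1) (ws.length * (1 + sig.length))
      (· = ws.map (rowOf T sig (e :: es))) := by
  induction ws with
  | nil => exact Spec.tick_pure rfl (by omega)
  | cons w ws ih =>
    have hw := hws w (by simp)
    rw [List.length_cons, Nat.add_one_mul ws.length, Nat.add_one_mul ws.length]
    refine Spec.cat.bind (fun _ h => ?_) (by simp only [rowOf]; omega) (by omega)
    subst h
    refine Spec.askMQ.bind (fun _ h => ?_) (by simp only [rowOf]; grind) (by omega)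
    subst h
    refine (Spec.addExpExt hw he).bind (fun _ h => ?_) (by simp only [rowOf]; grind) (by omega)
    subst h
    refine (ih fun w h => hws w (by simp [h])).bind (fun _ h => ?_) (by simp only [rowOf]; grind)
      (by omega)
    subst h
    exact Spec.pure rfl

/-- The time to add an experiment. -/
def tAddExp (M : ℕ) : ℕ := M * (M * (4 * M + 3) + 3 * M + 3) + 1

theorem Spec.addExp (hws : ∀ w ∈ ws, w.length < M) (he : e.1.length + e.2.length ≤ M)
    (hl : ws.length ≤ M) (hsig : sig.length ≤ M) :
    Spec K T (addExp (tableOf T sig ws es) e) (tAddExp M) (ws.length * (1 + sig.length))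
      (· = tableOf T sig ws (e :: es)) := by
  have h₁ : sig.length * (4 * M + 3) ≤ M * (4 * M + 3) := Nat.mul_le_mul_right _ hsig
  refine (Spec.addExpRows hws he).bind (fun _ h => ?_)
    (Nat.add_le_add_right (Nat.mul_le_mul hl (by omega)) 1) le_rfl
  subst h
  exact Spec.pure rfl

theorem Spec.findRow {bs : List Bool} (hbs : bs.length = es.length) :
    Spec K T (findRow (ws.map (rowOf T sig es)) bs) (ws.length * (2 * es.length + 1) + 1) 0
      (· = ws.find? fun w => vals T es w = bs) := by
  induction ws with
  | nil => exact Spec.tick_pure rfl (by omega)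
  | cons w ws ih =>
    rw [List.length_cons, Nat.add_one_mul]
    refine Spec.same.bind (fun _ h => ?_) (by simp [rowOf, hbs]; omega) le_rfl
    subst h
    by_cases hv : vals T es w = bs
    · simp only [rowOf, hv, decide_true, if_true]
      exact Spec.pure (by simp [List.find?, hv])
    · simp only [rowOf, hv, decide_false, Bool.false_eq_true, if_false]
      exact ih.mono (fun o ho => by simp [List.find?, hv, ho]) (by simp [hbs]; omega) le_rfl

/-- The time to search for a row. -/
def tFindRow (M : ℕ) : ℕ := M * (2 * M + 1) + 1

theorem Spec.findRow_le {bs : List Bool} (hbs : bs.length = es.length) (hl : ws.length ≤ M)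
    (hl' : es.length ≤ M) :
    Spec K T (Learner.findRow (ws.map (rowOf T sig es)) bs) (tFindRow M) 0
      (· = ws.find? fun w => vals T es w = bs) :=
  (Spec.findRow hbs).mono (fun _ h => h)
    (Nat.add_le_add_right (Nat.mul_le_mul hl (by omega)) 1) le_rfl

theorem Spec.findOpenExt (hw : w.length < M) (hl : ws.length ≤ M) (hl' : es.length ≤ M) :
    Spec K T (findOpenExt (ws.map (rowOf T sig es)) w (as.map fun a => (a, vals T es (w ++ [a]))))
      (as.length * tFindRow M + M + 1) 0 fun o =>
        (∀ u, o = some u → (∃ a, u = w ++ [a]) ∧ ∀ s ∈ ws, vals T es s ≠ vals T es u) ∧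
        (o = none → ∀ a ∈ as, ∃ s ∈ ws, vals T es s = vals T es (w ++ [a])) := by
  induction as with
  | nil => exact Spec.tick_pure (by simp) (by omega)
  | cons a as ih =>
    rw [List.length_cons, Nat.add_one_mul]
    refine (Spec.findRow_le (by simp) hl hl').bind (fun o ho => ?_) (by omega) le_rfl
    subst ho
    rcases hf : ws.find? fun s => vals T es s = vals T es (w ++ [a]) with _ | s
    · simp only
      refine Spec.cat.bind (fun _ h => ?_) (by omega) le_rfl
      subst h
      refine Spec.pure ⟨?_, by simp⟩
      rintro u ⟨⟩
      exact ⟨⟨a, rfl⟩, fun s hs => by simpa using List.find?_eq_none.mp hf s hs⟩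
    · simp only
      refine ih.mono (fun o ho => ⟨ho.1, fun h b hb => ?_⟩) (by omega) le_rfl
      rcases List.mem_cons.mp hb with rfl | hb
      · exact ⟨s, List.mem_of_find?_eq_some hf, by simpa using List.find?_some hf⟩
      · exact ho.2 h b hb

theorem Spec.findOpen (hvs : ∀ w ∈ vs, w.length < M) (hl : ws.length ≤ M) (hl' : es.length ≤ M) :
    Spec K T (findOpen (ws.map (rowOf T sig es)) (vs.map (rowOf T sig es)))
      (vs.length * (sig.length * tFindRow M + M + 1) + 1) 0 fun o =>
        (∀ u, o = some u → (∃ w ∈ vs, ∃ a, u = w ++ [a]) ∧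
          ∀ s ∈ ws, vals T es s ≠ vals T es u) ∧
        (o = none → ∀ w ∈ vs, ∀ a ∈ sig, ∃ s ∈ ws, vals T es s = vals T es (w ++ [a])) := by
  induction vs with
  | nil => exact Spec.tick_pure (by simp) (by omega)
  | cons w vs ih =>
    rw [List.length_cons, Nat.add_one_mul]
    refine (Spec.findOpenExt (hvs w (by simp)) hl hl').bind (fun o ho => ?_) (by omega) le_rfl
    rcases o with _ | u
    · refine (ih fun w h => hvs w (by simp [h])).mono (fun o ho' => ⟨fun u hu => ?_, fun h v hv => ?_⟩)
        (by omega) le_rfl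
      · obtain ⟨⟨w, hw, a, ha⟩, h⟩ := ho'.1 u hu
        exact ⟨⟨w, by simp [hw], a, ha⟩, h⟩
      · rcases List.mem_cons.mp hv with rfl | hv
        · exact ho.2 rfl
        · exact ho'.2 h v hv
    · refine Spec.pure ⟨?_, by simp⟩
      rintro u ⟨⟩
      obtain ⟨⟨a, ha⟩, h⟩ := ho.1 u rfl
      exact ⟨⟨w, by simp, a, ha⟩, h⟩

/-- The time of one round of `close`. -/
def tCloseBody (M : ℕ) : ℕ := M * (M * tFindRow M + M + 1) + 1 + tAddState M

/-! ### Separated representatives and the closing of the table -/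

/-- The invariant of the table. -/
structure TableInv (T : Teacher A) (W : ℕ) (ws : List (List A)) (es : List (List A × List A)) :
    Prop where
  nodup : (ws.map (vals T es)).Nodup
  nil_mem : [] ∈ ws
  pref : ∀ w ∈ ws, w = [] ∨ ∃ s ∈ ws, ∃ a, w = s ++ [a]
  length_lt : ∀ w ∈ ws, w.length < ws.length
  exps_ne_nil : ∀ e ∈ es, e.2 ≠ []
  exps_length : ∀ e ∈ es, e.1.length + e.2.length ≤ W
  exps_lt : es.length < ws.length

/-- At most `n` words can be distinguished by experiments. -/
def DistinguishesAtMost (T : Teacher A) (n : ℕ) : Prop :=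
  ∀ (ws : List (List A)) (es : List (List A × List A)), (∀ e ∈ es, e.2 ≠ []) →
    (ws.map (vals T es)).Nodup → ws.length ≤ n

/-- Each word in `S·Σ` has the same values as a word in `S`. -/
def IsClosedTable (T : Teacher A) (sig : List A) (ws : List (List A))
    (es : List (List A × List A)) : Prop :=
  ∀ w ∈ ws, ∀ a ∈ sig, ∃ s ∈ ws, vals T es s = vals T es (w ++ [a])

/-- The new word is one letter longer than an old one, while the number of words also grows by one;
this keeps lengths below the number of representatives. -/
theorem TableInv.cons {W : ℕ} (h : TableInv T W ws es) {s : List A} {a : A} (hs : s ∈ ws)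
    (hv : ∀ w ∈ ws, vals T es w ≠ vals T es (s ++ [a])) : TableInv T W ((s ++ [a]) :: ws) es where
  nodup := by
    rw [List.map_cons, List.nodup_cons]
    refine ⟨fun hm => ?_, h.nodup⟩
    obtain ⟨w, hw, hw'⟩ := List.mem_map.mp hm
    exact hv w hw hw'
  nil_mem := by simp [h.nil_mem]
  pref w hw := by
    rcases List.mem_cons.mp hw with rfl | hw
    · exact Or.inr ⟨s, by simp [hs], a, rfl⟩
    · rcases h.pref w hw with h' | ⟨s', hs', b, hb⟩
      · exact Or.inl h'
      · exact Or.inr ⟨s', by simp [hs'], b, hb⟩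
  length_lt w hw := by
    rcases List.mem_cons.mp hw with rfl | hw
    · simpa using h.length_lt s hs
    · exact (h.length_lt w hw).trans (by simp)
  exps_ne_nil := h.exps_ne_nil
  exps_length := h.exps_length
  exps_lt := h.exps_lt.trans (by simp)

/-- Old rows stay different when a column is added. The word `s · a` shared its old row with `s'`
alone, and the new column separates these two. -/
theorem TableInv.refine {W : ℕ} (h : TableInv T W ws es) {W' : ℕ} (hW : W ≤ W') {s s' : List A} {a : A}
    (hs : s ∈ ws) (hs' : s' ∈ ws) (hvals : vals T es s' = vals T es (s ++ [a]))
    {e : List A × List A} (he : e.2 ≠ []) (hel : e.1.length + e.2.length ≤ W')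
    (hne : T.mq (s' ++ e.1) e.2 ≠ T.mq (s ++ [a] ++ e.1) e.2) :
    TableInv T W' ((s ++ [a]) :: ws) (e :: es) where
  nodup := by
    have htail : ∀ w w', vals T (e :: es) w = vals T (e :: es) w' → vals T es w = vals T es w' :=
      fun w w' hw => (List.cons.inj hw).2
    have hnd : (ws.map (vals T (e :: es))).Nodup := by
      rw [List.nodup_map_iff_inj_on h.nodup.of_map]
      exact fun w hw w' hw' hww => List.inj_on_of_nodup_map h.nodup hw hw' (htail _ _ hww)
    rw [List.map_cons, List.nodup_cons]
    refine ⟨fun hm => ?_, hnd⟩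
    obtain ⟨w, hw, hww⟩ := List.mem_map.mp hm
    -- A representative that agrees with `s · a` on the old experiments can only be `s'`.
    obtain rfl := List.inj_on_of_nodup_map h.nodup hw hs' ((htail _ _ hww).trans hvals.symm)
    exact hne (List.cons.inj hww).1
  nil_mem := by simp [h.nil_mem]
  pref w hw := by
    rcases List.mem_cons.mp hw with rfl | hw
    · exact Or.inr ⟨s, by simp [hs], a, rfl⟩
    · rcases h.pref w hw with h' | ⟨s', hs', b, hb⟩
      · exact Or.inl h'
      · exact Or.inr ⟨s', by simp [hs'], b, hb⟩
  length_lt w hw := by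
    rcases List.mem_cons.mp hw with rfl | hw
    · simpa using h.length_lt s hs
    · exact (h.length_lt w hw).trans (by simp)
  exps_ne_nil e' he' := by
    rcases List.mem_cons.mp he' with rfl | he'
    · exact he
    · exact h.exps_ne_nil e' he'
  exps_length e' he' := by
    rcases List.mem_cons.mp he' with rfl | he'
    · exact hel
    · exact (h.exps_length e' he').trans hW
  exps_lt := by simpa using h.exps_lt

/-- Queries are charged to the growth of `S`: each new representative fills `(1 + |Σ|) * |E|`
entries. Separation bounds `S` by `n`, which makes `n - |S|` a variant; the extra unit in `n + 1`
pays for the last search, which finds nothing. -/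
theorem WP.close {n W : ℕ} (hn : DistinguishesAtMost T n) (hinv : TableInv T W ws es)
    (hW : W ≤ M) (hnM : n ≤ M) (hsig : sig.length ≤ M) {s : RunState} (hk : s.k ≤ K) :
    WP T (close sig (tableOf T sig ws es)) s fun t s' => ∃ ws', t = tableOf T sig ws' es ∧
      TableInv T W ws' es ∧ IsClosedTable T sig ws' es ∧ ws.length ≤ ws'.length ∧
      Grow K s s' ((n + 1) * tCloseBody M) ((ws'.length - ws.length) * ((1 + sig.length) * es.length)) := by
  refine WP.loop (fun t s' => ∃ ws', t = tableOf T sig ws' es ∧ TableInv T W ws' es ∧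
      ws.length ≤ ws'.length ∧ Grow K s s' ((ws'.length - ws.length) * tCloseBody M)
        ((ws'.length - ws.length) * ((1 + sig.length) * es.length))) (fun t _ => n - t.rows.length) ?_
    ⟨ws, rfl, hinv, le_rfl, rfl, rfl, le_rfl, hk, by omega, by omega⟩
  rintro t s₁ ⟨ws', rfl, hinv', hle, hg⟩
  have hwn : ws'.length ≤ n := hn ws' es hinv'.exps_ne_nil hinv'.nodup
  have hesM : es.length ≤ M := by have := hinv'.exps_lt; omega
  have hwM : ∀ w ∈ ws', w.length < M := fun w hw => (hinv'.length_lt w hw).trans_le (by omega)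
  have ht : ws'.length * (sig.length * tFindRow M + M + 1) ≤ M * (M * tFindRow M + M + 1) :=
    Nat.mul_le_mul (by omega) (by have := Nat.mul_le_mul_right (tFindRow M) hsig; omega)
  refine WP.bind ((Spec.findOpen (K := K) (vs := ws') hwM (by omega) hesM s₁ hg.k_le).mono ?_)
  rintro (_ | u) s₂ ⟨ho, hg₂⟩
  · refine WP.pure ⟨by simp, ?_⟩
    rintro t ⟨⟩
    refine ⟨ws', rfl, hinv', ho.2 rfl, hle, (hg.trans hg₂).mono ?_ le_rfl⟩
    have := Nat.mul_le_mul_right (tCloseBody M) (show ws'.length - ws.length ≤ n by omega)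
    rw [Nat.succ_mul]
    unfold tCloseBody at *
    omega
  · obtain ⟨⟨w, hw, a, rfl⟩, hv⟩ := ho.1 u rfl
    have hinv'' := hinv'.cons hw hv
    have hwn' : ws'.length + 1 ≤ n := hn _ es hinv''.exps_ne_nil hinv''.nodup
    have hwl := hinv'.length_lt w hw
    refine WP.bind ((Spec.addState (K := K) (M := M) (by simp; omega)
      (fun e he => (hinv'.exps_length e he).trans hW) hesM hsig s₂ hg₂.k_le).mono ?_)
    rintro _ s₃ ⟨rfl, hg₃⟩
    refine WP.pure ⟨?_, by simp⟩
    rintro t ⟨⟩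
    have hsub : ((w ++ [a]) :: ws').length - ws.length = (ws'.length - ws.length) + 1 := by
      simp; omega
    refine ⟨⟨_, rfl, hinv'', by simp; omega, ?_⟩, by simp [tableOf]; omega⟩
    rw [hsub, Nat.add_one_mul (_ - _), Nat.add_one_mul (_ - _)]
    refine ((hg.trans hg₂).trans hg₃).mono ?_ (by omega)
    unfold tCloseBody at *
    omega

end Learner

namespace Learner

variable {A : Type}

/-- The states. -/
def keys {α β : Type} (l : List (α × β)) : List α := l.map Prod.fst

@[simp] theorem keys_nil {α β : Type} : keys ([] : List (α × β)) = [] := rfl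

@[simp] theorem keys_cons {α β : Type} {p : α × β} {l : List (α × β)} :
    keys (p :: l) = p.1 :: keys l := rfl

theorem finite_state (B : Conjecture A) : Finite B.State :=
  Set.Finite.to_subtype (s := {w | w = [] ∨ w ∈ B.delta.map Prod.fst})
    (((List.finite_toSet (B.delta.map Prod.fst)).insert []).subset fun _ h => h)

variable {T : Teacher A} {K M : ℕ} {sig as : List A} {ws vs : List (List A)}
  {es : List (List A × List A)}
  {δ : TransList A} {n m : ℕ} {p q r u v w : List A} {a : A}

/-! ### The transition system of a table -/

/-- The representative with the same values as `u`. -/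
def rep (T : Teacher A) (ws : List (List A)) (es : List (List A × List A)) (u : List A) : List A :=
  (ws.find? fun s => vals T es s = vals T es u).getD []

/-- The transition system of a closed table. -/
def deltaOf (T : Teacher A) (sig : List A) (ws : List (List A)) (es : List (List A × List A)) :
    TransList A :=
  ws.map fun w => (w, sig.map fun a => (a, rep T ws es (w ++ [a])))

/-- In a closed table the default value `[]` in `rep` is never used. -/
theorem rep_spec (h : ∃ s ∈ ws, vals T es s = vals T es u) :
    rep T ws es u ∈ ws ∧ vals T es (rep T ws es u) = vals T es u := by
  rcases hf : ws.find? fun s => vals T es s = vals T es u with _ | s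
  · obtain ⟨s, hs, hs'⟩ := h
    exact absurd hs' (by simpa using List.find?_eq_none.mp hf s hs)
  · rw [rep, hf]
    exact ⟨List.mem_of_find?_eq_some hf, by simpa using List.find?_some hf⟩

theorem eq_of_vals (h : (ws.map (vals T es)).Nodup) (hu : u ∈ ws) (hv : v ∈ ws)
    (huv : vals T es u = vals T es v) : u = v :=
  List.inj_on_of_nodup_map h hu hv huv

theorem Spec.buildExt (hl : ws.length ≤ M) (hl' : es.length ≤ M)
    (hcl : ∀ a ∈ as, ∃ s ∈ ws, vals T es s = vals T es (w ++ [a])) :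
    Spec K T (buildExt (ws.map (rowOf T sig es)) (as.map fun a => (a, vals T es (w ++ [a]))))
      (as.length * tFindRow M + 1) 0 (· = as.map fun a => (a, rep T ws es (w ++ [a]))) := by
  induction as with
  | nil => exact Spec.tick_pure rfl (by omega)
  | cons a as ih =>
    rw [List.length_cons, Nat.add_one_mul]
    refine (Spec.findRow_le (by simp) hl hl').bind (fun o ho => ?_) (by omega) le_rfl
    refine (ih fun a ha => hcl a (by simp [ha])).bind (fun l hl => ?_) (by omega) le_rfl
    subst hl
    rcases hf : ws.find? fun s => vals T es s = vals T es (w ++ [a]) with _ | s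
    · obtain ⟨s, hs, hs'⟩ := hcl a (by simp)
      exact absurd hs' (by simpa using List.find?_eq_none.mp hf s hs)
    · rw [ho, hf]
      exact Spec.pure (by simp [rep, hf])

/-- The time to build the transition system. -/
def tBuildTS (M : ℕ) : ℕ := M * (M * tFindRow M + 1) + 1

theorem Spec.buildTS (hl : ws.length ≤ M) (hl' : es.length ≤ M) (hsig : sig.length ≤ M)
    (hcl : IsClosedTable T sig ws es) :
    Spec K T (buildTS (ws.map (rowOf T sig es)) (ws.map (rowOf T sig es))) (tBuildTS M) 0
      (· = deltaOf T sig ws es) := by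
  -- The recursion consumes its second argument, while rows are always searched in the full table.
  suffices h : ∀ vs : List (List A), (∀ w ∈ vs, w ∈ ws) →
      Spec K T (Learner.buildTS (ws.map (rowOf T sig es)) (vs.map (rowOf T sig es)))
        (vs.length * (M * tFindRow M + 1) + 1) 0
        (· = vs.map fun w => (w, sig.map fun a => (a, rep T ws es (w ++ [a])))) by
    exact (h ws fun _ h => h).mono (fun _ h => h)
      (Nat.add_le_add_right (Nat.mul_le_mul_right _ hl) 1) le_rfl
  intro vs hvs
  induction vs with
  | nil => exact Spec.tick_pure rfl (by omega)
  | cons w vs ih =>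
    have := Nat.mul_le_mul_right (tFindRow M) hsig
    rw [List.length_cons, Nat.add_one_mul]
    refine (Spec.buildExt hl hl' (hcl w (hvs w (by simp)))).bind (fun _ h => ?_) (by omega) le_rfl
    subst h
    refine (ih fun w h => hvs w (by simp [h])).bind (fun _ h => ?_) (by omega) le_rfl
    subst h
    exact Spec.pure rfl

theorem lookup_map_mk {α β : Type} [BEq α] [LawfulBEq α] {l : List α} {f : α → β} {x : α} (hx : x ∈ l) :
    (l.map fun y => (y, f y)).lookup x = some (f x) := by
  induction l with
  | nil => simp at hx
  | cons y l ih =>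
    by_cases h : x = y
    · subst h; simp
    · have : (x == y) = false := by simpa using h
      simp only [List.map_cons, List.lookup_cons, this]
      exact ih ((List.mem_cons.mp hx).resolve_left h)

theorem keys_deltaOf : keys (deltaOf T sig ws es) = ws := by
  simp [keys, deltaOf, Function.comp_def]

variable [DecidableEq A]

/-! ### Transition systems -/

/-- The successor of a state. -/
def succ (δ : TransList A) (q : List A) (a : A) : List A :=
  ((δ.lookup q).bind fun l => l.lookup a).getD []

/-- The state reached from `q` on `u`. -/
def reached (δ : TransList A) (q u : List A) : List A := u.foldl (succ δ) q

/-- A transition list with at most `n` states, in which each state is reached on the word that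
names it. -/
structure IsTS (δ : TransList A) (n m : ℕ) : Prop where
  nodup : (keys δ).Nodup
  nil_mem : [] ∈ keys δ
  succ_mem : ∀ q ∈ keys δ, ∀ a, succ δ q a ∈ keys δ
  reached_self : ∀ q ∈ keys δ, reached δ [] q = q
  length_le : δ.length ≤ n
  key_lt : ∀ q ∈ keys δ, q.length < n
  ext_le : ∀ p ∈ δ, p.2.length ≤ m

@[simp] theorem reached_nil : reached δ q [] = q := rfl

@[simp] theorem reached_cons : reached δ q (a :: u) = reached δ (succ δ q a) u := rfl

@[simp] theorem reached_append : reached δ q (u ++ v) = reached δ (reached δ q u) v :=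
  List.foldl_append

theorem IsTS.reached_mem (h : IsTS δ n m) (hq : q ∈ keys δ) : reached δ q u ∈ keys δ := by
  induction u generalizing q with
  | nil => exact hq
  | cons a u ih => exact ih (h.succ_mem q hq a)

/-- The states of the automaton of a conjecture. -/
theorem IsTS.mem_iff (h : IsTS δ n m) {w : List A} : (w = [] ∨ w ∈ δ.map Prod.fst) ↔ w ∈ keys δ :=
  ⟨fun hw => hw.elim (fun hw => hw ▸ h.nil_mem) id, Or.inr⟩

theorem IsTS.card_state (h : IsTS δ n m) (acc : List (List A)) :
    Nat.card (Conjecture.mk δ acc).State = δ.length := by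
  have := Nat.subtype_card (p := fun w => w = [] ∨ w ∈ δ.map Prod.fst) (keys δ).toFinset
    fun w => by rw [List.mem_toFinset, h.mem_iff]
  rw [List.toFinset_card_of_nodup h.nodup, keys, List.length_map] at this
  exact this

theorem IsTS.step_val (h : IsTS δ n m) {acc : List (List A)} (q : (Conjecture.mk δ acc).State)
    (a : A) : ((Conjecture.mk δ acc).toDBA.step q a).1 = succ δ q.1 a := by
  have hs : succ δ q.1 a = [] ∨ succ δ q.1 a ∈ δ.map Prod.fst :=
    Or.inr (h.succ_mem _ (h.mem_iff.mp q.2) a)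
  have h' : (Conjecture.mk δ acc).toDBA.step q a = ⟨succ δ q.1 a, hs⟩ := dif_pos hs
  rw [h']

theorem IsTS.evalFrom_val (h : IsTS δ n m) {acc : List (List A)} (q : (Conjecture.mk δ acc).State)
    (u : List A) : ((Conjecture.mk δ acc).toDBA.evalFrom q u).1 = reached δ q.1 u := by
  induction u generalizing q with
  | nil => rfl
  | cons a u ih => rw [DFA.evalFrom_cons, ih, h.step_val]; rfl

theorem IsTS.eval_val (h : IsTS δ n m) {acc : List (List A)} (u : List A) :
    ((Conjecture.mk δ acc).toDBA.eval u).1 = reached δ [] u := h.evalFrom_val _ u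

/-- A non-empty path can be replaced by one whose length is at most the number of states. -/
theorem IsTS.exists_short (h : IsTS δ n m) (hp : p ∈ keys δ) (hv : v ≠ []) :
    ∃ v', v' ≠ [] ∧ v'.length ≤ δ.length ∧ reached δ p v' = reached δ p v := by
  induction hl : v.length using Nat.strong_induction_on generalizing v with
  | _ l ih =>
    by_cases hle : v.length ≤ δ.length
    · exact ⟨v, hv, hle, rfl⟩
    have := finite_state (Conjecture.mk δ [])
    have := Fintype.ofFinite (Conjecture.mk δ []).State
    have hcard : Fintype.card (Conjecture.mk δ []).State = δ.length := by
      rw [← Nat.card_eq_fintype_card, h.card_state]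
    -- Pumping: a word longer than the number of states contains a loop `b`, which is cut out.
    obtain ⟨q, a, b, c, rfl, hab, hb, h₁, h₂, h₃⟩ :=
      (Conjecture.mk δ []).toDBA.evalFrom_split (x := v) (s := ⟨p, Or.inr hp⟩)
        (by rw [hcard]; omega) rfl
    have e₁ : reached δ p a = q.1 := (h.evalFrom_val _ a).symm.trans (congrArg Subtype.val h₁)
    have e₂ : reached δ q.1 b = q.1 := (h.evalFrom_val _ b).symm.trans (congrArg Subtype.val h₂)
    -- If nothing else were left, `b` would be the whole word, which is too long for `hab`.
    have hne : a ++ c ≠ [] := by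
      intro h0
      simp only [List.append_eq_nil_iff] at h0
      simp [h0.1, h0.2] at hle hab
      omega
    have hb' : 0 < b.length := List.length_pos_of_ne_nil hb
    obtain ⟨v', h₄, h₅, h₆⟩ := ih (a ++ c).length (by simp at hl ⊢; omega) hne rfl
    refine ⟨v', h₄, h₅, h₆.trans ?_⟩
    simp only [reached_append, e₁, e₂]

theorem succ_deltaOf (hw : w ∈ ws) (ha : a ∈ sig) :
    succ (deltaOf T sig ws es) w a = rep T ws es (w ++ [a]) := by
  rw [succ, deltaOf, lookup_map_mk hw, Option.bind_some, lookup_map_mk ha, Option.getD_some]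

/-- That a representative is reached on its own name follows by induction along prefixes: the
`a`-successor of `s` has the row of `s · a`, and if `s · a` is itself a representative, separation
makes the two equal. -/
theorem TableInv.isTS {W : ℕ} (h : TableInv T W ws es) (hmem : ∀ a : A, a ∈ sig)
    (hcl : IsClosedTable T sig ws es) (hn : ws.length ≤ n) :
    IsTS (deltaOf T sig ws es) n sig.length where
  nodup := by rw [keys_deltaOf]; exact h.nodup.of_map _
  nil_mem := by rw [keys_deltaOf]; exact h.nil_mem
  succ_mem q hq a := by
    rw [keys_deltaOf] at *
    rw [succ_deltaOf hq (hmem a)]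
    exact (rep_spec (hcl q hq a (hmem a))).1
  reached_self q hq := by
    rw [keys_deltaOf] at *
    induction hl : q.length using Nat.strong_induction_on generalizing q with
    | _ l ih =>
      rcases h.pref q hq with rfl | ⟨s, hs, a, rfl⟩
      · rfl
      · have := rep_spec (hcl s hs a (hmem a))
        rw [reached_append, ih s.length (by simp at hl; omega) s hs rfl]
        change succ _ s a = _
        rw [succ_deltaOf hs (hmem a)]
        exact eq_of_vals h.nodup this.1 hq this.2
  length_le := by simpa [deltaOf] using hn
  key_lt q hq := by
    rw [keys_deltaOf] at *
    exact (h.length_lt q hq).trans_le hn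
  ext_le p hp := by
    obtain ⟨w, _, rfl⟩ := List.mem_map.mp hp
    simp

theorem vals_succ_deltaOf (hmem : ∀ a : A, a ∈ sig) (hcl : IsClosedTable T sig ws es) (hw : w ∈ ws) :
    vals T es (succ (deltaOf T sig ws es) w a) = vals T es (w ++ [a]) := by
  rw [succ_deltaOf hw (hmem a)]
  exact (rep_spec (hcl w hw a (hmem a))).2

/-! ### Search in a transition system -/

/-- The time to look up a word. -/
def tLookup (M : ℕ) : ℕ := M * (2 * M + 1) + 1

theorem Spec.lookupWord {β : Type} {l : List (List A × β)} (hl : l.length ≤ M)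
    (hk : ∀ w ∈ keys l, w.length ≤ M) (hu : u.length ≤ M) :
    Spec K T (lookupWord l u) (tLookup M) 0 (· = l.lookup u) := by
  suffices h : Spec K T (Learner.lookupWord l u) (l.length * (2 * M + 1) + 1) 0 (· = l.lookup u) from
    h.mono (fun _ h => h) (Nat.add_le_add_right (Nat.mul_le_mul_right _ hl) 1) le_rfl
  clear hl
  induction l with
  | nil => exact Spec.tick_pure rfl (by omega)
  | cons p l ih =>
    obtain ⟨w, b⟩ := p
    have hw : w.length ≤ M := hk w (by simp)
    rw [List.length_cons, Nat.add_one_mul]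
    refine Spec.same.bind (fun _ h => ?_) (by omega) le_rfl
    subst h
    by_cases hwu : w = u
    · subst hwu
      simp only [decide_true, if_true]
      exact Spec.pure (by simp)
    · simp only [hwu, decide_false, Bool.false_eq_true, if_false]
      have hb : (u == w) = false := by simpa using Ne.symm hwu
      exact (ih fun w hw => hk w (by simp [hw])).mono
        (fun o ho => by simp only [List.lookup_cons, hb, ho]) (by omega) le_rfl

theorem Spec.lookupLetter {β : Type} {l : List (A × β)} :
    Spec K T (lookupLetter l a) (l.length + 1) 0 (· = l.lookup a) := by
  induction l with
  | nil => exact Spec.tick_pure rfl (by simp)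
  | cons p l ih =>
    obtain ⟨c, b⟩ := p
    rw [List.length_cons]
    refine Spec.tick.bind (fun _ _ => ?_) (by omega) le_rfl
    by_cases hca : c = a
    · subst hca
      simp only [if_true]
      exact Spec.pure (by simp)
    · simp only [hca, if_false]
      have hb : (a == c) = false := by simpa using Ne.symm hca
      exact ih.mono (fun o ho => by simp only [List.lookup_cons, hb, ho]) (by omega) le_rfl

/-- The time of one transition. -/
def tStep (M : ℕ) : ℕ := tLookup M + M + 1

theorem mem_of_lookup {α β : Type} [BEq α] [LawfulBEq α] {l : List (α × β)} {x : α} {b : β}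
    (h : l.lookup x = some b) : (x, b) ∈ l := by
  obtain ⟨l₁, l₂, rfl, _⟩ := List.lookup_eq_some_iff.mp h
  simp

theorem IsTS.length_le_of_mem (h : IsTS δ n m) (hn : n ≤ M) (hq : q ∈ keys δ) : q.length ≤ M :=
  (h.key_lt q hq).le.trans hn

theorem Spec.step (h : IsTS δ n m) (hn : n ≤ M) (hm : m ≤ M) (hq : q ∈ keys δ) :
    Spec K T (step δ q a) (tStep M) 0 (· = succ δ q a) := by
  unfold tStep
  refine (Spec.lookupWord (h.length_le.trans hn) (fun w hw => h.length_le_of_mem hn hw)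
    (h.length_le_of_mem hn hq)).bind (fun o ho => ?_) (by omega) le_rfl
  rcases o with _ | l
  · exact Spec.pure (by simp [succ, ← ho])
  · have hl := h.ext_le _ (mem_of_lookup ho.symm)
    simp only at hl
    refine Spec.lookupLetter.bind (fun o' ho' => ?_) (by omega) le_rfl
    rcases o' with _ | b <;> exact Spec.pure (by simp [succ, ← ho, ← ho'])

theorem Spec.run (h : IsTS δ n m) (hn : n ≤ M) (hm : m ≤ M) (hq : q ∈ keys δ) :
    Spec K T (run δ q u) (u.length * tStep M + 1) 0 (· = reached δ q u) := by
  induction u generalizing q with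
  | nil => exact Spec.tick_pure rfl (by omega)
  | cons a u ih =>
    rw [List.length_cons, Nat.add_one_mul]
    refine (Spec.step h hn hm hq).bind (fun _ h' => ?_) (by omega) le_rfl
    subst h'
    exact (ih (h.succ_mem q hq a)).mono (fun _ h => h) (by omega) le_rfl

/-- What the breadth-first search from `p` has found are states with non-empty words of length at
most `b` that lead there. -/
structure Found (δ : TransList A) (p : List A) (b : ℕ) (seen : List (List A × List A)) : Prop where
  nodup : (keys seen).Nodup
  path : ∀ e ∈ seen, e.2 ≠ [] ∧ e.2.length ≤ b ∧ reached δ p e.2 = e.1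

theorem Found.mono {b b' : ℕ} {seen : List (List A × List A)} (h : Found δ p b seen) (hb : b ≤ b') :
    Found δ p b' seen :=
  ⟨h.nodup, fun e he => ⟨(h.path e he).1, (h.path e he).2.1.trans hb, (h.path e he).2.2⟩⟩

theorem Found.mem_keys {b : ℕ} {seen : List (List A × List A)} (h : Found δ p b seen)
    (hδ : IsTS δ n m) (hp : p ∈ keys δ) (hq : q ∈ keys seen) : q ∈ keys δ := by
  obtain ⟨e, he, rfl⟩ := List.mem_map.mp hq
  rw [← (h.path e he).2.2]
  exact hδ.reached_mem hp

theorem Found.length_le {b : ℕ} {seen : List (List A × List A)} (h : Found δ p b seen)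
    (hδ : IsTS δ n m) (hp : p ∈ keys δ) : seen.length ≤ n := by
  have := (h.nodup.subperm fun q hq => h.mem_keys hδ hp hq).length_le
  simp only [keys, List.length_map] at this
  exact this.trans hδ.length_le

/-- The time to search the successors of a state. -/
def tExtend (M : ℕ) : ℕ := M * (tStep M + tLookup M + M + 1) + 1

variable {b : ℕ} {seen : List (List A × List A)}

theorem Spec.extend (h : IsTS δ n m) (hn : n ≤ M) (hm : m ≤ M) (hp : p ∈ keys δ)
    (hw : reached δ p w = r) (hwb : w.length < b) (hbM : b ≤ M) (hseen : Found δ p b seen)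
    (has : as.length ≤ M) :
    Spec K T (extend δ r w as seen) (tExtend M) 0 fun seen' =>
      Found δ p b seen' ∧ keys seen ⊆ keys seen' ∧ ∀ a ∈ as, succ δ r a ∈ keys seen' := by
  suffices h : Spec K T (Learner.extend δ r w as seen)
      (as.length * (tStep M + tLookup M + M + 1) + 1) 0 fun seen' =>
        Found δ p b seen' ∧ keys seen ⊆ keys seen' ∧ ∀ a ∈ as, succ δ r a ∈ keys seen' from
    h.mono (fun _ h => h) (Nat.add_le_add_right (Nat.mul_le_mul_right _ has) 1) le_rfl
  clear has
  have hr : r ∈ keys δ := hw ▸ h.reached_mem hp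
  induction as generalizing seen with
  | nil => exact Spec.tick_pure ⟨hseen, fun _ h => h, by simp⟩ (by omega)
  | cons a as ih =>
    rw [List.length_cons, Nat.add_one_mul]
    refine (Spec.step h hn hm hr).bind (fun _ h' => ?_) (by omega) le_rfl
    subst h'
    refine (Spec.lookupWord ((hseen.length_le h hp).trans hn)
      (fun q hq => h.length_le_of_mem hn (hseen.mem_keys h hp hq))
      (h.length_le_of_mem hn (h.succ_mem r hr a))).bind (fun o ho => ?_) (by omega) le_rfl
    rcases o with _ | w'
    · refine Spec.cat.bind (fun _ h' => ?_) (by omega) le_rfl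
      subst h'
      have hnew : succ δ r a ∉ keys seen := by
        intro hmem
        obtain ⟨e, he, he'⟩ := List.mem_map.mp hmem
        have := List.lookup_eq_none_iff.mp ho.symm e he
        simp [he'] at this
      have hF : Found δ p b ((succ δ r a, w ++ [a]) :: seen) := by
        refine ⟨List.nodup_cons.mpr ⟨hnew, hseen.nodup⟩, fun e he => ?_⟩
        rcases List.mem_cons.mp he with rfl | he
        · exact ⟨by simp, by simp; omega, by simp [hw]⟩
        · exact hseen.path e he
      refine (ih hF).mono (fun seen' hs => ⟨hs.1, fun q hq => hs.2.1 (by simp [hq]),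
        fun c hc => ?_⟩) (by omega) le_rfl
      rcases List.mem_cons.mp hc with rfl | hc
      · exact hs.2.1 (by simp)
      · exact hs.2.2 c hc
    · refine (ih hseen).mono (fun seen' hs => ⟨hs.1, hs.2.1, fun c hc => ?_⟩) (by omega) le_rfl
      rcases List.mem_cons.mp hc with rfl | hc
      · exact hs.2.1 (List.mem_map.mpr ⟨_, mem_of_lookup ho.symm, rfl⟩)
      · exact hs.2.2 c hc

/-- The time of one round of the search. -/
def tExtendAll (M : ℕ) : ℕ := M * tExtend M + 1

theorem Spec.extendAll (h : IsTS δ n m) (hn : n ≤ M) (hm : m ≤ M) (hp : p ∈ keys δ)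
    (hbM : b ≤ M) (hsig : sig.length ≤ M) {ps : List (List A × List A)}
    (hps : ∀ e ∈ ps, e.2.length < b ∧ reached δ p e.2 = e.1) (hlen : ps.length ≤ M)
    (hseen : Found δ p b seen) :
    Spec K T (extendAll δ sig ps seen) (tExtendAll M) 0 fun seen' =>
      Found δ p b seen' ∧ keys seen ⊆ keys seen' ∧
        ∀ q ∈ keys ps, ∀ a ∈ sig, succ δ q a ∈ keys seen' := by
  suffices h : Spec K T (Learner.extendAll δ sig ps seen) (ps.length * tExtend M + 1) 0 fun seen' =>
      Found δ p b seen' ∧ keys seen ⊆ keys seen' ∧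
        ∀ q ∈ keys ps, ∀ a ∈ sig, succ δ q a ∈ keys seen' from
    h.mono (fun _ h => h) (Nat.add_le_add_right (Nat.mul_le_mul_right _ hlen) 1) le_rfl
  clear hlen
  induction ps generalizing seen with
  | nil => exact Spec.tick_pure ⟨hseen, fun _ h => h, by simp⟩ (by omega)
  | cons e ps ih =>
    obtain ⟨r, w⟩ := e
    have he := hps (r, w) (by simp)
    rw [List.length_cons, Nat.add_one_mul]
    refine (Spec.extend h hn hm hp he.2 he.1 hbM hseen hsig).bind (fun s₁ h₁ => ?_) (by omega) le_rfl
    refine (ih (fun e he => hps e (by simp [he])) h₁.1).mono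
      (fun s₂ h₂ => ⟨h₂.1, fun q hq => h₂.2.1 (h₁.2.1 hq), fun q hq a ha => ?_⟩) (by omega) le_rfl
    rcases List.mem_cons.mp hq with rfl | hq
    · exact h₂.2.1 (h₁.2.2 a ha)
    · exact h₂.2.2 q hq a ha

/-- A round expands only the list with which it began, so the recorded words grow by at most one
letter per round. -/
theorem Spec.rounds (h : IsTS δ n m) (hn : n ≤ M) (hm : m ≤ M) (hp : p ∈ keys δ)
    (hmem : ∀ a : A, a ∈ sig) (hsig : sig.length ≤ M) {k : ℕ} (hbM : b + k ≤ M)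
    (hseen : Found δ p b seen) :
    Spec K T (rounds δ sig k seen) (k * tExtendAll M + 1) 0 fun seen' =>
      Found δ p (b + k) seen' ∧ ∀ q ∈ keys seen, ∀ v : List A, v.length ≤ k →
        reached δ q v ∈ keys seen' := by
  induction k generalizing b seen with
  | zero =>
    refine Spec.tick_pure ⟨hseen, fun q hq v hv => ?_⟩ (by omega)
    rw [List.length_eq_zero_iff.mp (Nat.le_zero.mp hv)]
    exact hq
  | succ k ih =>
    rw [Nat.add_one_mul]
    refine (Spec.extendAll h hn hm hp (b := b + 1) (by omega) hsig
      (fun e he => ⟨Nat.lt_succ_of_le (hseen.path e he).2.1, (hseen.path e he).2.2⟩)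
      ((hseen.length_le h hp).trans hn) (hseen.mono (by omega))).bind (fun s₁ h₁ => ?_)
      (by omega) le_rfl
    refine (ih (by omega) h₁.1).mono (fun s₂ h₂ => ⟨h₂.1.mono (by omega), fun q hq v hv => ?_⟩)
      (by omega) le_rfl
    rcases v with _ | ⟨a, v⟩
    · exact h₂.2 q (h₁.2.1 hq) [] (by simp)
    · exact h₂.2 _ (h₁.2.2 q hq a (hmem a)) v (by simpa using hv)

/-- The time to find a path. -/
def tFindPath (M : ℕ) : ℕ := M + 1 + tExtend M + (M * tExtendAll M + 1) + tLookup M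

/-- `o` is a non-empty word of length at most `b` that leads from `p` to `q`, if there is one. -/
def IsPathOpt (δ : TransList A) (p q : List A) (b : ℕ) (o : Option (List A)) : Prop :=
  (∀ v, o = some v → v ≠ [] ∧ v.length ≤ b ∧ reached δ p v = q) ∧
    (o = none → ∀ v, v ≠ [] → reached δ p v ≠ q)

/-- The separate first step excludes the empty path, so that loops at `p` are found as well. By
`IsTS.exists_short` one step and `δ.length` rounds reach everything that is reachable by a non-empty
word. -/
theorem Spec.findPath (h : IsTS δ n m) (hn : n + 1 ≤ M) (hm : m ≤ M) (hp : p ∈ keys δ)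
    (hq : q ∈ keys δ) (hmem : ∀ a : A, a ∈ sig) (hsig : sig.length ≤ M) :
    Spec K T (findPath δ sig p q) (tFindPath M) 0 (IsPathOpt δ p q (n + 1)) := by
  have hδ := h.length_le
  have ht : δ.length * tExtendAll M ≤ M * tExtendAll M := Nat.mul_le_mul_right _ (by omega)
  unfold tFindPath
  refine Spec.tick.bind (fun _ _ => ?_) (by omega) le_rfl
  refine (Spec.extend h (by omega) hm hp (w := []) rfl (b := 1) (by simp) (by omega)
    ⟨by simp, by simp⟩ hsig).bind (fun s₁ h₁ => ?_) (by omega) le_rfl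
  refine (Spec.rounds h (by omega) hm hp hmem hsig (by omega) h₁.1).bind (fun s₂ h₂ => ?_)
    (by omega) le_rfl
  refine (Spec.lookupWord (M := M) ((h₂.1.length_le h hp).trans (by omega))
    (fun q hq => h.length_le_of_mem (by omega) (h₂.1.mem_keys h hp hq))
    (h.length_le_of_mem (by omega) hq)).mono (fun o ho => ⟨?_, ?_⟩) (by omega) le_rfl
  · rintro v rfl
    have := h₂.1.path _ (mem_of_lookup ho.symm)
    exact ⟨this.1, this.2.1.trans (by omega), this.2.2⟩
  · rintro rfl v hv hpv
    obtain ⟨v', h₃, h₄, h₅⟩ := h.exists_short hp hv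
    rcases v' with _ | ⟨a, v'⟩
    · exact h₃ rfl
    have hmem' : reached δ p (a :: v') ∈ keys s₂ :=
      h₂.2 _ (h₁.2.2 a (hmem a)) v' (by simp at h₄; omega)
    rw [h₅, hpv] at hmem'
    obtain ⟨e, he, he'⟩ := List.mem_map.mp hmem'
    have := List.lookup_eq_none_iff.mp ho.symm e he
    simp [he'] at this

end Learner

namespace DBA

variable {A Q : Type}

/-! ### Runs on ultimately periodic words -/

/-- This transfers questions about infinite runs to evaluations of finite prefixes. -/
theorem omegaRun_eq_eval (M : DBA A Q) (w : ℕ → A) (i : ℕ) :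
    M.omegaRun w i = M.eval ((List.range i).map w) := by
  induction i with
  | zero => rfl
  | succ i ih => simp [omegaRun, List.range_succ, ih, DFA.eval_append_singleton]

theorem getElem?_flatten_replicate {y : List A} {j i : ℕ} (hi : i < j * y.length) :
    (List.replicate j y).flatten[i]? = y[i % y.length]? := by
  induction j generalizing i with
  | zero => simp at hi
  | succ j ih =>
    rw [List.replicate_succ, List.flatten_cons, List.getElem?_append]
    split_ifs with h
    · rw [Nat.mod_eq_of_lt h]
    · rw [Nat.add_one_mul] at hi
      rw [ih (by omega), Nat.mod_eq_sub_mod (a := i) (by omega)]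

theorem length_flatten_replicate {y : List A} {j : ℕ} :
    (List.replicate j y).flatten.length = j * y.length := by
  simp

theorem getElem?_append_flatten_replicate {x y : List A} (hy : y ≠ []) {j i : ℕ}
    (hi : i < x.length + j * y.length) :
    (x ++ (List.replicate j y).flatten)[i]? = some (upWord x y hy i) := by
  rw [List.getElem?_append, upWord]
  split_ifs with h
  · simp [h]
  · rw [getElem?_flatten_replicate (by omega), List.getElem?_eq_getElem]

theorem map_range_upWord {x y : List A} (hy : y ≠ []) (j : ℕ) :
    (List.range (x.length + j * y.length)).map (upWord x y hy) =
      x ++ (List.replicate j y).flatten := by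
  apply List.ext_getElem?
  intro i
  by_cases hi : i < x.length + j * y.length
  · rw [getElem?_append_flatten_replicate hy hi]
    simp [hi]
  · rw [List.getElem?_eq_none (by simpa using hi), List.getElem?_eq_none]
    rw [List.length_append, length_flatten_replicate]
    omega

/-- One direction suffices: the prefixes on the left become arbitrarily long and thus determine
every letter of both words. -/
theorem upWord_eq_of_prefix {x y x' y' : List A} (hy : y ≠ []) (hy' : y' ≠ [])
    (h : ∀ j, ∃ j', x ++ (List.replicate j y).flatten <+: x' ++ (List.replicate j' y').flatten) :
    upWord x y hy = upWord x' y' hy' := by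
  funext i
  have hpos : 0 < y.length := List.length_pos_of_ne_nil hy
  have hi : i < x.length + (i + 1) * y.length := by nlinarith
  obtain ⟨j', t, ht⟩ := h (i + 1)
  have h₁ := getElem?_append_flatten_replicate (x := x) hy hi
  have hlen : i < (x ++ (List.replicate (i + 1) y).flatten).length := by
    rw [List.length_append, length_flatten_replicate]; exact hi
  have h₂ : (x' ++ (List.replicate j' y').flatten)[i]? = some (upWord x y hy i) := by
    rw [← ht, List.getElem?_append_left hlen, h₁]
  have hlen' : i < x'.length + j' * y'.length := by
    have := congrArg List.length ht
    rw [List.length_append, List.length_append (as := x'), length_flatten_replicate] at this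
    omega
  rw [getElem?_append_flatten_replicate hy' hlen'] at h₂
  exact (Option.some_injective _ h₂).symm

theorem append_flatten_replicate_comm (z w : List A) (j : ℕ) :
    z ++ (List.replicate j (w ++ z)).flatten = (List.replicate j (z ++ w)).flatten ++ z := by
  induction j with
  | zero => simp
  | succ j ih =>
    simp only [List.replicate_succ, List.flatten_cons, List.append_assoc]
    rw [← ih]

theorem upWord_rotate {u z w : List A} (h₁ : w ++ z ≠ []) (h₂ : z ++ w ≠ []) :
    upWord (u ++ z) (w ++ z) h₁ = upWord u (z ++ w) h₂ := by
  refine (upWord_eq_of_prefix h₂ h₁ fun j => ⟨j, ?_⟩).symm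
  rw [List.append_assoc, append_flatten_replicate_comm, ← List.append_assoc]
  exact List.prefix_append _ _

theorem flatten_replicate_add (y : List A) (i j : ℕ) :
    (List.replicate (i + j) y).flatten =
      (List.replicate i y).flatten ++ (List.replicate j y).flatten := by
  rw [List.replicate_add, List.flatten_append]

theorem flatten_replicate_mul (y : List A) (i j : ℕ) :
    (List.replicate i (List.replicate j y).flatten).flatten = (List.replicate (i * j) y).flatten := by
  induction i with
  | zero => simp
  | succ i ih =>
    rw [List.replicate_succ, List.flatten_cons, ih, ← flatten_replicate_add]
    congr 2
    ring

theorem upWord_unroll {x y : List A} {m r : ℕ} (hy : y ≠ [])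
    (hy' : (List.replicate r y).flatten ≠ []) :
    upWord (x ++ (List.replicate m y).flatten) (List.replicate r y).flatten hy' =
      upWord x y hy := by
  refine upWord_eq_of_prefix hy' hy fun j => ⟨m + j * r, ?_⟩
  rw [flatten_replicate_mul, flatten_replicate_add, List.append_assoc]

theorem evalFrom_flatten_replicate (M : DBA A Q) (q : Q) (y : List A) (j : ℕ) :
    M.evalFrom q (List.replicate j y).flatten = (fun q => M.evalFrom q y)^[j] q := by
  induction j generalizing q with
  | zero => rfl
  | succ j ih =>
    rw [List.replicate_succ, List.flatten_cons, DFA.evalFrom_of_append, ih, Function.iterate_succ_apply]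

/-! ### Weak automata -/

/-- The connecting paths in `IsSCC` may leave the set, so weakness applies to the pair `{p, q}`
itself. -/
theorem IsWeak.accept_iff_of_cycle {M : DBA A Q} (hM : M.IsWeak) {p q : Q} {u v : List A}
    (hu : M.evalFrom p u = q) (hv : M.evalFrom q v = p) : p ∈ M.accept ↔ q ∈ M.accept := by
  by_cases hpq : p = q
  · rw [hpq]
  have hu' : u ≠ [] := fun h => hpq (by rw [← hu, h]; rfl)
  have hv' : v ≠ [] := fun h => hpq (by rw [← hv, h]; rfl)
  have hC : M.IsSCC {p, q} := by
    intro a ha b hb hab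
    rcases ha with rfl | rfl <;> rcases hb with rfl | rfl
    · exact absurd rfl hab
    · exact ⟨u, v, hu', hv', hu, hv⟩
    · exact ⟨v, u, hv', hu', hv, hu⟩
    · exact absurd rfl hab
  rcases hM _ hC with h | h
  · exact ⟨fun _ => h (by simp), fun _ => h (by simp)⟩
  · rw [Set.disjoint_left] at h
    exact ⟨fun h' => absurd h' (h (by simp)), fun h' => absurd h' (h (by simp))⟩

theorem exists_evalFrom_of_mem_infStates {M : DBA A Q} {w : ℕ → A} {p q : Q}
    (hp : p ∈ M.infStates w) (hq : q ∈ M.infStates w) : ∃ u, M.evalFrom p u = q := by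
  obtain ⟨i, hi⟩ := Filter.Frequently.exists hp
  obtain ⟨j, hij, hj⟩ := Filter.frequently_atTop.mp hq i
  obtain ⟨d, rfl⟩ := Nat.exists_eq_add_of_le hij
  refine ⟨((List.range d).map (i + ·)).map w, ?_⟩
  rw [omegaRun_eq_eval] at hi hj
  rw [List.range_add, List.map_append, DFA.eval, DFA.evalFrom_of_append] at hj
  rw [← hj, ← hi]
  rfl

/-- States visited infinitely often reach each other, so in a weak automaton any one of them decides
acceptance. -/
theorem IsWeak.mem_language_iff {M : DBA A Q} (hM : M.IsWeak) {w : ℕ → A} {p : Q}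
    (hp : p ∈ M.infStates w) : w ∈ M.language ↔ p ∈ M.accept := by
  refine ⟨fun ⟨q, hq, hacc⟩ => ?_, fun h => ⟨p, hp, h⟩⟩
  obtain ⟨u, hu⟩ := exists_evalFrom_of_mem_infStates hp hq
  obtain ⟨v, hv⟩ := exists_evalFrom_of_mem_infStates hq hp
  exact (hM.accept_iff_of_cycle hu hv).mpr hacc

/-- Acceptance of `x · y^ω` by a weak automaton is decided in a state on the cycle of `y`. -/
theorem IsWeak.upWord_mem_iff {M : DBA A Q} (hM : M.IsWeak) {x y : List A} (hy : y ≠ []) {m r : ℕ}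
    (hr : 0 < r) (hcyc : M.evalFrom (M.eval (x ++ (List.replicate m y).flatten))
      (List.replicate r y).flatten = M.eval (x ++ (List.replicate m y).flatten)) :
    upWord x y hy ∈ M.language ↔ M.eval (x ++ (List.replicate m y).flatten) ∈ M.accept := by
  refine hM.mem_language_iff (Filter.frequently_atTop.mpr fun N => ?_)
  have hpos : 0 < y.length := List.length_pos_of_ne_nil hy
  -- After `x · y^m` and `N` further turns of the cycle `y^r` the run is in the same state again.
  refine ⟨x.length + (m + N * r) * y.length, ?_, ?_⟩
  · have : N * 1 ≤ N * r := Nat.mul_le_mul_left _ hr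
    nlinarith
  · rw [omegaRun_eq_eval, map_range_upWord, flatten_replicate_add, ← List.append_assoc]
    rw [DFA.eval, DFA.evalFrom_of_append, ← flatten_replicate_mul, evalFrom_flatten_replicate]
    exact Function.iterate_fixed hcyc N

/-- Two of the iterates with exponents up to `Nat.card Q` coincide, and from the earlier of them on
the sequence is periodic. -/
theorem exists_iterate_cycle {Q : Type} [Finite Q] (f : Q → Q) (q : Q) {k : ℕ} (hk : Nat.card Q ≤ k) :
    ∃ r, 0 < r ∧ r ≤ Nat.card Q ∧ f^[r] (f^[k] q) = f^[k] q := by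
  have := Fintype.ofFinite Q
  obtain ⟨i, j, hij, heq⟩ : ∃ i j : Fin (Nat.card Q + 1), i ≠ j ∧ f^[i] q = f^[j] q :=
    Fintype.exists_ne_map_eq_of_card_lt _ (by simp [Nat.card_eq_fintype_card])
  wlog hlt : i < j generalizing i j
  · exact this j i hij.symm heq.symm (lt_of_le_of_ne (not_lt.mp hlt) hij.symm)
  have hlt' : (i : ℕ) < j := hlt
  have hj := j.2
  refine ⟨j - i, by omega, by omega, ?_⟩
  have e₁ : (j : ℕ) - i + k = (k - i) + j := by omega
  have e₂ : k = (k - i) + i := by omega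
  rw [← Function.iterate_add_apply, e₁, Function.iterate_add_apply, ← heq,
    ← Function.iterate_add_apply, ← e₂]

theorem exists_cycle [Finite Q] (M : DBA A Q) (q : Q) (y : List A) {k : ℕ} (hk : Nat.card Q ≤ k) :
    ∃ r, 0 < r ∧ r ≤ Nat.card Q ∧
      M.evalFrom (M.evalFrom q (List.replicate k y).flatten) (List.replicate r y).flatten =
        M.evalFrom q (List.replicate k y).flatten := by
  simp only [evalFrom_flatten_replicate]
  exact exists_iterate_cycle _ q hk

/-- After as many copies of `y` as there are states, the run is on the cycle of `y`. A membership
query thus becomes a question about a single state. -/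
theorem IsWeak.upWord_mem_iff_of_card_le [Finite Q] {M : DBA A Q} (hM : M.IsWeak) {x y : List A}
    (hy : y ≠ []) {k : ℕ} (hk : Nat.card Q ≤ k) :
    upWord x y hy ∈ M.language ↔ M.eval (x ++ (List.replicate k y).flatten) ∈ M.accept := by
  obtain ⟨r, hr, _, h⟩ := M.exists_cycle (M.eval x) y hk
  refine hM.upWord_mem_iff hy hr ?_
  rw [DFA.eval, DFA.evalFrom_of_append]
  exact h

theorem IsWeak.rightCongr_of_eval_eq [Finite Q] {M : DBA A Q} (hM : M.IsWeak) {u v : List A}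
    (h : M.eval u = M.eval v) : RightCongr M.language u v := by
  intro x y hy
  rw [hM.upWord_mem_iff_of_card_le hy le_rfl, hM.upWord_mem_iff_of_card_le hy le_rfl]
  simp only [DFA.eval, DFA.evalFrom_of_append] at h ⊢
  rw [h]

/-- Minimality speaks only of state sets `Fin m`; the automaton is transported along a bijection `Q
≃ Fin (Nat.card Q)`. -/
theorem IsMinimalWeak.card_le {n : ℕ} {D : DBA A (Fin n)} (hD : D.IsMinimalWeak) [Finite Q]
    {M : DBA A Q} (hM : M.IsWeak) (hL : M.language = D.language) : n ≤ Nat.card Q := by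
  let e := Finite.equivFin Q
  let M' : DBA A (Fin (Nat.card Q)) := DFA.reindex e M
  have hstep : ∀ q a, M'.step (e q) a = e (M.step q a) := fun q a => by simp [M']
  have heval : ∀ u q, M'.evalFrom (e q) u = e (M.evalFrom q u) := by
    intro u
    induction u with
    | nil => exact fun _ => rfl
    | cons a u ih => intro q; rw [DFA.evalFrom_cons, DFA.evalFrom_cons, hstep, ih]
  have hacc : ∀ q, e q ∈ M'.accept ↔ q ∈ M.accept := fun q => by simp [M']
  have hrun : ∀ w i, M'.omegaRun w i = e (M.omegaRun w i) := fun w i => by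
    rw [omegaRun_eq_eval, omegaRun_eq_eval]
    exact heval _ _
  have hinf : ∀ w q, e q ∈ M'.infStates w ↔ q ∈ M.infStates w := fun w q => by
    simp [infStates, hrun]
  refine hD.2 _ M' ?_ (Eq.trans ?_ hL)
  · intro C hC
    have hC' : M.IsSCC (e ⁻¹' C) := by
      intro p hp q hq hpq
      obtain ⟨u, v, hu, hv, h₁, h₂⟩ := hC _ hp _ hq (e.injective.ne hpq)
      exact ⟨u, v, hu, hv, e.injective (by rw [← heval, h₁]), e.injective (by rw [← heval, h₂])⟩
    rcases hM _ hC' with h | h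
    · refine Or.inl fun q hq => ?_
      rw [← e.apply_symm_apply q, hacc]
      exact h (by simpa using hq)
    · refine Or.inr (Set.disjoint_left.mpr fun q hq => ?_)
      rw [← e.apply_symm_apply q, hacc]
      exact Set.disjoint_left.mp h (by simpa using hq)
  · ext w
    constructor
    · rintro ⟨q, hq, hq'⟩
      obtain ⟨q, rfl⟩ := e.surjective q
      exact ⟨q, (hinf w q).mp hq, (hacc q).mp hq'⟩
    · rintro ⟨q, hq, hq'⟩
      exact ⟨e q, (hinf w q).mpr hq, (hacc q).mpr hq'⟩

end DBA

/-! ### The number of words that experiments can separate -/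

namespace Learner

variable {A : Type} {n : ℕ} {D : DBA A (Fin n)}

theorem vals_eq_of_rightCongr [DecidableEq A] {T : Teacher A} {L : Set (ℕ → A)} (hT : T.Truthful L)
    {es : List (List A × List A)} (hes : ∀ e ∈ es, e.2 ≠ []) {u v : List A}
    (h : RightCongr L u v) : vals T es u = vals T es v := by
  refine List.map_congr_left fun e he => Bool.eq_iff_iff.mpr ?_
  rw [hT.mq_iff _ _ (hes e he), hT.mq_iff _ _ (hes e he)]
  exact h _ _ _

/-- Words with different rows lead to different states of `D`, of which there are `n`. -/
theorem distinguishesAtMost [DecidableEq A] {T : Teacher A} (hD : D.IsWeak)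
    (hT : T.Truthful D.language) : DistinguishesAtMost T n := by
  intro ws es hes hnd
  have : (ws.map D.eval).Nodup := by
    rw [List.nodup_map_iff_inj_on hnd.of_map]
    exact fun u hu v hv huv => List.inj_on_of_nodup_map hnd hu hv
      (vals_eq_of_rightCongr hT hes (hD.rightCongr_of_eval_eq huv))
  simpa using this.length_le_card

theorem card_pos (D : DBA A (Fin n)) : 0 < n := D.start.pos

end Learner

namespace Learner

variable {A : Type} {n K M : ℕ} {T : Teacher A} {u x y : List A}

/-! ### Conflict resolution -/

theorem Spec.resolveInner {yk xk p : List A} {r : ℕ}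
    (hM : p.length + r * (yk ++ xk).length ≤ M) (hx : x.length ≤ M) (hy : y.length ≤ M) :
    Spec K T (resolveInner x y yk xk r p) (r * (6 * M + 4) + 1) (2 * r) fun o =>
      (∀ c, o = some c → ∃ j < r,
        (c = (p ++ (List.replicate j (yk ++ xk)).flatten ++ yk, x) ∧ T.mq c.1 c.2 = false) ∨
        (c = (p ++ (List.replicate (j + 1) (yk ++ xk)).flatten, y) ∧ T.mq c.1 c.2 = true)) ∧
      (o = none → ∀ j < r,
        T.mq (p ++ (List.replicate j (yk ++ xk)).flatten ++ yk) x = true ∧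
        T.mq (p ++ (List.replicate (j + 1) (yk ++ xk)).flatten) y = false) := by
  induction r generalizing p with
  | zero => exact Spec.tick_pure (by simp) (by omega)
  | succ r ih =>
    rw [Nat.add_one_mul, List.length_append] at hM
    rw [Nat.add_one_mul]
    refine Spec.cat.bind (fun _ h => ?_) (by omega) (by omega)
    subst h
    refine Spec.askMQ.bind (fun _ h => ?_) (by grind) (by omega)
    subst h
    by_cases h₁ : T.mq (p ++ yk) x = false
    · rw [if_pos h₁]
      refine Spec.pure ⟨?_, by simp⟩
      rintro c ⟨⟩
      exact ⟨0, by omega, Or.inl ⟨by simp, h₁⟩⟩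
    rw [if_neg h₁]
    refine Spec.cat.bind (fun _ h => ?_) (by grind) (by omega)
    subst h
    refine Spec.askMQ.bind (fun _ h => ?_) (by grind) (by omega)
    subst h
    by_cases h₂ : T.mq (p ++ yk ++ xk) y = true
    · rw [if_pos h₂]
      refine Spec.pure ⟨?_, by simp⟩
      rintro c ⟨⟩
      exact ⟨0, by omega, Or.inr ⟨by simp, h₂⟩⟩
    rw [if_neg h₂]
    have hshift : ∀ j, p ++ yk ++ xk ++ (List.replicate j (yk ++ xk)).flatten =
        p ++ (List.replicate (j + 1) (yk ++ xk)).flatten := fun j => by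
      simp [List.replicate_succ]
    refine (ih (p := p ++ yk ++ xk) (by simp only [List.length_append] at hM ⊢; omega)).mono
      (fun o ho => ⟨fun c hc => ?_, fun hn j hj => ?_⟩) (by grind) (by omega)
    · obtain ⟨j, hj, h⟩ := ho.1 c hc
      rw [hshift, hshift] at h
      exact ⟨j + 1, by omega, h⟩
    · rcases j with _ | j
      · simpa using And.intro h₁ h₂
      · have := ho.2 hn j (by omega)
        rwa [hshift, hshift] at this

/-- If the rounds of `resolveConflict` fail for `k`, then `k` is less than the number of states of a
weak automaton for the language. -/
theorem lt_of_unresolved [DecidableEq A] {D : DBA A (Fin n)} (hD : D.IsWeak)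
    (hT : T.Truthful D.language) (hx : x ≠ []) (hy : y ≠ []) {k : ℕ} {yk xk : List A}
    (hyk : yk = (List.replicate k y).flatten) (hxk : xk = (List.replicate k x).flatten)
    (hu : T.mq u y = false)
    (h : ∀ j < k, T.mq (u ++ (List.replicate j (yk ++ xk)).flatten ++ yk) x = true ∧
        T.mq (u ++ (List.replicate (j + 1) (yk ++ xk)).flatten) y = false) : k < n := by
  by_contra! hnk
  set z := yk ++ xk with hz
  -- These are the states of `D` after `u · z^i · y^k` and after `u · z^(i+1)`.
  set a : ℕ → Fin n := fun i => D.eval (u ++ (List.replicate i z).flatten ++ yk) with ha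
  set b : ℕ → Fin n := fun i => D.evalFrom (a i) xk with hb
  -- As `k ≥ n`, the blocks `y^k` and `x^k` are long enough to enter the respective cycles, so the
  -- answers tell which `a i` and `b i` accept.
  have hacc : ∀ {v w : List A} (hw : w ≠ []), T.mq v w = true ↔
      D.eval (v ++ (List.replicate k w).flatten) ∈ D.accept := fun hw => by
    rw [hT.mq_iff _ _ hw, hD.upWord_mem_iff_of_card_le hw (by simpa using hnk)]
  have hbacc : ∀ i < k, b i ∈ D.accept := fun i hi => by
    have := (hacc hx).mp (h i hi).1
    rwa [← hxk, DFA.eval, DFA.evalFrom_of_append] at this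
  have haacc : ∀ i < k, a i ∉ D.accept := fun i hi hm => by
    have : T.mq (u ++ (List.replicate i z).flatten) y = false := by
      rcases i with _ | i
      · simpa using hu
      · exact (h i (by omega)).2
    rw [← Bool.not_eq_true, hacc hy, ← hyk] at this
    exact this hm
  -- If `a i = a j`, the run returns from the accepting `b i` to the rejecting `a i`, against
  -- weakness.
  have hne : ∀ i j, i < j → j < k → a i ≠ a j := fun i j hij hj heq => by
    have hcyc : D.evalFrom (b i) ((List.replicate (j - i - 1) z).flatten ++ yk) = a i := by
      rw [heq, hb, ha]
      simp only [DFA.eval]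
      rw [← DFA.evalFrom_of_append, ← DFA.evalFrom_of_append]
      congr 1
      have : j = i + (1 + (j - i - 1)) := by omega
      conv_rhs => rw [this, DBA.flatten_replicate_add, DBA.flatten_replicate_add]
      simp [hz]
    exact haacc i (by omega) ((hD.accept_iff_of_cycle rfl hcyc).mpr (hbacc i (by omega)))
  have hinj : Function.Injective fun i : Fin n => a i := fun i j hij => by
    rcases lt_trichotomy i j with hlt | rfl | hlt
    · exact absurd hij (hne i j hlt (by omega))
    · rfl
    · exact absurd hij.symm (hne j i hlt (by omega))
  have hk : 0 < k := (card_pos D).trans_le hnk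
  -- The `n` distinct rejecting states exhaust `D` and leave no room for the accepting `b 0`. This
  -- gives the strict inequality, so `k` stays at most `n` even after its increase.
  obtain ⟨i, hi⟩ := Finite.surjective_of_injective hinj (b 0)
  simp only at hi
  exact haacc i (by omega) (hi ▸ hbacc 0 hk)

/-- The time of one round of `resolveConflict`. -/
def tResolveBody (M : ℕ) : ℕ := 1 + (2 * M + 1) + (2 * M + 1) + (M * (6 * M + 4) + 1) + 1

/-- A counterexample `(c, v)` obtained from loop words `x` and `y` of the state `u`. -/
structure Resolved (T : Teacher A) (n : ℕ) (R : List A → Prop) (u x y : List A)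
    (c : List A × List A) : Prop where
  closed : R c.1
  period : c.2 = x ∨ c.2 = y
  valid : T.mq c.1 c.2 ≠ T.mq u c.2
  length_le : c.1.length ≤ u.length + n * (n * (x.length + y.length))

theorem closed_flatten_replicate {R : List A → Prop} {w : List A} (h : ∀ p, R p → R (p ++ w)) (j : ℕ)
    {p : List A} (hp : R p) : R (p ++ (List.replicate j w).flatten) := by
  induction j generalizing p with
  | zero => simpa using hp
  | succ j ih =>
    rw [List.replicate_succ, List.flatten_cons, ← List.append_assoc]
    exact ih (h p hp)

/-- A failed round has query budget zero because the increase of `k` pays for it; a successful round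
is charged `2 * n`. The predicate `R` stands for any property of words preserved by appending the
two loops. -/
theorem WP.resolveBody [DecidableEq A] {D : DBA A (Fin n)} (hD : D.IsWeak)
    (hT : T.Truthful D.language) (hx : x ≠ []) (hy : y ≠ []) (hux : T.mq u x = true)
    (huy : T.mq u y = false) {R : List A → Prop} (hu : R u) (hRx : ∀ p, R p → R (p ++ x))
    (hRy : ∀ p, R p → R (p ++ y)) (hM : u.length + n * (n * (x.length + y.length)) ≤ M) (hnM : n ≤ M)
    {s : RunState} (hk : s.k ≤ n) :
    WP T (resolveBody u x y) s fun r s' =>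
      (∀ c, r = Sum.inr c → Resolved T n R u x y c ∧ Grow n s s' (tResolveBody M) (2 * n)) ∧
      (∀ c, r = Sum.inl c → Grow n s s' (tResolveBody M) 0 ∧ s'.k = s.k + 1) := by
  have hn := card_pos D
  have hz : s.k * (x.length + y.length) ≤ n * (x.length + y.length) := Nat.mul_le_mul_right _ hk
  have hz' : s.k * (s.k * (x.length + y.length)) ≤ n * (n * (x.length + y.length)) :=
    Nat.mul_le_mul hk hz
  have h1 : n * (x.length + y.length) ≤ n * (n * (x.length + y.length)) := Nat.le_mul_of_pos_left _ hn
  have h2 : x.length + y.length ≤ n * (x.length + y.length) := Nat.le_mul_of_pos_left _ hn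
  have hk3 : s.k * (6 * M + 4) ≤ M * (6 * M + 4) := Nat.mul_le_mul_right _ (hk.trans hnM)
  have hkx : s.k * (x.length + 1) = s.k * x.length + s.k := by ring
  have hky : s.k * (y.length + 1) = s.k * y.length + s.k := by ring
  have hkxy : s.k * (x.length + y.length) = s.k * x.length + s.k * y.length := by ring
  refine WP.bind ⟨_, _, rfl, ?_⟩
  set s₁ : RunState := { s with time := s.time + 1 } with hs₁
  -- With the bound `K := s.k`, `k_mono` and `k_le` together say that `k` does not change before
  -- `setK`.
  have hg₁ : Grow s.k s s₁ 1 0 := ⟨rfl, rfl, le_rfl, le_rfl, le_rfl, le_rfl⟩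
  refine WP.bind ((Spec.power (K := s.k) s₁ le_rfl).mono ?_)
  rintro yk s₂ ⟨hyk, hg₂⟩
  refine WP.bind ((Spec.power (K := s.k) s₂ hg₂.k_le).mono ?_)
  rintro xk s₃ ⟨hxk, hg₃⟩
  have hlen : (yk ++ xk).length = s.k * (x.length + y.length) := by
    rw [hyk, hxk, List.length_append, DBA.length_flatten_replicate, DBA.length_flatten_replicate]
    ring
  refine WP.bind ((Spec.resolveInner (K := s.k) (M := M) (r := s.k) (p := u) (x := x) (y := y)
    (by rw [hlen]; omega) (by omega) (by omega) s₃ hg₃.k_le).mono ?_)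
  rintro o s₄ ⟨ho, hg₄⟩
  have hg := (((hg₁.trans hg₂).trans hg₃).trans hg₄)
  have hRyk : ∀ p, R p → R (p ++ yk) := fun p hp => by
    rw [hyk]; exact closed_flatten_replicate hRy _ hp
  have hRz : ∀ p, R p → R (p ++ (yk ++ xk)) := fun p hp => by
    rw [← List.append_assoc, hxk]; exact closed_flatten_replicate hRx _ (hRyk p hp)
  rcases o with _ | c
  · have hlt : s.k < n := lt_of_unresolved hD hT hx hy hyk hxk huy (ho.2 rfl)
    have hk₄ : s₄.k = s.k := le_antisymm hg.k_le hg.k_mono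
    refine WP.bind ⟨_, _, rfl, WP.pure ⟨by simp, fun _ _ => ⟨⟨?_, ?_, ?_, ?_, ?_, ?_⟩, rfl⟩⟩⟩
    · exact hg.eqs
    · exact hg.maxCex
    · simp only; omega
    · simp only; omega
    · have h3 := hg.mqs
      -- The increase `2 * s.k + 1` of the potential covers the `2 * s.k` queries of the failed
      -- round.
      have h4 : (s.k + 1) ^ 2 = s.k ^ 2 + 2 * s.k + 1 := by ring
      rw [hk₄] at h3
      simp only [h4]
      omega
    · have := hg.time
      simp only [tResolveBody]
      omega
  · refine WP.pure ⟨?_, by simp⟩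
    rintro c ⟨⟩
    refine ⟨?_, (hg.mono_bound hk).mono (by simp only [tResolveBody]; omega) (by omega)⟩
    obtain ⟨j, hj, ⟨rfl, hc⟩ | ⟨rfl, hc⟩⟩ := ho.1 c rfl
    · refine ⟨hRyk _ (closed_flatten_replicate hRz _ hu), Or.inl rfl, ?_, ?_⟩
      · simp only at hc ⊢
        rw [hc, hux]
        simp
      · have h3 : (j + 1) * (yk ++ xk).length ≤ s.k * (yk ++ xk).length :=
          Nat.mul_le_mul_right _ (by omega)
        rw [Nat.add_one_mul] at h3
        rw [hlen] at h3
        have : yk.length ≤ (yk ++ xk).length := by simp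
        simp only
        rw [List.length_append, List.length_append, DBA.length_flatten_replicate, hlen]
        rw [hlen] at this
        omega
    · refine ⟨closed_flatten_replicate hRz _ hu, Or.inr rfl, ?_, ?_⟩
      · simp only at hc ⊢
        rw [hc, huy]
        simp
      · have h3 : (j + 1) * (yk ++ xk).length ≤ s.k * (yk ++ xk).length :=
          Nat.mul_le_mul_right _ (by omega)
        simp only
        rw [List.length_append, DBA.length_flatten_replicate]
        rw [hlen] at h3 ⊢
        omega

/-- Each failed round raises `k`, which never exceeds `n`, so `n - k` is a variant. Time is charged
to the growth of `k`, and only the final successful round contributes to the query budget. -/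
theorem Spec.resolveConflict [DecidableEq A] {D : DBA A (Fin n)} (hD : D.IsWeak)
    (hT : T.Truthful D.language) (hx : x ≠ []) (hy : y ≠ []) (hux : T.mq u x = true)
    (huy : T.mq u y = false) {R : List A → Prop} (hu : R u) (hRx : ∀ p, R p → R (p ++ x))
    (hRy : ∀ p, R p → R (p ++ y)) (hM : u.length + n * (n * (x.length + y.length)) ≤ M)
    (hnM : n ≤ M) :
    Spec n T (resolveConflict u x y) ((M + 1) * tResolveBody M) (2 * n) (Resolved T n R u x y) := by
  intro s hs
  refine WP.loop (fun _ s' => Grow n s s' ((s'.k - s.k) * tResolveBody M) 0) (fun _ s' => n - s'.k) ?_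
    ⟨rfl, rfl, le_rfl, hs, le_rfl, by omega⟩
  rintro _ s₁ hg
  refine (WP.resolveBody hD hT hx hy hux huy hu hRx hRy hM hnM hg.k_le).mono ?_
  rintro r s₂ ⟨h₁, h₂⟩
  have hk := hg.k_mono
  refine ⟨?_, ?_⟩
  · rintro c rfl
    obtain ⟨hg₂, hk₂⟩ := h₂ c rfl
    have := hg₂.k_le
    refine ⟨(hg.trans hg₂).mono ?_ le_rfl, by omega⟩
    rw [hk₂, Nat.sub_add_comm hk, Nat.add_one_mul]
  · rintro c rfl
    obtain ⟨hc, hg₂⟩ := h₁ c rfl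
    refine ⟨hc, (hg.trans hg₂).mono ?_ (by omega)⟩
    rw [Nat.add_one_mul]
    have := Nat.mul_le_mul_right (tResolveBody M) (show s₁.k - s.k ≤ M by have := hg.k_le; omega)
    omega

end Learner

namespace Learner

variable {A : Type} [DecidableEq A] {n m K M W : ℕ} {T : Teacher A} {δ : TransList A}
  {sig : List A} {u u₁ u₂ v x y z w : List A}

/-! ### Valid counterexamples -/

/-- The word `c.1 · c.2^ω` shows that the transition system is not correct. -/
structure IsCex (T : Teacher A) (δ : TransList A) (W : ℕ) (c : List A × List A) : Prop where
  ne_nil : c.2 ≠ []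
  valid : T.mq c.1 c.2 ≠ T.mq (reached δ [] c.1) c.2
  length_le : c.1.length + c.2.length ≤ W

theorem IsCex.mono {W' : ℕ} {c : List A × List A} (h : IsCex T δ W c) (hW : W ≤ W') :
    IsCex T δ W' c := ⟨h.ne_nil, h.valid, h.length_le.trans hW⟩

/-- A bound for the length of counterexamples that come from loop words of length at most `b`. -/
def cexBound (n b : ℕ) : ℕ := n + n * (n * (b + b)) + b

/-- A bound for the length of counterexamples. -/
def wordBound (n l : ℕ) : ℕ := cexBound n (2 * (n + 1) + (n + 1) * l)

theorem cexBound_mono {n b b' : ℕ} (h : b ≤ b') : cexBound n b ≤ cexBound n b' := by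
  unfold cexBound
  gcongr

theorem wordBound_mono {n l l' : ℕ} (h : l ≤ l') : wordBound n l ≤ wordBound n l' :=
  cexBound_mono (by gcongr)

/-- A linear lower bound that lets `omega` settle the length conditions below. -/
theorem add_le_cexBound {n b : ℕ} (hn : 0 < n) : n + 3 * b ≤ cexBound n b := by
  have : b + b ≤ n * (n * (b + b)) :=
    (Nat.le_mul_of_pos_left _ hn).trans (Nat.le_mul_of_pos_left _ hn)
  unfold cexBound
  omega

/-- Here `R` says that the transition system reaches `u`. The pumped words keep this property, so an
answer that differs from the one at `u` is a valid counterexample. -/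
theorem Spec.resolveConflict_of_loops {D : DBA A (Fin n)} (hD : D.IsWeak)
    (hT : T.Truthful D.language) (hδ : IsTS δ n m) (hu : u ∈ keys δ) (hx : x ≠ []) (hy : y ≠ [])
    (hux : T.mq u x = true) (huy : T.mq u y = false) (hxl : reached δ u x = u)
    (hyl : reached δ u y = u) {b : ℕ} (hxb : x.length ≤ b) (hyb : y.length ≤ b)
    (hM : cexBound n b ≤ M) :
    Spec n T (Learner.resolveConflict u x y) ((M + 1) * tResolveBody M) (2 * n)
      (IsCex T δ (cexBound n b)) := by
  have hul := hδ.key_lt u hu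
  have h₁ : n * (n * (x.length + y.length)) ≤ n * (n * (b + b)) := by gcongr
  have hM' := hM
  unfold cexBound at hM'
  refine (Spec.resolveConflict hD hT hx hy hux huy (R := fun p => reached δ [] p = u)
    (hδ.reached_self u hu) (fun p hp => by rw [reached_append, hp, hxl])
    (fun p hp => by rw [reached_append, hp, hyl]) (by omega) (by omega)).mono
    (fun c hc => ⟨?_, ?_, ?_⟩) le_rfl le_rfl
  · rcases hc.period with h | h <;> rw [h] <;> assumption
  · rw [hc.closed]
    exact hc.valid
  · have := hc.length_le
    unfold cexBound
    rcases hc.period with h | h <;> rw [h] <;> omega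

/-- The time of `resolveConflictState`. -/
def tResolveState (M : ℕ) : ℕ := 2 * tFindPath M + 10 * M + 10 + (M + 1) * tResolveBody M

/-- Both queries concern the same infinite word, since `z · (w · z)^ω = (z · w)^ω`. -/
theorem mq_rotate {L : Set (ℕ → A)} (hT : T.Truthful L) (hz : z ≠ []) :
    T.mq (u ++ z) (w ++ z) = T.mq u (z ++ w) := by
  have h₁ : w ++ z ≠ [] := by simp [hz]
  have h₂ : z ++ w ≠ [] := by simp [hz]
  rw [Bool.eq_iff_iff, hT.mq_iff _ _ h₁, hT.mq_iff _ _ h₂, DBA.upWord_rotate h₁ h₂]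

/-- The cycle through both states either disagrees with the loop word of `u₁` or with that of `u₂`,
or else its own answer is `⊤` at `u₁` and `⊥` at `u₂`. In the last case the rotated word `u₁ · z ·
(w · z)^ω` is in `L`, although `u₁ · z` leads to `u₂`. -/
theorem Spec.resolveConflictState {D : DBA A (Fin n)} (hD : D.IsWeak)
    (hT : T.Truthful D.language) (hδ : IsTS δ n m) (hmem : ∀ a : A, a ∈ sig) (hsig : sig.length ≤ M)
    (hm : m ≤ M) (hu₁ : u₁ ∈ keys δ) (hu₂ : u₂ ∈ keys δ) (hx : x ≠ []) (hy : y ≠ [])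
    (hux : T.mq u₁ x = true) (huy : T.mq u₂ y = false) (hxl : reached δ u₁ x = u₁)
    (hyl : reached δ u₂ y = u₂) (hxb : x.length ≤ n + 1) (hyb : y.length ≤ n + 1)
    (h₁₂ : ∃ v, v ≠ [] ∧ reached δ u₁ v = u₂) (h₂₁ : ∃ v, v ≠ [] ∧ reached δ u₂ v = u₁)
    (hM : cexBound n (2 * (n + 1)) ≤ M) :
    Spec n T (resolveConflictState δ sig u₁ u₂ x y) (tResolveState M) (2 * n + 2)
      (IsCex T δ (cexBound n (2 * (n + 1)))) := by
  have hb := add_le_cexBound (n := n) (b := 2 * (n + 1)) (card_pos D)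
  have hul₁ := hδ.key_lt u₁ hu₁
  have hul₂ := hδ.key_lt u₂ hu₂
  unfold tResolveState
  refine (Spec.findPath hδ (by omega) hm hu₁ hu₂ hmem hsig).bind (fun o₁ ho₁ => ?_) (by omega)
    (by omega)
  refine (Spec.findPath hδ (by omega) hm hu₂ hu₁ hmem hsig).bind (fun o₂ ho₂ => ?_) (by omega)
    (by omega)
  obtain ⟨z, rfl⟩ : ∃ z, o₁ = some z := by
    rcases o₁ with _ | z
    · obtain ⟨v, hv, hv'⟩ := h₁₂
      exact absurd hv' (ho₁.2 rfl v hv)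
    · exact ⟨z, rfl⟩
  obtain ⟨w, rfl⟩ : ∃ w, o₂ = some w := by
    rcases o₂ with _ | w
    · obtain ⟨v, hv, hv'⟩ := h₂₁
      exact absurd hv' (ho₂.2 rfl v hv)
    · exact ⟨w, rfl⟩
  obtain ⟨hz, hzl, hz'⟩ := ho₁.1 z rfl
  obtain ⟨hw, hwl, hw'⟩ := ho₂.1 w rfl
  simp only [Option.getD_some]
  refine Spec.cat.bind (fun _ h => ?_) (by omega) (by omega)
  subst h
  refine Spec.askMQ.bind (fun _ h => ?_) (by simp only [List.length_append]; omega) (by omega)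
  subst h
  by_cases hb₁ : T.mq u₁ (z ++ w) = false
  · rw [if_pos hb₁]
    exact (Spec.resolveConflict_of_loops hD hT hδ hu₁ hx (y := z ++ w) (by simp [hz]) hux hb₁ hxl
      (by rw [reached_append, hz', hw']) (by omega) (by simp only [List.length_append]; omega)
      hM).mono (fun _ h => h) (by simp only [List.length_append]; omega) (by omega)
  rw [if_neg hb₁]
  refine Spec.cat.bind (fun _ h => ?_) (by simp only [List.length_append]; omega) (by omega)
  subst h
  refine Spec.askMQ.bind (fun _ h => ?_) (by simp only [List.length_append]; omega) (by omega)
  subst h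
  by_cases hb₂ : T.mq u₂ (w ++ z) = true
  · rw [if_pos hb₂]
    exact (Spec.resolveConflict_of_loops hD hT hδ hu₂ (x := w ++ z) (by simp [hz]) hy hb₂ huy
      (by rw [reached_append, hw', hz']) hyl (by simp only [List.length_append]; omega) (by omega)
      hM).mono (fun _ h => h) (by simp only [List.length_append]; omega) (by omega)
  rw [if_neg hb₂]
  refine Spec.cat.bind (fun _ h => ?_) (by simp only [List.length_append]; omega) (by omega)
  subst h
  refine Spec.pure ⟨by simp [hz], ?_, ?_⟩
  · simp only
    rw [reached_append, hδ.reached_self u₁ hu₁, hz', mq_rotate hT hz, eq_false_of_ne_true hb₂]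
    simpa using hb₁
  · simp only [List.length_append]
    omega

/-! ### Marking the states -/

/-- `g` lists the states of `l` that have loop words, with a loop word and the answer to the query
for it. -/
structure IsMarking (T : Teacher A) (δ : TransList A) (n : ℕ) (l : TransList A) (g : Marks A) :
    Prop where
  sub : (keys g).Sublist (keys l)
  entry : ∀ e ∈ g, e.2.1 ≠ [] ∧ e.2.1.length ≤ n + 1 ∧ reached δ e.1 e.2.1 = e.1 ∧
    e.2.2 = T.mq e.1 e.2.1
  complete : ∀ u ∈ keys l, ∀ v, v ≠ [] → reached δ u v = u → u ∈ keys g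

/-- The time to mark the states. -/
def tMark (M : ℕ) : ℕ := M * (tFindPath M + 2 * M + 1) + 1

theorem Spec.mark (hδ : IsTS δ n m) (hmem : ∀ a : A, a ∈ sig) (hsig : sig.length ≤ M)
    (hm : m ≤ M) (hn : n + 1 ≤ M) :
    Spec K T (mark δ sig δ) (tMark M) n (IsMarking T δ n δ) := by
  suffices h : ∀ l : TransList A, keys l ⊆ keys δ → Spec K T (Learner.mark δ sig l)
      (l.length * (tFindPath M + 2 * M + 1) + 1) l.length (IsMarking T δ n l) from
    (h δ fun _ h => h).mono (fun _ h => h) (Nat.add_le_add_right (Nat.mul_le_mul_right _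
      (by have := hδ.length_le; omega)) 1) hδ.length_le
  intro l hl
  induction l with
  | nil => exact Spec.tick_pure ⟨by simp, by simp, by simp⟩ (by omega)
  | cons p l ih =>
    obtain ⟨u, r⟩ := p
    have hu : u ∈ keys δ := hl (by simp)
    have hul := hδ.key_lt u hu
    rw [List.length_cons, Nat.add_one_mul]
    refine (Spec.findPath hδ hn hm hu hu hmem hsig).bind (fun o ho => ?_) (by omega) (by omega)
    refine (ih fun q hq => hl (by simp [hq])).bind (fun g hg => ?_) (by omega) (by omega)
    rcases o with _ | v
    · refine Spec.pure ⟨hg.sub.trans (List.sublist_cons_self _ _), hg.entry, fun q hq v hv hqv => ?_⟩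
      rcases List.mem_cons.mp hq with rfl | hq
      · exact absurd hqv (ho.2 rfl v hv)
      · exact hg.complete q hq v hv hqv
    · obtain ⟨hv, hvl, hv'⟩ := ho.1 v rfl
      refine Spec.askMQ.bind (fun _ h => ?_) (by omega) (by omega)
      subst h
      refine Spec.pure ⟨hg.sub.cons_cons _, fun e he => ?_, fun q hq w hw hqw => ?_⟩
      · rcases List.mem_cons.mp he with rfl | he
        · exact ⟨hv, hvl, hv', rfl⟩
        · exact hg.entry e he
      · rcases List.mem_cons.mp hq with rfl | hq
        · simp
        · exact List.mem_cons_of_mem _ (hg.complete q hq w hw hqw)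

/-- The states `u₁` and `u₂` lie on a common cycle. -/
def Connected (δ : TransList A) (u₁ u₂ : List A) : Prop :=
  (∃ v, v ≠ [] ∧ reached δ u₁ v = u₂) ∧ ∃ v, v ≠ [] ∧ reached δ u₂ v = u₁

theorem IsPathOpt.isSome_iff {p q : List A} {b : ℕ} {o : Option (List A)}
    (h : IsPathOpt δ p q b o) : o.isSome = true ↔ ∃ v, v ≠ [] ∧ reached δ p v = q := by
  rcases o with _ | v
  · simpa using h.2 rfl
  · simpa using ⟨v, (h.1 v rfl).1, (h.1 v rfl).2.2⟩

theorem Spec.findRejecting (hδ : IsTS δ n m) (hmem : ∀ a : A, a ∈ sig) (hsig : sig.length ≤ M)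
    (hm : m ≤ M) (hn : n + 1 ≤ M) (hu₁ : u₁ ∈ keys δ) {g : Marks A} (hg : keys g ⊆ keys δ) :
    Spec K T (findRejecting δ sig u₁ g) (g.length * (2 * tFindPath M + 1) + 1) 0 fun o =>
      (∀ u₂ y, o = some (u₂, y) → (u₂, (y, false)) ∈ g ∧ Connected δ u₁ u₂) ∧
      (o = none → ∀ u₂ y, (u₂, (y, false)) ∈ g → ¬ Connected δ u₁ u₂) := by
  induction g with
  | nil => exact Spec.tick_pure (by simp) (by omega)
  | cons e g ih =>
    obtain ⟨u₂, y, b⟩ := e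
    have hu₂ : u₂ ∈ keys δ := hg (by simp)
    have ih := ih fun q hq => hg (by simp [hq])
    rw [List.length_cons, Nat.add_one_mul]
    by_cases hb : b = true
    · subst hb
      simp only [Learner.findRejecting, if_true]
      refine Spec.tick.bind (fun _ _ => ?_) (by omega) le_rfl
      exact ih.mono (fun o ho => ⟨fun u₂ y h => ⟨by simp [(ho.1 u₂ y h).1], (ho.1 u₂ y h).2⟩,
        fun h u₂ y hm => ho.2 h u₂ y (by simpa using hm)⟩) (by omega) le_rfl
    · obtain rfl : b = false := by simpa using hb
      simp only [Learner.findRejecting, Bool.false_eq_true, if_false]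
      refine (Spec.findPath hδ hn hm hu₁ hu₂ hmem hsig).bind (fun o₁ ho₁ => ?_) (by omega) le_rfl
      refine (Spec.findPath hδ hn hm hu₂ hu₁ hmem hsig).bind (fun o₂ ho₂ => ?_) (by omega) le_rfl
      have hiff : (o₁.isSome && o₂.isSome) = true ↔ Connected δ u₁ u₂ := by
        rw [Bool.and_eq_true, ho₁.isSome_iff, ho₂.isSome_iff]
        rfl
      by_cases hc : (o₁.isSome && o₂.isSome) = true
      · rw [if_pos hc]
        refine Spec.pure ⟨?_, by simp⟩
        rintro u₂ y ⟨⟩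
        exact ⟨by simp, hiff.mp hc⟩
      · rw [if_neg hc]
        refine ih.mono (fun o ho => ⟨fun u₂ y h => ⟨by simp [(ho.1 u₂ y h).1], (ho.1 u₂ y h).2⟩,
          fun h u y' hm => ?_⟩) (by omega) le_rfl
        rcases List.mem_cons.mp hm with h' | h'
        · obtain ⟨rfl, rfl⟩ := by simpa using h'
          exact fun hc' => hc (hiff.mpr hc')
        · exact ho.2 h u y' h'

/-- The time to find a conflict. -/
def tFindConflict (M : ℕ) : ℕ := M * (M * (2 * tFindPath M + 1) + 1 + 1) + 1

theorem Spec.findConflict (hδ : IsTS δ n m) (hmem : ∀ a : A, a ∈ sig) (hsig : sig.length ≤ M)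
    (hm : m ≤ M) (hn : n + 1 ≤ M) {g : Marks A} (hg : keys g ⊆ keys δ) (hgl : g.length ≤ M) :
    Spec K T (findConflict δ sig g g) (tFindConflict M) 0 fun o =>
      (∀ u₁ u₂ x y, o = some (u₁, u₂, x, y) →
        (u₁, (x, true)) ∈ g ∧ (u₂, (y, false)) ∈ g ∧ Connected δ u₁ u₂) ∧
      (o = none → ∀ u₁ u₂ x y, (u₁, (x, true)) ∈ g → (u₂, (y, false)) ∈ g →
        ¬ Connected δ u₁ u₂) := by
  suffices h : ∀ l : Marks A, l ⊆ g → Spec K T (Learner.findConflict δ sig g l)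
      (l.length * (M * (2 * tFindPath M + 1) + 1 + 1) + 1) 0 fun o =>
      (∀ u₁ u₂ x y, o = some (u₁, u₂, x, y) →
        (u₁, (x, true)) ∈ g ∧ (u₂, (y, false)) ∈ g ∧ Connected δ u₁ u₂) ∧
      (o = none → ∀ u₁ u₂ x y, (u₁, (x, true)) ∈ l → (u₂, (y, false)) ∈ g →
        ¬ Connected δ u₁ u₂) from
    (h g fun _ h => h).mono (fun _ h => h)
      (Nat.add_le_add_right (Nat.mul_le_mul_right _ hgl) 1) le_rfl
  intro l hl
  induction l with
  | nil => exact Spec.tick_pure (by simp) (by omega)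
  | cons e l ih =>
    obtain ⟨u₁, x, b⟩ := e
    have hu₁ : u₁ ∈ keys δ := hg (List.mem_map.mpr ⟨(u₁, x, b), hl (by simp), rfl⟩)
    have ih := ih fun q hq => hl (by simp [hq])
    have ht := Nat.mul_le_mul_right (2 * tFindPath M + 1) hgl
    rw [List.length_cons, Nat.add_one_mul]
    by_cases hb : b = false
    · subst hb
      simp only [Learner.findConflict, if_true]
      refine Spec.tick.bind (fun _ _ => ?_) (by omega) le_rfl
      exact ih.mono (fun o ho => ⟨ho.1, fun h u₁ u₂ x y hm => ho.2 h u₁ u₂ x y (by simpa using hm)⟩)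
        (by omega) le_rfl
    · obtain rfl : b = true := by simpa using hb
      simp only [Learner.findConflict, Bool.true_eq_false, if_false]
      refine (Spec.findRejecting hδ hmem hsig hm hn hu₁ hg).bind (fun o ho => ?_) (by omega) le_rfl
      rcases o with _ | ⟨u₂, y⟩
      · refine ih.mono (fun o' ho' => ⟨ho'.1, fun h u u₂ x' y hm hm' => ?_⟩) (by omega) le_rfl
        rcases List.mem_cons.mp hm with h' | h'
        · obtain ⟨rfl, rfl⟩ := by simpa using h'
          exact ho.2 rfl u₂ y hm'
        · exact ho'.2 h u u₂ x' y h' hm'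
      · refine Spec.pure ⟨?_, by simp⟩
        rintro u₁ u₂ x y ⟨⟩
        obtain ⟨h₁, h₂⟩ := ho.1 u₂ y rfl
        exact ⟨hl (by simp), h₁, h₂⟩

end Learner

namespace Learner

variable {A : Type} {n m K M W : ℕ} {T : Teacher A} {δ : TransList A}
  {sig : List A} {u v x y s : List A} {g : Marks A}

/-! ### The conjecture -/

/-- The conjecture with the marked transition system. -/
def conjectureOf (δ : TransList A) (g : Marks A) : Conjecture A where
  delta := δ
  acc := (g.filter fun p => p.2.2).map Prod.fst

theorem mem_acc_iff : u ∈ (conjectureOf δ g).acc ↔ ∃ v, (u, (v, true)) ∈ g := by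
  simp [conjectureOf]

theorem Spec.conjecture :
    Spec K T (conjecture δ g) (g.length + 1) 0 (· = conjectureOf δ g) :=
  Spec.tick_pure rfl le_rfl

variable [DecidableEq A]

/-- No accepting and rejecting states lie on a common cycle. -/
def ConflictFree (δ : TransList A) (g : Marks A) : Prop :=
  ∀ u₁ u₂ x y, (u₁, (x, true)) ∈ g → (u₂, (y, false)) ∈ g → ¬ Connected δ u₁ u₂

theorem IsMarking.exists_entry (hg : IsMarking T δ n δ g) (hu : u ∈ keys δ) (hv : v ≠ [])
    (huv : reached δ u v = u) : ∃ w b, (u, (w, b)) ∈ g := by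
  obtain ⟨⟨u', w, b⟩, he, rfl⟩ := List.mem_map.mp (hg.complete u hu v hv huv)
  exact ⟨w, b, he⟩

/-- A state connected to a different accepting one lies on a cycle, so it has a loop word and is
marked; a rejecting mark would be a conflict. Unmarked states therefore do no harm. -/
theorem ConflictFree.isWeak (hδ : IsTS δ n m) (hg : IsMarking T δ n δ g)
    (hc : ConflictFree δ g) : (conjectureOf δ g).toDBA.IsWeak := by
  intro C hC
  by_cases hdis : Disjoint C (conjectureOf δ g).toDBA.accept
  · exact Or.inr hdis
  refine Or.inl fun q hq => ?_
  obtain ⟨p, hp, hpa⟩ := Set.not_disjoint_iff.mp hdis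
  by_cases hpq : p = q
  · exact hpq ▸ hpa
  obtain ⟨u, v, hu, hv, h₁, h₂⟩ := hC p hp q hq hpq
  have e₁ : reached δ p.1 u = q.1 := (hδ.evalFrom_val p u).symm.trans (congrArg Subtype.val h₁)
  have e₂ : reached δ q.1 v = p.1 := (hδ.evalFrom_val q v).symm.trans (congrArg Subtype.val h₂)
  obtain ⟨w, b, hw⟩ := hg.exists_entry (u := q.1) (v := v ++ u) (hδ.mem_iff.mp q.2) (by simp [hu])
    (by rw [reached_append, e₂, e₁])
  obtain ⟨x, hx⟩ := mem_acc_iff.mp hpa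
  rcases b with _ | _
  · exact absurd ⟨⟨u, hu, e₁⟩, ⟨v, hv, e₂⟩⟩ (hc _ _ x w hx hw)
  · exact mem_acc_iff.mpr ⟨w, hw⟩

/-! ### Counterexample analysis -/

theorem Spec.findPeriod (hδ : IsTS δ n m) (hn : n ≤ M) (hm : m ≤ M) (hs : s ∈ keys δ)
    (hu : u.length ≤ M) {r : ℕ} (hv : v.length + r * y.length ≤ M)
    (hr : ∃ j, 0 < j ∧ j ≤ r ∧ reached δ s (List.replicate j y).flatten = u) :
    Spec K T (findPeriod δ u y r s v) (r * (M * tStep M + 3 * M + 3) + 1) 0 fun v' =>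
      ∃ j, 0 < j ∧ j ≤ r ∧ v' = v ++ (List.replicate j y).flatten ∧
        reached δ s (List.replicate j y).flatten = u := by
  induction r generalizing s v with
  | zero => obtain ⟨j, h₁, h₂, _⟩ := hr; omega
  | succ r ih =>
    rw [Nat.add_one_mul] at hv
    rw [Nat.add_one_mul]
    have hy : y.length * tStep M ≤ M * tStep M := Nat.mul_le_mul_right _ (by omega)
    have hs' : reached δ s y ∈ keys δ := hδ.reached_mem hs
    have hs'l := hδ.length_le_of_mem hn hs'
    refine (Spec.run hδ hn hm hs).bind (fun _ h => ?_) (by omega) le_rfl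
    subst h
    refine Spec.cat.bind (fun _ h => ?_) (by omega) le_rfl
    subst h
    refine Spec.same.bind (fun _ h => ?_) (by omega) le_rfl
    subst h
    by_cases hsu : reached δ s y = u
    · rw [if_pos (by simpa using hsu)]
      exact Spec.pure ⟨1, by omega, by omega, by simp, by simpa using hsu⟩
    rw [if_neg (by simpa using hsu)]
    have hstep : ∀ j, reached δ s (List.replicate (j + 1) y).flatten =
        reached δ (reached δ s y) (List.replicate j y).flatten := fun j => by
      rw [List.replicate_succ, List.flatten_cons, reached_append]
    refine (ih hs' (v := v ++ y) (by simp only [List.length_append]; omega) ?_).mono ?_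
      (by omega) le_rfl
    · obtain ⟨j, h₁, h₂, h₃⟩ := hr
      rcases j with _ | _ | j
      · omega
      · exact absurd (by simpa using h₃) hsu
      · exact ⟨j + 1, by omega, by omega, by rw [← hstep, h₃]⟩
    · rintro v' ⟨j, h₁, h₂, rfl, h₄⟩
      refine ⟨j + 1, by omega, by omega, ?_, by rw [hstep, h₄]⟩
      simp [List.replicate_succ]

/-- The time to analyse a counterexample. -/
def tAnalyse (M : ℕ) : ℕ :=
  M + 1 + (2 * M + 1) + (M + 1) + (M * tStep M + 1) + (M * (M * tStep M + 3 * M + 3) + 1) +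
    tLookup M + (2 * M + 1) + (M + 1) * tResolveBody M

/-- Appending `δ.length` copies of `y'` to `x'` puts the state `u` on the cycle of `y'`, and a power
`y` of `y'` loops there. The conjecture decides the word by the mark of `u`, and the teacher
contradicts it. If the query for `u · y^ω` agrees with the mark, `(x, y)` is already valid;
otherwise `y` and the loop word `g(u)` give different answers at `u`. -/
theorem Spec.analyse {D : DBA A (Fin n)} (hD : D.IsWeak) (hT : T.Truthful D.language)
    (hδ : IsTS δ n m) (hg : IsMarking T δ n δ g) (hc : ConflictFree δ g) {x' y' : List A}
    (hy' : y' ≠ []) (hcex : ¬ (upWord x' y' hy' ∈ (conjectureOf δ g).toDBA.language ↔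
      upWord x' y' hy' ∈ D.language)) (hm : m ≤ M)
    (hM : wordBound n (x'.length + y'.length) ≤ M) :
    Spec n T (analyse δ g x' y') (tAnalyse M) (2 * n + 1)
      (IsCex T δ (wordBound n (x'.length + y'.length))) := by
  -- The second summand covers the unrolled words `x` and `y`; the first covers the marking loop
  -- words, with room for a concatenation of two paths in `resolveConflictState`.
  set b := 2 * (n + 1) + (n + 1) * (x'.length + y'.length) with hb
  have hbM : n + 3 * b ≤ wordBound n (x'.length + y'.length) := add_le_cexBound (card_pos D)
  have hbe : b = 2 * (n + 1) + n * x'.length + n * y'.length + x'.length + y'.length := by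
    rw [hb]; ring
  have hδl := hδ.length_le
  have hδy : δ.length * y'.length ≤ n * y'.length := Nat.mul_le_mul_right _ hδl
  have hδy₁ : δ.length * (y'.length + 1) = δ.length * y'.length + δ.length := by ring
  have hnd : (keys g).Nodup := hδ.nodup.sublist hg.sub
  have hgl : g.length ≤ n := by simpa [keys] using hg.sub.length_le.trans (by simpa [keys] using hδl)
  have hweak := hc.isWeak hδ hg
  have hcard : Nat.card (conjectureOf δ g).State = δ.length := hδ.card_state _
  have := finite_state (conjectureOf δ g)
  obtain ⟨x, hx⟩ : ∃ x, x = x' ++ (List.replicate δ.length y').flatten := ⟨_, rfl⟩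
  obtain ⟨u, hu⟩ : ∃ u, u = reached δ [] x := ⟨_, rfl⟩
  have hu_mem : u ∈ keys δ := hu ▸ hδ.reached_mem hδ.nil_mem
  have hul := hδ.key_lt u hu_mem
  obtain ⟨r₀, hr₀, hr₁, hr₂⟩ := (conjectureOf δ g).toDBA.exists_cycle
    ((conjectureOf δ g).toDBA.eval x') y' hcard.le
  have he : ∀ w, (conjectureOf δ g).toDBA.evalFrom ((conjectureOf δ g).toDBA.eval x') w =
      (conjectureOf δ g).toDBA.eval (x' ++ w) := fun w => (DFA.evalFrom_of_append _ _ _ _).symm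
  rw [he] at hr₂
  have hxu : ((conjectureOf δ g).toDBA.eval x).1 = u := (hδ.eval_val _).trans hu.symm
  have hloop : reached δ u (List.replicate r₀ y').flatten = u := by
    rw [← hx] at hr₂
    rw [← hxu]
    exact (hδ.evalFrom_val _ _).symm.trans (congrArg Subtype.val hr₂)
  have hB : upWord x' y' hy' ∈ (conjectureOf δ g).toDBA.language ↔ u ∈ (conjectureOf δ g).acc := by
    rw [hweak.upWord_mem_iff hy' hr₀ hr₂, ← hx, ← hxu]
    rfl
  have hxl : x.length =
      x'.length + δ.length * y'.length := by
    rw [hx, List.length_append, DBA.length_flatten_replicate]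
  have hxt : x.length * tStep M ≤ M * tStep M :=
    Nat.mul_le_mul_right _ (by omega)
  have hpt : δ.length * (M * tStep M + 3 * M + 3) ≤ M * (M * tStep M + 3 * M + 3) :=
    Nat.mul_le_mul_right _ (by omega)
  unfold tAnalyse
  refine Spec.tick.bind (fun _ _ => ?_) (by omega) (by omega)
  refine Spec.power.bind (fun _ h => ?_) (by omega) (by omega)
  subst h
  refine Spec.cat.bind (fun _ h => ?_) (by omega) (by omega)
  rw [h.trans hx.symm]
  clear h
  refine (Spec.run hδ (M := M) (by omega) hm hδ.nil_mem).bind (fun _ h => ?_) (by omega) (by omega)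
  rw [h.trans hu.symm]
  clear h
  refine (Spec.findPeriod hδ (M := M) (by omega) hm hu_mem (by omega) (by simp; omega)
    ⟨r₀, hr₀, hr₁.trans hcard.le, hloop⟩).bind (fun y h => ?_) (by omega) (by omega)
  obtain ⟨j, hj, hjr, hy, hyl⟩ := h
  rw [List.nil_append] at hy
  have hylen : y.length ≤ n * y'.length := by
    rw [hy, DBA.length_flatten_replicate]
    exact Nat.mul_le_mul_right _ (hjr.trans hδl)
  rw [← hy] at hyl
  have hyne : y ≠ [] := by
    have : 0 < j * y'.length := Nat.mul_pos hj (List.length_pos_of_ne_nil hy')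
    rw [← DBA.length_flatten_replicate, ← hy] at this
    exact List.length_pos_iff.mp this
  have hmq : T.mq x y = true ↔
      upWord x' y' hy' ∈ D.language := by
    subst hy hx
    rw [hT.mq_iff _ _ hyne, DBA.upWord_unroll hy' hyne]
  refine (Spec.lookupWord (M := M) (by omega)
    (fun w hw => hδ.length_le_of_mem (by omega) (hg.sub.subset hw)) (by omega)).bind
      (fun o ho => ?_) (by omega) (by omega)
  rcases o with _ | ⟨v, c⟩
  -- The state `u` has the loop word `y`, so the marking contains it and this case cannot occur.
  · obtain ⟨w, b', hw⟩ := hg.exists_entry hu_mem hyne hyl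
    have := List.lookup_eq_none_iff.mp ho.symm _ hw
    simp at this
  have he := mem_of_lookup ho.symm
  have hev := hg.entry _ he
  simp only at hev
  obtain ⟨hv, hvl, hvu, hcv⟩ := hev
  have hacc : u ∈ (conjectureOf δ g).acc ↔ c = true := by
    rw [mem_acc_iff]
    refine ⟨fun ⟨w, hw⟩ => ?_, fun h => ⟨v, h ▸ he⟩⟩
    have := List.inj_on_of_nodup_map hnd he hw rfl
    simp only [Prod.mk.injEq] at this
    exact this.2.2
  rw [hB, hacc, ← hmq] at hcex
  have hres : IsCex T δ (wordBound n (x'.length + y'.length))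
      (x, y) ↔
        T.mq x y ≠ T.mq u y :=
    ⟨fun h => hu ▸ h.valid, fun h => ⟨hyne, hu ▸ h, by simp only; omega⟩⟩
  refine Spec.askMQ.bind (fun _ h => ?_) (by omega) (by omega)
  subst h
  by_cases hc₁ : c = true
  · have hf : T.mq x y = false := by
      simpa [hc₁] using hcex
    rw [if_pos hc₁]
    by_cases hc₂ : T.mq u y = true
    · rw [if_pos hc₂]
      exact Spec.pure (hres.mpr (by simp [hf, hc₂]))
    · rw [if_neg hc₂]
      exact (Spec.resolveConflict_of_loops hD hT hδ hu_mem hv hyne (hcv ▸ hc₁)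
        (eq_false_of_ne_true hc₂) hvu hyl (b := b) (by omega) (by omega) hM).mono (fun _ h => h)
        (by omega) (by omega)
  · have hf : T.mq x y = true := by
      by_contra h
      exact hcex (iff_of_false hc₁ h)
    rw [if_neg hc₁]
    by_cases hc₂ : T.mq u y = true
    · rw [if_pos hc₂]
      exact (Spec.resolveConflict_of_loops hD hT hδ hu_mem hyne hv hc₂
        (by rw [← hcv]; exact eq_false_of_ne_true hc₁) hyl hvu (b := b) (by omega) (by omega)
        hM).mono (fun _ h => h) (by omega) (by omega)
    · rw [if_neg hc₂]
      exact Spec.pure (hres.mpr (by simp [hf, hc₂]))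

end Learner

namespace Learner

variable {A : Type} [DecidableEq A] {n m K M W : ℕ} {T : Teacher A} {δ : TransList A}
  {sig : List A} {u v : List A} {ws : List (List A)} {es : List (List A × List A)}

/-! ### Refinement -/

/-- The answer to the query that the binary search asks at position `i`. -/
def answerAt (T : Teacher A) (δ : TransList A) (u v : List A) (i : ℕ) : Bool :=
  T.mq (reached δ [] (u.take i) ++ u.drop i) v

/-- The time of one round of the binary search. -/
def tSearch (M : ℕ) : ℕ := M + 1 + (M * tStep M + 1) + (M + 1) + (2 * M + 1)

/-- The invariant is that the answers at the two ends differ. If the interval has length at most `2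
^ (q + 1)`, both halves have length at most `2 ^ q`, also after rounding, so each halving uses one
query of the budget. -/
theorem Spec.search (hδ : IsTS δ n m) (hm : m ≤ M) (huv : n + u.length + v.length ≤ M)
    {b₀ : Bool} {lo hi q : ℕ} (hlt : lo < hi) (hhi : hi ≤ u.length) (hq : hi - lo ≤ 2 ^ q)
    (hlo : answerAt T δ u v lo = b₀) (hhi' : answerAt T δ u v hi ≠ b₀) :
    Spec K T (search δ u v b₀ lo hi) ((hi - lo) * tSearch M + 1) q fun i =>
      i < u.length ∧ answerAt T δ u v i ≠ answerAt T δ u v (i + 1) := by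
  induction hd : hi - lo using Nat.strong_induction_on generalizing lo hi q with
  | _ d ih =>
  rw [Learner.search]
  by_cases h : hi ≤ lo + 1
  · rw [dif_pos h]
    obtain rfl : hi = lo + 1 := by omega
    exact Spec.tick_pure ⟨by omega, by rw [hlo]; exact hhi'.symm⟩ (by omega)
  rw [dif_neg h]
  obtain ⟨q, rfl⟩ : ∃ q', q = q' + 1 := by
    rcases q with _ | q
    · simp at hq; omega
    · exact ⟨q, rfl⟩
  rw [pow_succ] at hq
  obtain ⟨mid, hmid⟩ : ∃ mid, mid = (lo + hi) / 2 := ⟨_, rfl⟩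
  simp only [← hmid]
  obtain ⟨e, rfl⟩ : ∃ e, d = e + 1 := ⟨d - 1, by omega⟩
  rw [Nat.add_one_mul]
  have hmid_len : (u.take mid).length * tStep M ≤ M * tStep M :=
    Nat.mul_le_mul_right _ (by rw [List.length_take]; omega)
  have hsl : (reached δ [] (u.take mid)).length < n :=
    hδ.key_lt _ (hδ.reached_mem hδ.nil_mem)
  have hdl : (u.drop mid).length ≤ u.length := by rw [List.length_drop]; omega
  refine Spec.tick.bind (fun _ _ => ?_) (by unfold tSearch; omega) (by omega)
  refine (Spec.run hδ (M := M) (by omega) hm hδ.nil_mem).bind (fun _ h => ?_)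
    (by unfold tSearch; omega) (by omega)
  subst h
  refine Spec.cat.bind (fun _ h => ?_) (by unfold tSearch; omega) (by omega)
  subst h
  refine Spec.askMQ.bind (fun _ h => ?_)
    (by rw [List.length_append]; unfold tSearch; omega) (by omega)
  subst h
  have hrec : ∀ d', d' ≤ e → d' * tSearch M ≤ e * tSearch M := fun d' h => Nat.mul_le_mul_right _ h
  by_cases hb : T.mq (reached δ [] (u.take mid) ++ u.drop mid) v = b₀
  · rw [if_pos hb]
    have := hrec (hi - mid) (by omega)
    exact (ih (hi - mid) (by omega) (q := q) (by omega) hhi (by omega) hb hhi' rfl).mono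
      (fun _ h => h) (by rw [List.length_append]; unfold tSearch at *; omega) (by omega)
  · rw [if_neg hb]
    have := hrec (mid - lo) (by omega)
    exact (ih (mid - lo) (by omega) (q := q) (by omega) (by omega) (by omega) hlo hb rfl).mono
      (fun _ h => h) (by rw [List.length_append]; unfold tSearch at *; omega) (by omega)

/-- The time of a refinement. -/
def tRefine (M : ℕ) : ℕ :=
  (M + 1) + (M + 1) + (M * tSearch M + 1) + (M + 1) + (M * tStep M + 1) + tAddExp M + (M + 1) +
    tAddState M

/-- Position `0` asks about the word itself and position `u.length` about the state reached, so
validity of the counterexample is what the search needs. At the flip, the remaining suffix with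
period `v` separates `s · a` from the `a`-successor of `s`, which share their old row. -/
theorem Spec.refine (hinv : TableInv T W ws es) (hmem : ∀ a : A, a ∈ sig)
    (hcl : IsClosedTable T sig ws es) (hn : ws.length ≤ n) {W' q : ℕ} (hW : W ≤ W')
    {c : List A × List A} (hc : IsCex T (deltaOf T sig ws es) W' c) (hq : c.1.length ≤ 2 ^ q)
    (hM : n + W' ≤ M) (hsig : sig.length ≤ M) :
    Spec K T (refine sig (tableOf T sig ws es) (deltaOf T sig ws es) c.1 c.2) (tRefine M)
      (1 + q + ws.length * (1 + sig.length) + (1 + sig.length) * (es.length + 1)) fun t =>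
        ∃ w e, t = tableOf T sig (w :: ws) (e :: es) ∧ TableInv T W' (w :: ws) (e :: es) := by
  obtain ⟨u, v⟩ := c
  have hδ := hinv.isTS hmem hcl hn
  have hkeys : keys (deltaOf T sig ws es) = ws := keys_deltaOf
  have hlen := hc.length_le
  have hesl := hinv.exps_lt
  simp only at hlen hq ⊢
  -- The empty word names the state it reaches, so it cannot be part of a valid counterexample.
  have hpos : 0 < u.length := by
    rcases u with _ | _
    · exact absurd rfl hc.valid
    · simp
  have h0 : answerAt T (deltaOf T sig ws es) u v 0 = T.mq u v := by simp [answerAt]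
  have h1 : answerAt T (deltaOf T sig ws es) u v u.length ≠ T.mq u v := by
    simpa [answerAt] using hc.valid.symm
  have ht₁ : (u.length - 0) * tSearch M ≤ M * tSearch M := Nat.mul_le_mul_right _ (by omega)
  unfold tRefine
  refine Spec.askMQ.bind (fun _ h => ?_) (by omega) (by omega)
  subst h
  refine Spec.tick.bind (fun _ _ => ?_) (by omega) (by omega)
  refine (Spec.search hδ (M := M) hsig (by omega) hpos le_rfl (q := q) (by omega) h0 h1).bind
    (fun i hi => ?_) (by omega) (by omega)
  obtain ⟨hiu, hne⟩ := hi
  have ht₂ : (u.take i).length * tStep M ≤ M * tStep M :=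
    Nat.mul_le_mul_right _ (by rw [List.length_take]; omega)
  refine Spec.tick.bind (fun _ _ => ?_) (by omega) (by omega)
  refine (Spec.run hδ (M := M) (by omega) hsig hδ.nil_mem).bind (fun _ h => ?_) (by omega)
    (by omega)
  subst h
  obtain ⟨s, hs⟩ : ∃ s, s = reached (deltaOf T sig ws es) [] (u.take i) := ⟨_, rfl⟩
  have hsm : s ∈ ws := by
    have := hδ.reached_mem (u := u.take i) hδ.nil_mem
    rwa [hkeys, ← hs] at this
  have hsl := hinv.length_lt s hsm
  rw [← hs]
  obtain ⟨a, u', hau⟩ : ∃ a u', u.drop i = a :: u' := ⟨_, _, List.drop_eq_getElem_cons hiu⟩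
  have hu'l : u'.length < u.length := by
    have := congrArg List.length hau
    simp only [List.length_drop, List.length_cons] at this
    omega
  have htake : u.take (i + 1) = u.take i ++ [a] := by
    rw [List.take_add, hau]
    rfl
  have hdrop : u.drop (i + 1) = u' := by
    rw [← List.drop_drop, hau]
    rfl
  simp only [answerAt, htake, hdrop, hau, reached_append, ← hs] at hne
  rw [hau]
  simp only
  refine (Spec.addExp (e := (u', v)) (M := M) (fun w hw => (hinv.length_lt w hw).trans_le (by omega))
    (by simp only; omega) (by omega) hsig).bind (fun _ h => ?_) (by omega) (by omega)
  subst h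
  refine Spec.cat.bind (fun _ h => ?_) (by omega) (by omega)
  subst h
  have hinv' := hinv.refine hW hsm (hkeys ▸ hδ.succ_mem s (hkeys.symm ▸ hsm) a)
    (vals_succ_deltaOf hmem hcl hsm) (e := (u', v)) hc.ne_nil (by simp only; omega)
    (by simpa using hne.symm)
  exact (Spec.addState (M := M) (by simp; omega)
    (fun e he => (hinv'.exps_length e he).trans (by omega)) (by simp; omega) hsig).mono
    (fun t ht => ⟨_, _, ht, hinv'⟩) (by omega) (by simp only [List.length_cons]; omega)

end Learner

namespace Learner

variable {A : Type} {n m M : ℕ} {T : Teacher A} {δ : TransList A}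
  {sig : List A} {ws : List (List A)} {es : List (List A × List A)} {g : Marks A}

/-! ### The size of conjectures -/

/-- A bound for the size of conjectures. -/
def tSize (M : ℕ) : ℕ := M * (M + 1 + M * (M + 2)) + M * (M + 1)

theorem sum_map_le {α : Type} {l : List α} {f : α → ℕ} {b c : ℕ} (hf : ∀ a ∈ l, f a ≤ b)
    (hl : l.length ≤ c) : (l.map f).sum ≤ c * b := by
  refine (List.sum_le_card_nsmul _ b ?_).trans ?_
  · intro a ha
    obtain ⟨a, h, rfl⟩ := List.mem_map.mp ha
    exact hf a h
  · simpa using Nat.mul_le_mul_right b hl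

theorem size_conjectureOf_le (hcl : IsClosedTable T sig ws es) (hws : ∀ w ∈ ws, w.length ≤ M)
    (hl : ws.length ≤ M) (hsig : sig.length ≤ M) (hg : keys g ⊆ ws) (hgl : g.length ≤ M) :
    (conjectureOf (deltaOf T sig ws es) g).size ≤ tSize M := by
  refine Nat.add_le_add (sum_map_le ?_ (by simpa [conjectureOf, deltaOf] using hl))
    (sum_map_le ?_ ?_)
  · intro p hp
    obtain ⟨w, hw, rfl⟩ := List.mem_map.mp hp
    refine Nat.add_le_add (Nat.add_le_add_right (hws w hw) 1)
      (sum_map_le ?_ (by simpa using hsig))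
    intro q hq
    obtain ⟨a, ha, rfl⟩ := List.mem_map.mp hq
    exact Nat.add_le_add_right (hws _ (rep_spec (hcl w hw a ha)).1) 2
  · intro w hw
    obtain ⟨v, hv⟩ := mem_acc_iff.mp hw
    exact Nat.add_le_add_right (hws w (hg (List.mem_map.mpr ⟨_, hv, rfl⟩))) 1
  · simp only [conjectureOf, List.length_map]
    exact (List.length_filter_le _ _).trans hgl

/-! ### The output -/

variable [DecidableEq A]

/-- The output is a weak automaton for the language, and it is the canonical one. -/
structure IsCanonical (D : DBA A (Fin n)) (B : Conjecture A) : Prop where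
  isWeak : B.toDBA.IsWeak
  language : B.toDBA.language = D.language
  card : Nat.card B.State = n
  surjective : Function.Surjective B.toDBA.eval
  eval_eq_iff : ∀ u v : List A, B.toDBA.eval u = B.toDBA.eval v ↔ RightCongr D.language u v

/-- The name of the state reached on `u` leads to the same state as `u`, hence is congruent to `u`.
Congruent words thus reach states with congruent names, and `hsep` makes these equal. -/
theorem isCanonical {D : DBA A (Fin n)} (hD : D.IsMinimalWeak) (hδ : IsTS δ n m)
    (hsep : ∀ p ∈ keys δ, ∀ q ∈ keys δ, RightCongr D.language p q → p = q)
    (hweak : (conjectureOf δ g).toDBA.IsWeak)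
    (hL : (conjectureOf δ g).toDBA.language = D.language) : IsCanonical D (conjectureOf δ g) := by
  have := finite_state (conjectureOf δ g)
  have hcard : Nat.card (conjectureOf δ g).State = δ.length := hδ.card_state _
  have hk : ∀ q : (conjectureOf δ g).State, q.1 ∈ keys δ := fun q => hδ.mem_iff.mp q.2
  have hself : ∀ q : (conjectureOf δ g).State, (conjectureOf δ g).toDBA.eval q.1 = q := fun q =>
    Subtype.ext ((hδ.eval_val _).trans (hδ.reached_self _ (hk q)))
  have hcongr : ∀ {u v}, (conjectureOf δ g).toDBA.eval u = (conjectureOf δ g).toDBA.eval v →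
      RightCongr D.language u v := fun h => hL ▸ hweak.rightCongr_of_eval_eq h
  refine ⟨hweak, hL, le_antisymm (hcard.le.trans hδ.length_le) (hD.card_le hweak hL),
    fun q => ⟨q.1, hself q⟩, fun u v => ⟨hcongr, fun h => Subtype.ext ?_⟩⟩
  refine hsep _ (hk _) _ (hk _) fun x y hy => ?_
  rw [hcongr (hself ((conjectureOf δ g).toDBA.eval u)) x y hy,
    hcongr (hself ((conjectureOf δ g).toDBA.eval v)) x y hy]
  exact h x y hy

/-! ### The main loop -/

/-- A bound for the lengths of all lists in a run with counterexamples of length at most `l`. -/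
def listBound (n c l : ℕ) : ℕ := wordBound n l + n + c + 1

/-- The time of the part of a round before the equivalence query. -/
def tPre (M : ℕ) : ℕ := (M + 1) * tCloseBody M + tBuildTS M + tMark M + tFindConflict M + M + 1

/-- The time of the part of a round from the equivalence query. -/
def tPost (M : ℕ) : ℕ :=
  tSize M + M + 1 + tResolveState M + tAnalyse M + tRefine M + tAddState M

/-- The number of membership queries in a round, apart from those that fill the table. -/
def roundQueries (n l : ℕ) : ℕ := n + (2 * n + 2) + (1 + Nat.clog 2 (wordBound n l))

/-- The bounds for a run with `w` representatives and `e` experiments. -/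
structure RunBounds (P : ℕ → ℕ) (n c w e : ℕ) (s : RunState) : Prop where
  eqs : s.eqs ≤ e
  k_le : s.k ≤ n
  mqs : s.mqs ≤ w * ((1 + c) * e) + s.k ^ 2 + e * roundQueries n s.maxCex
  time : s.time ≤ (2 * e + 1) * P (listBound n c s.maxCex)

theorem roundQueries_mono {n l l' : ℕ} (h : l ≤ l') : roundQueries n l ≤ roundQueries n l' :=
  Nat.add_le_add_left (Nat.add_le_add_left (Nat.clog_mono_right 2 (wordBound_mono h)) 1) _

theorem listBound_mono {n c l l' : ℕ} (h : l ≤ l') : listBound n c l ≤ listBound n c l' := by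
  have := wordBound_mono (n := n) h
  unfold listBound
  omega

/-- What holds after the loop. -/
structure IsResult (P : ℕ → ℕ) (D : DBA A (Fin n)) (c : ℕ) (B : Conjecture A) (s : RunState) :
    Prop where
  canonical : IsCanonical D B
  eqs : s.eqs ≤ n
  mqs : s.mqs ≤ n * ((1 + c) * n) + n ^ 2 + n * roundQueries n s.maxCex
  time : s.time ≤ (2 * n + 1) * P (listBound n c s.maxCex)

/-- All costs of a round are charged to the experiment it adds: two units of `P`, one for each side
of the equivalence query, and `roundQueries` membership queries. Table entries are counted
separately by the product in `RunBounds`. The final round adds no experiment but still fits, since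
`|E| < |S| ≤ n`. -/
theorem WP.mainBody {D : DBA A (Fin n)} (hD : D.IsMinimalWeak) (hT : T.Truthful D.language)
    (hmem : ∀ a : A, a ∈ sig) {P : ℕ → ℕ} (hP : Monotone P) (hpre : ∀ M, tPre M ≤ P M)
    (hpost : ∀ M, tPost M ≤ P M) {s : RunState} (hinv : TableInv T (wordBound n s.maxCex) ws es)
    (hb : RunBounds P n sig.length ws.length es.length s) :
    WP T (mainBody sig (tableOf T sig ws es)) s fun r s' =>
      (∀ t, r = Sum.inl t → ∃ ws' es', t = tableOf T sig ws' es' ∧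
        TableInv T (wordBound n s'.maxCex) ws' es' ∧
        RunBounds P n sig.length ws'.length es'.length s' ∧ es'.length = es.length + 1) ∧
      (∀ B, r = Sum.inr B → IsResult P D sig.length B s') := by
  have hn := distinguishesAtMost hD.1 hT
  obtain ⟨M, hM⟩ : ∃ M, M = listBound n sig.length s.maxCex := ⟨_, rfl⟩
  have hM' := hM
  unfold listBound at hM'
  refine WP.bind ((WP.close (M := M) hn hinv (by omega) (by omega) (by omega) hb.k_le).mono ?_)
  rintro _ s₁ ⟨ws', rfl, hinv', hcl, hle, hg₁⟩
  have hws' : ws'.length ≤ n := hn ws' es hinv'.exps_ne_nil hinv'.nodup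
  have hes' := hinv'.exps_lt
  have hδ := hinv'.isTS hmem hcl hws'
  have hkeys : keys (deltaOf T sig ws' es) = ws' := keys_deltaOf
  refine WP.bind ((Spec.buildTS (M := M) (by omega) (by omega) (by omega) hcl s₁ hg₁.k_le).mono ?_)
  rintro _ s₂ ⟨rfl, hg₂⟩
  refine WP.bind ((Spec.mark hδ (M := M) hmem (by omega) (by omega) (by omega) s₂ hg₂.k_le).mono ?_)
  rintro g s₃ ⟨hg, hg₃⟩
  have hgsub : keys g ⊆ keys (deltaOf T sig ws' es) := hg.sub.subset
  have hgl : g.length ≤ n := by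
    have := hg.sub.length_le
    rw [hkeys, keys, List.length_map] at this
    omega
  refine WP.bind ((Spec.findConflict hδ (M := M) hmem (by omega) (by omega) (by omega) hgsub
    (by omega) s₃ hg₃.k_le).mono ?_)
  rintro o s₄ ⟨ho, hg₄⟩
  have hG := ((hg₁.trans hg₂).trans hg₃).trans hg₄
  have hts : (n + 1) * tCloseBody M ≤ (M + 1) * tCloseBody M := Nat.mul_le_mul_right _ (by omega)
  have htable : ws.length * ((1 + sig.length) * es.length) +
      (ws'.length - ws.length) * ((1 + sig.length) * es.length) =
        ws'.length * ((1 + sig.length) * es.length) := by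
    rw [← Nat.add_mul, Nat.add_sub_cancel' hle]
  -- A refinement adds one column to the old rows and then one full row.
  have hgrow : (ws'.length + 1) * ((1 + sig.length) * (es.length + 1)) =
      ws'.length * ((1 + sig.length) * es.length) + ws'.length * (1 + sig.length) +
        (1 + sig.length) * (es.length + 1) := by ring
  have hpreM := hpre M
  have hbt := hb.time
  have hbm := hb.mqs
  have hGt := hG.time
  have hGm := hG.mqs
  rcases o with _ | ⟨u₁, u₂, x, y⟩
  · have hfree : ConflictFree (deltaOf T sig ws' es) g := ho.2 rfl
    have hweak := hfree.isWeak hδ hg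
    refine WP.bind ((Spec.conjecture (K := n) s₄ hG.k_le).mono ?_)
    rintro _ s₅ ⟨rfl, hg₅⟩
    have hG₅ := hG.trans hg₅
    have hGt₅ := hG₅.time
    have hGm₅ := hG₅.mqs
    have hpt : s₅.time ≤ (2 * es.length + 1) * P M + P M := by
      rw [← hM] at hbt
      unfold tPre at hpreM
      omega
    obtain ⟨a, ha⟩ : ∃ a, a = T.eq s₅.eqs (conjectureOf (deltaOf T sig ws' es) g) := ⟨_, rfl⟩
    refine WP.bind ⟨_, _, rfl, ?_⟩
    simp only [← ha]
    obtain ⟨s₆, hs₆⟩ : ∃ s₆ : RunState, s₆ = { s₅ with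
        time := s₅.time + ((conjectureOf (deltaOf T sig ws' es) g).size + answerLength a + 1)
        eqs := s₅.eqs + 1
        maxCex := max s₅.maxCex (answerLength a) } := ⟨_, rfl⟩
    rw [← hs₆]
    have hcex₆ : s₆.maxCex = max s.maxCex (answerLength a) := by rw [hs₆, ← hG₅.maxCex]
    have hlM : listBound n sig.length s.maxCex ≤ listBound n sig.length s₆.maxCex :=
      listBound_mono (by omega)
    obtain ⟨M₆, hM₆⟩ : ∃ M₆, M₆ = listBound n sig.length s₆.maxCex := ⟨_, rfl⟩
    have hM₆' := hM₆
    unfold listBound at hM₆'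
    rw [← hM, ← hM₆] at hlM
    have hPM := hP hlM
    have hans : answerLength a + n ≤ M₆ := by
      have h₁ := add_le_cexBound (n := n) (b := 2 * (n + 1) + (n + 1) * s₆.maxCex) (card_pos D)
      have h₂ : (n + 1) * s₆.maxCex = n * s₆.maxCex + s₆.maxCex := by ring
      have h₃ : answerLength a ≤ s₆.maxCex := by omega
      unfold wordBound at hM₆'
      omega
    have hsize := size_conjectureOf_le (M := M₆) (g := g) hcl
      (fun w hw => ((hinv'.length_lt w hw).le.trans hws').trans (by omega)) (by omega) (by omega)
      (by rw [← hkeys]; exact hgsub) (by omega)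
    -- A longer counterexample raises all bounds; what was spent before is estimated anew with the
    -- larger one.
    have hmul : (2 * es.length + 1) * P M ≤ (2 * es.length + 1) * P M₆ :=
      Nat.mul_le_mul_left _ hPM
    have hR : roundQueries n s.maxCex ≤ roundQueries n s₆.maxCex := roundQueries_mono (by omega)
    have hRm : es.length * roundQueries n s.maxCex ≤ es.length * roundQueries n s₆.maxCex :=
      Nat.mul_le_mul_left _ hR
    have hqn : n + (2 * n + 2) + (1 + Nat.clog 2 (wordBound n s₆.maxCex)) =
      roundQueries n s₆.maxCex := rfl
    have hpostM := hpost M₆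
    unfold tPost at hpostM
    have ht₆ : s₆.time = s₅.time + ((conjectureOf (deltaOf T sig ws' es) g).size +
      answerLength a + 1) := by rw [hs₆]
    have hm₆ : s₆.mqs = s₅.mqs := by rw [hs₆]
    have hk₆ : s₆.k = s₅.k := by rw [hs₆]
    have hk₆' : s₆.k ^ 2 = s₅.k ^ 2 := by rw [hk₆]
    have he₆ : s₆.eqs = s.eqs + 1 := by rw [hs₆, ← hG₅.eqs]
    have heb := hb.eqs
    have hGk := hG₅.k_le
    rcases a with _ | ⟨x, y⟩
    · refine WP.pure ⟨by simp, ?_⟩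
      rintro _ ⟨⟩
      have hsep : ∀ p ∈ keys (deltaOf T sig ws' es), ∀ q ∈ keys (deltaOf T sig ws' es),
          RightCongr D.language p q → p = q := by
        rw [hkeys]
        exact fun p hp q hq hpq => List.inj_on_of_nodup_map hinv'.nodup hp hq
          (vals_eq_of_rightCongr hT hinv'.exps_ne_nil hpq)
      have hen : es.length + 1 ≤ n := by omega
      refine ⟨isCanonical hD hδ hsep hweak (hT.eq_none _ _ hweak ha.symm), by omega, ?_, ?_⟩
      · have h₁ : ws'.length * ((1 + sig.length) * es.length) ≤ n * ((1 + sig.length) * n) :=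
          Nat.mul_le_mul hws' (Nat.mul_le_mul_left _ (by omega))
        have h₂ : s₅.k ^ 2 ≤ n ^ 2 := Nat.pow_le_pow_left hGk 2
        have h₃ := Nat.mul_le_mul_right (roundQueries n s₆.maxCex) hen
        rw [Nat.add_one_mul] at h₃
        omega
      · have h₃ := Nat.mul_le_mul_right (P M₆) (show 2 * es.length + 1 + 2 ≤ 2 * n + 1 by omega)
        rw [← hM₆]
        rw [Nat.add_mul (2 * es.length + 1)] at h₃
        omega
    · have hxy : x.length + y.length ≤ s₆.maxCex := by rw [hcex₆]; exact le_max_right _ _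
      obtain ⟨hy, hcex⟩ := hT.eq_some _ _ x y hweak ha.symm
      have hwb := wordBound_mono (n := n) hxy
      refine WP.bind ((Spec.analyse hD.1 hT hδ hg hfree hy hcex (M := M₆) (by omega) (by omega) s₆
        (by omega)).mono ?_)
      rintro c s₇ ⟨hc, hg₇⟩
      have hc' := hc.mono hwb
      refine WP.bind ((Spec.refine (M := M₆) hinv' hmem hcl hws' (wordBound_mono (by omega)) hc'
        (((Nat.le_add_right _ _).trans hc'.length_le).trans (Nat.le_pow_clog (by norm_num) _))
        (by omega) (by omega) s₇ hg₇.k_le).mono ?_)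
      rintro _ s₈ ⟨⟨w, e, rfl, hinv''⟩, hg₈⟩
      have hG₈ := hg₇.trans hg₈
      have hGt₈ := hG₈.time
      have hGm₈ := hG₈.mqs
      refine WP.pure ⟨?_, by simp⟩
      rintro _ ⟨⟩
      refine ⟨_, _, rfl, hG₈.maxCex.symm ▸ hinv'', ⟨?_, hG₈.k_le, ?_, ?_⟩, rfl⟩
      · rw [hG₈.eqs, he₆]
        simpa using heb
      · rw [hG₈.maxCex, List.length_cons, List.length_cons, hgrow, Nat.add_one_mul]
        omega
      · rw [hG₈.maxCex, ← hM₆, List.length_cons]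
        have h₃ : (2 * (es.length + 1) + 1) * P M₆ = (2 * es.length + 1) * P M₆ + P M₆ + P M₆ := by
          ring
        omega
  · obtain ⟨h₁, h₂, h₃⟩ := ho.1 u₁ u₂ x y rfl
    obtain ⟨hx, hxl, hxu, hxm⟩ := hg.entry _ h₁
    obtain ⟨hy, hyl, hyu, hym⟩ := hg.entry _ h₂
    have hcb : cexBound n (2 * (n + 1)) ≤ wordBound n s.maxCex := cexBound_mono (by omega)
    refine WP.bind ((Spec.resolveConflictState hD.1 hT hδ hmem (M := M) (by omega) (by omega)
      (hgsub (List.mem_map.mpr ⟨_, h₁, rfl⟩)) (hgsub (List.mem_map.mpr ⟨_, h₂, rfl⟩)) hx hy hxm.symm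
      hym.symm hxu hyu hxl hyl h₃.1 h₃.2 (by omega) s₄ hG.k_le).mono ?_)
    rintro c s₇ ⟨hc, hg₇⟩
    have hc' := hc.mono hcb
    refine WP.bind ((Spec.refine (M := M) hinv' hmem hcl hws' le_rfl hc'
      (((Nat.le_add_right _ _).trans hc'.length_le).trans (Nat.le_pow_clog (by norm_num) _))
      (by omega) (by omega) s₇ hg₇.k_le).mono ?_)
    rintro _ s₈ ⟨⟨w, e, rfl, hinv''⟩, hg₈⟩
    have hG₈ := hG.trans (hg₇.trans hg₈)
    have hGt₈ := hG₈.time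
    have hGm₈ := hG₈.mqs
    have hqn : n + (2 * n + 2) + (1 + Nat.clog 2 (wordBound n s.maxCex)) =
      roundQueries n s.maxCex := rfl
    refine WP.pure ⟨?_, by simp⟩
    rintro _ ⟨⟩
    refine ⟨_, _, rfl, hG₈.maxCex.symm ▸ hinv'', ⟨?_, hG₈.k_le, ?_, ?_⟩, rfl⟩
    · rw [hG₈.eqs]
      have := hb.eqs
      simp only [List.length_cons]
      omega
    · rw [hG₈.maxCex, List.length_cons, List.length_cons, hgrow, Nat.add_one_mul]
      omega
    · rw [← hM] at hbt
      rw [hG₈.maxCex, ← hM, List.length_cons]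
      have h₃ : (2 * (es.length + 1) + 1) * P M = (2 * es.length + 1) * P M + P M + P M := by ring
      have := hpost M
      unfold tPost at this
      unfold tPre at hpreM
      omega

/-- Each continuing round adds an experiment and there are always fewer than `n`, so `n - |E|` is a
variant. -/
theorem WP.learn {D : DBA A (Fin n)} (hD : D.IsMinimalWeak) (hT : T.Truthful D.language)
    (hmem : ∀ a : A, a ∈ sig) {P : ℕ → ℕ} (hP : Monotone P) (hpre : ∀ M, tPre M ≤ P M)
    (hpost : ∀ M, tPost M ≤ P M) :
    WP T (learn sig) RunState.initial fun B s => IsResult P D sig.length B s := by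
  have hpos := card_pos D
  refine WP.bind ((Spec.addState (K := n) (M := listBound n sig.length 0) (ws := []) (es := [])
    (w := []) (by simp [listBound]) (by simp) (by simp) (by simp [listBound]; omega)
    RunState.initial (by simp [RunState.initial]; omega)).mono ?_)
  rintro _ s₀ ⟨rfl, hg₀⟩
  have hcex₀ : s₀.maxCex = 0 := hg₀.maxCex
  refine WP.loop (fun t s => ∃ ws es, t = tableOf T sig ws es ∧
      TableInv T (wordBound n s.maxCex) ws es ∧
      RunBounds P n sig.length ws.length es.length s) (fun t _ => n - t.exps.length) ?_
    ⟨[[]], [], rfl, ⟨by simp, by simp, by simp, by simp, by simp, by simp, by simp⟩,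
      ⟨hg₀.eqs.le, hg₀.k_le, ?_, ?_⟩⟩
  · rintro _ s ⟨ws, es, rfl, hinv, hb⟩
    refine (WP.mainBody hD hT hmem hP hpre hpost hinv hb).mono fun r s' h => ⟨?_, h.2⟩
    intro t ht
    obtain ⟨ws', es', rfl, hinv', hb', hlen⟩ := h.1 t ht
    have h₁ := distinguishesAtMost hD.1 hT ws es hinv.exps_ne_nil hinv.nodup
    have h₂ := hinv.exps_lt
    exact ⟨⟨ws', es', rfl, hinv', hb'⟩, by simp only [tableOf]; omega⟩
  · have := hg₀.mqs
    have h₁ := hg₀.k_mono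
    simp [RunState.initial] at this ⊢
    omega
  -- The initial `addState` is paid by the `+ 1` in `(2 * e + 1) * P`.
  · have h₁ := hg₀.time
    have h₂ := hpost (listBound n sig.length 0)
    rw [hcex₀]
    simp [RunState.initial] at h₁ ⊢
    unfold tPost at h₂
    omega

end Learner

namespace Learner

/-! ### The empty alphabet -/

/-- Without letters there are no loop words and no counterexamples, so the first conjecture is
accepted before any membership query. The general estimate does not give zero, hence the explicit
run. -/
theorem WP.learn_nil {A : Type} [DecidableEq A] [IsEmpty A] {L : Set (ℕ → A)} {T : Teacher A}
    (hT : T.Truthful L) : WP T (Learner.learn []) RunState.initial fun _ s => s.mqs = 0 := by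
  obtain ⟨B, hB⟩ : ∃ B : Conjecture A, B = conjectureOf [([], [])] [] := ⟨_, rfl⟩
  have hnone : T.eq 0 B = none := by
    rcases h : T.eq 0 B with _ | ⟨x, y⟩
    · rfl
    · obtain ⟨hy, _⟩ := hT.eq_some 0 B x y
        (fun C _ => Or.inr (Set.disjoint_left.mpr fun q _ hq => by
          obtain ⟨v, hv⟩ := mem_acc_iff.mp (hB ▸ hq : q.1 ∈ (conjectureOf [([], [])] []).acc)
          simp at hv)) h
      exact absurd (Subsingleton.elim y []) hy
  -- The second component of each run state is the exact step count, checked by evaluating the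
  -- program.
  refine WP.bind ⟨tableOf T [] [[]] [], ⟨1, 2, 0, 0, 0⟩, rfl, ?_⟩
  suffices h : WP T (Learner.mainBody [] (tableOf T [] [[]] [])) ⟨1, 2, 0, 0, 0⟩ fun r s =>
      r = Sum.inr B ∧ s.mqs = 0 by
    obtain ⟨r, s, h, rfl, hs⟩ := h
    exact ⟨B, s, loop_eq_of_iterate (n := 1) (by rw [iterate_succ, h]; rfl), hs⟩
  refine WP.bind ⟨tableOf T [] [[]] [], ⟨1, 4, 0, 0, 0⟩,
    loop_eq_of_iterate (n := 1) (by rw [iterate_succ]; rfl), ?_⟩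
  refine WP.bind ⟨[([], [])], ⟨1, 6, 0, 0, 0⟩, rfl, ?_⟩
  refine WP.bind ⟨[], ⟨1, 13, 0, 0, 0⟩, rfl, ?_⟩
  refine WP.bind ⟨none, ⟨1, 14, 0, 0, 0⟩, rfl, ?_⟩
  refine WP.bind ⟨B, ⟨1, 15, 0, 0, 0⟩, hB ▸ rfl, ?_⟩
  refine WP.bind ⟨T.eq 0 B, _, rfl, ?_⟩
  rw [hnone]
  exact WP.pure ⟨rfl, rfl⟩

/-! ### Polynomial bounds -/

/-- The function is bounded by a polynomial. -/
def PolyBounded (f : ℕ → ℕ) : Prop := ∃ C d, ∀ M, f M ≤ C * (M + 1) ^ d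

theorem PolyBounded.const (c : ℕ) : PolyBounded fun _ => c := ⟨c, 0, fun M => by simp⟩

theorem PolyBounded.id : PolyBounded fun M => M := ⟨1, 1, fun M => by simp⟩

theorem PolyBounded.mul {f g : ℕ → ℕ} (hf : PolyBounded f) (hg : PolyBounded g) :
    PolyBounded fun M => f M * g M := by
  obtain ⟨C₁, d₁, h₁⟩ := hf
  obtain ⟨C₂, d₂, h₂⟩ := hg
  refine ⟨C₁ * C₂, d₁ + d₂, fun M => (Nat.mul_le_mul (h₁ M) (h₂ M)).trans (le_of_eq ?_)⟩
  ring

theorem PolyBounded.add {f g : ℕ → ℕ} (hf : PolyBounded f) (hg : PolyBounded g) :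
    PolyBounded fun M => f M + g M := by
  obtain ⟨C₁, d₁, h₁⟩ := hf
  obtain ⟨C₂, d₂, h₂⟩ := hg
  refine ⟨C₁ + C₂, d₁ + d₂, fun M => (Nat.add_le_add (h₁ M) (h₂ M)).trans ?_⟩
  rw [Nat.add_mul]
  gcongr <;> omega

theorem polyBounded_tLookup : PolyBounded tLookup := by
  unfold tLookup
  repeat' first
    | exact .const _ | exact .id | apply PolyBounded.add | apply PolyBounded.mul

theorem polyBounded_tStep : PolyBounded tStep := by
  unfold tStep
  repeat' first
    | exact .const _ | exact .id | exact polyBounded_tLookup | apply PolyBounded.add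

theorem polyBounded_tFindPath : PolyBounded tFindPath := by
  unfold tFindPath tExtendAll tExtend
  repeat' first
    | exact .const _ | exact .id | exact polyBounded_tLookup | exact polyBounded_tStep
    | apply PolyBounded.add | apply PolyBounded.mul

theorem polyBounded_tAddState : PolyBounded tAddState := by
  unfold tAddState
  repeat' first
    | exact .const _ | exact .id | apply PolyBounded.add | apply PolyBounded.mul

theorem polyBounded_tPre : PolyBounded tPre := by
  unfold tPre tCloseBody tBuildTS tMark tFindConflict tFindRow
  repeat' first
    | exact .const _ | exact .id | exact polyBounded_tFindPath | exact polyBounded_tAddState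
    | apply PolyBounded.add | apply PolyBounded.mul

theorem polyBounded_tPost : PolyBounded tPost := by
  unfold tPost tSize tResolveState tAnalyse tRefine tSearch tAddExp tResolveBody
  repeat' first
    | exact .const _ | exact .id | exact polyBounded_tFindPath | exact polyBounded_tAddState
    | exact polyBounded_tLookup | exact polyBounded_tStep
    | apply PolyBounded.add | apply PolyBounded.mul

/-! ### Explicit constants for the query and time bounds -/

theorem wordBound_le {n l N : ℕ} (hn : n ≤ N) (hl : l ≤ N) (hN : 1 ≤ N) :
    wordBound n l ≤ 19 * N ^ 4 := by
  have hb : 2 * (n + 1) + (n + 1) * l ≤ 6 * N ^ 2 :=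
    calc 2 * (n + 1) + (n + 1) * l ≤ 2 * (N + N) + (N + N) * N := by gcongr
      _ = 4 * N + 2 * N ^ 2 := by ring
      _ ≤ 4 * N ^ 2 + 2 * N ^ 2 := by gcongr; exact Nat.le_self_pow two_ne_zero N
      _ = 6 * N ^ 2 := by ring
  calc wordBound n l ≤ N + N * (N * (6 * N ^ 2 + 6 * N ^ 2)) + 6 * N ^ 2 := by
        unfold wordBound cexBound
        gcongr
    _ = N ^ 1 + 12 * N ^ 4 + 6 * N ^ 2 := by ring
    _ ≤ N ^ 4 + 12 * N ^ 4 + 6 * N ^ 4 := by gcongr <;> omega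
    _ = 19 * N ^ 4 := by ring

/-- The estimate `n ≤ 2 ^ n` is crude but harmless: the term `4 * n`, asked in each of at most `n`
rounds, disappears in `n ^ 2 * |Σ|`. The constant `9` is `5` from `19 ≤ 2 ^ 5` and `4` from the
fourth power of `2`. -/
theorem clog_wordBound_le {n l : ℕ} (hn : 1 ≤ n) :
    Nat.clog 2 (wordBound n l) ≤ 9 + 4 * n + 4 * Nat.log 2 l := by
  refine Nat.clog_le_of_le_pow ((wordBound_le (N := n + l) (by omega) (by omega) (by omega)).trans ?_)
  have h₁ : n + l ≤ 2 ^ n * 2 ^ (Nat.log 2 l + 1) := by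
    have h₂ : n ≤ 2 ^ n := Nat.lt_two_pow_self.le
    have h₃ : l + 1 ≤ 2 ^ (Nat.log 2 l + 1) := Nat.lt_pow_succ_log_self (by norm_num) l
    calc n + l ≤ n * (l + 1) := by nlinarith
      _ ≤ _ := Nat.mul_le_mul h₂ h₃
  calc 19 * (n + l) ^ 4 ≤ 2 ^ 5 * (2 ^ n * 2 ^ (Nat.log 2 l + 1)) ^ 4 := by gcongr; norm_num
    _ = 2 ^ (9 + 4 * n + 4 * Nat.log 2 l) := by
      rw [← pow_add, ← pow_mul, ← pow_add]
      congr 1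
      ring

theorem natLog_le_two_mul_log (l : ℕ) : (Nat.log 2 l : ℝ) ≤ 2 * Real.log l := by
  have h₁ : (Nat.log 2 l : ℝ) ≤ Real.logb 2 l := by exact_mod_cast Real.natLog_le_logb l 2
  have h₂ : 0 ≤ Real.log l := Real.log_natCast_nonneg l
  have h₃ : Real.log l / Real.log 2 ≤ 2 * Real.log l := by
    rw [div_le_iff₀ (Real.log_pos one_lt_two)]
    nlinarith [Real.log_two_gt_d9]
  exact h₁.trans h₃

/-- The constant is `22 + 4 * 2`, the factor `2` coming from the change to the natural logarithm.
The hypothesis `1 ≤ c` absorbs the terms in `n ^ 2` without a factor `c`. -/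
theorem queries_le_max {n c l q : ℕ} (hn : 1 ≤ n) (hc : 1 ≤ c)
    (hq : q ≤ n * ((1 + c) * n) + n ^ 2 + n * roundQueries n l) :
    (q : ℝ) ≤ 30 * max ((n : ℝ) ^ 2 * c) (n * Real.log l) := by
  have h₁ : q ≤ 22 * (n ^ 2 * c) + 4 * (n * Nat.log 2 l) := by
    have h₂ : roundQueries n l ≤ 7 * n + 12 + 4 * Nat.log 2 l := by
      have := clog_wordBound_le (l := l) hn
      unfold roundQueries
      omega
    have h₃ := Nat.mul_le_mul_left n h₂
    have h₄ : n ≤ n ^ 2 := Nat.le_self_pow two_ne_zero n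
    have h₅ : n ^ 2 ≤ n ^ 2 * c := Nat.le_mul_of_pos_right _ hc
    have h₆ : n * ((1 + c) * n) = n ^ 2 + n ^ 2 * c := by ring
    have h₇ : n * (7 * n + 12 + 4 * Nat.log 2 l) =
      7 * n ^ 2 + 12 * n + 4 * (n * Nat.log 2 l) := by ring
    omega
  have h₂ : (q : ℝ) ≤ 22 * ((n : ℝ) ^ 2 * c) + 4 * (n * (Nat.log 2 l : ℝ)) := by exact_mod_cast h₁
  have h₃ : (n : ℝ) * (Nat.log 2 l : ℝ) ≤ n * (2 * Real.log l) :=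
    mul_le_mul_of_nonneg_left (natLog_le_two_mul_log l) (Nat.cast_nonneg n)
  have h₄ := le_max_left ((n : ℝ) ^ 2 * c) (n * Real.log l)
  have h₅ := le_max_right ((n : ℝ) ^ 2 * c) (n * Real.log l)
  linarith

theorem time_le {n c l t C d : ℕ} (hn : 1 ≤ n)
    (ht : t ≤ (2 * n + 1) * (C * (listBound n c l + 1) ^ d)) :
    t ≤ 3 * C * 23 ^ d * (n + c + l) ^ (4 * d + 1) := by
  obtain ⟨N, hN⟩ : ∃ N, N = n + c + l := ⟨_, rfl⟩
  have hN₁ : 1 ≤ N := by omega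
  have h₁ : listBound n c l + 1 ≤ 23 * N ^ 4 := by
    have := wordBound_le (n := n) (l := l) (N := N) (by omega) (by omega) hN₁
    have h₂ : N ≤ N ^ 4 := Nat.le_self_pow (by norm_num) N
    unfold listBound
    omega
  rw [← hN]
  calc t ≤ (2 * n + 1) * (C * (listBound n c l + 1) ^ d) := ht
    _ ≤ (3 * N) * (C * (23 * N ^ 4) ^ d) := by gcongr; omega
    _ = 3 * C * 23 ^ d * N ^ (4 * d + 1) := by ring

end Learner

theorem mainTheorem1 :
    ∃ C d : ℕ,
      ∀ {A : Type} [DecidableEq A] (sig : List A) (hnodup : sig.Nodup) (hmem : ∀ a : A, a ∈ sig)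
        {n : ℕ} (D : DBA A (Fin n)) (hD : D.IsMinimalWeak)
        (T : Teacher A) (hT : T.Truthful D.language),
        ∃ (B : Conjecture A) (s : RunState),
          -- the algorithm terminates with output `B`
          ((Learner.learn sig).run T).run RunState.initial = some (B, s) ∧
          -- correctness
          B.toDBA.IsWeak ∧ B.toDBA.language = D.language ∧
          -- the output is the canonical automaton
          Nat.card B.State = n ∧ Function.Surjective B.toDBA.eval ∧
          (∀ u v : List A, B.toDBA.eval u = B.toDBA.eval v ↔ RightCongr D.language u v) ∧
          -- the number of equivalence queries
          s.eqs ≤ n ∧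
          -- the number of membership queries
          (s.mqs : ℝ) ≤ C * max ((n : ℝ) ^ 2 * sig.length) (n * Real.log s.maxCex) ∧
          -- the running time
          s.time ≤ C * (n + sig.length + s.maxCex) ^ d := by
  obtain ⟨C₁, d₁, h₁⟩ := Learner.polyBounded_tPre
  obtain ⟨C₂, d₂, h₂⟩ := Learner.polyBounded_tPost
  -- The summand `30` serves the queries and the other one the time. Lengths are of fourth order in
  -- `n + |Σ| + ℓ`, and the `2 * n + 1` units of time give one more factor.
  refine ⟨30 + 3 * (C₁ + C₂) * 23 ^ (d₁ + d₂), 4 * (d₁ + d₂) + 1, ?_⟩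
  intro A _ sig hnodup hmem n D hD T hT
  have hn := Learner.card_pos D
  obtain ⟨B, s, hrun, hres⟩ := Learner.WP.learn hD hT hmem
    (P := fun M => (C₁ + C₂) * (M + 1) ^ (d₁ + d₂))
    (fun a b hab => by simp only; gcongr)
    (fun M => (h₁ M).trans (by gcongr <;> omega)) (fun M => (h₂ M).trans (by gcongr <;> omega))
  refine ⟨B, s, hrun, hres.canonical.isWeak, hres.canonical.language, hres.canonical.card,
    hres.canonical.surjective, hres.canonical.eval_eq_iff, hres.eqs, ?_,
    (Learner.time_le hn hres.time).trans (Nat.mul_le_mul_right _ (Nat.le_add_left _ _))⟩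
  have hmax : 0 ≤ max ((n : ℝ) ^ 2 * sig.length) (n * Real.log s.maxCex) :=
    le_max_of_le_left (by positivity)
  rcases sig with _ | ⟨a, sig⟩
  -- For the empty alphabet the maximum is only known to be nonnegative, so the query count must be
  -- exactly zero; the two descriptions of the run agree because it is deterministic.
  · have : IsEmpty A := ⟨fun a => by simpa using hmem a⟩
    obtain ⟨B', s', hrun', hs'⟩ := Learner.WP.learn_nil hT
    obtain ⟨-, rfl⟩ := Prod.mk.inj (Option.some.inj (hrun.symm.trans hrun'))
    rw [hs', Nat.cast_zero]
    positivity
  · refine (Learner.queries_le_max hn (by simp) hres.mqs).trans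
      (mul_le_mul_of_nonneg_right ?_ hmax)
    push_cast
    linarith [show (0 : ℝ) ≤ 3 * (C₁ + C₂) * 23 ^ (d₁ + d₂) by positivity]
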